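/- Let $\kappa>0$, $c>2\kappa$, and let $Q:\mathbb{R}\to\mathbb{R}$ be the solitary wave of the Camassa–Holm equation with speed $c$, centred at the origin: $Q\in C^2(\mathbb{R})$ is even, not identically zero, $Q(x)\to0$ as $|x|\to\infty$, and $$-cQ+cQ''+2\kappa Q+\tfrac32Q^2-\tfrac12(Q')^2-QQ''=0 .$$ Put $$M=\partial_x(Q-c)\partial_x+Q''-3Q+c-2\kappa,\qquad L=-\partial_xM\partial_x ,$$ where $L$ is regarded as an unbounded operator on $L^2(\mathbb{R})$ (complex-valued functions) with domain $H^4(\mathbb{R})$, and write $L_{\mathrm{odd}}$ for its restriction to odd functions, an operator on $L^2_{\mathrm{odd}}(\mathbb{R})$ with domain $H^4_{\mathrm{odd}}(\mathbb{R})$. Let $$X=L^2_{\mathrm{odd}}(\mathbb{R})\times H^2_{\mathrm{odd}}(\mathbb{R}),\qquad Y=H^2_{\mathrm{odd}}(\mathbb{R})\times H^4_{\mathrm{odd}}(\mathbb{R}),$$ with norms $\|W\|_X=\|W_1\|_{L^2}+\|W_2\|_{H^2}$ and $\|W\|_Y=\|W_1\|_{H^2}+\|W_2\|_{H^4}$,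 and let $\mathcal{L}:Y\subset X\to X$ be the unbounded operator $$\mathcal{L}=\begin{pmatrix}0&L\\1&0\end{pmatrix},\qquad \mathcal{L}(W_1,W_2)=(LW_2,W_1).$$ The resolvent set $\rho(T)$ of an operator $T$ consists of the $\mu\in\mathbb{C}$ for which $T-\mu$ maps the domain of $T$ bijectively onto the whole space with an inverse bounded in the norm of that space; the spectrum is the complement of $\rho(T)$. An eigenvalue $\mu$ is simple if its generalized eigenspace $\bigcup_n\ker(T-\mu)^n$ is one-dimensional. Then $L$ has exactly one negative eigenvalue $\lambda$, and: 1. the eigenvalues of $\mathcal{L}$ are exactly $\mathrm{i}\sqrt{|\lambda|}$ and $-\mathrm{i}\sqrt{|\lambda|}$, and both are simple; 2. every other point of the spectrum of $\mathcal{L}$ is real; 3. for every $\mu\in\mathbb{C}$, $\mu\in\rho(\mathcal{L})$ if and only if $\mu^2\in\rho(L_{\mathrm{odd}})$. -/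

import Mathlib

open MeasureTheory Filter Topology
open scoped ContDiff ENNReal BoundedContinuousFunction

noncomputable section

namespace CHKP

/-! ### Solitary waves of the Camassa-Holm equation -/

/-- `Q` is the profile of a solitary wave, with speed `c`, of the Camassa-Holm equation with
parameter `κ`: a nontrivial classical solution, tending to zero at `±∞`, of
`-cQ + cQ'' + 2κQ + (3/2)Q² - (1/2)Q'² - QQ'' = 0`. -/
structure IsSolitaryWave (κ c : ℝ) (Q : ℝ → ℝ) : Prop where
  contDiff : ContDiff ℝ 2 Q
  profile : ∀ x, -c * Q x + c * deriv (deriv Q) x + 2 * κ * Q x + 3 / 2 * Q x ^ 2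
    - 1 / 2 * deriv Q x ^ 2 - Q x * deriv (deriv Q) x = 0
  tendsto_atTop : Tendsto Q atTop (𝓝 0)
  tendsto_atBot : Tendsto Q atBot (𝓝 0)
  nontrivial : ∃ x, Q x ≠ 0

section Wave

/-- Boundedness of a real function. -/
def Bdd (a : ℝ → ℝ) : Prop := ∃ C, ∀ x, ‖a x‖ ≤ C

theorem Bdd.add {a b : ℝ → ℝ} (ha : Bdd a) (hb : Bdd b) : Bdd (fun x => a x + b x) := by
  obtain ⟨C, hC⟩ := ha
  obtain ⟨D, hD⟩ := hb
  exact ⟨C + D, fun x => (norm_add_le _ _).trans (add_le_add (hC x) (hD x))⟩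

theorem Bdd.mul {a b : ℝ → ℝ} (ha : Bdd a) (hb : Bdd b) : Bdd (fun x => a x * b x) := by
  obtain ⟨C, hC⟩ := ha
  obtain ⟨D, hD⟩ := hb
  refine ⟨C * D, fun x => ?_⟩
  rw [norm_mul]
  exact mul_le_mul (hC x) (hD x) (norm_nonneg _) ((norm_nonneg _).trans (hC x))

theorem Bdd.const (r : ℝ) : Bdd (fun _ => r) := ⟨‖r‖, fun _ => le_rfl⟩

variable {κ c : ℝ} {Q : ℝ → ℝ}

theorem IsSolitaryWave.hasDerivAt (hQ : IsSolitaryWave κ c Q) (x : ℝ) :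
    HasDerivAt Q (deriv Q x) x :=
  (hQ.contDiff.differentiable (by norm_num) x).hasDerivAt

theorem IsSolitaryWave.contDiff_deriv (hQ : IsSolitaryWave κ c Q) : ContDiff ℝ 1 (deriv Q) := by
  have h : ContDiff ℝ (1 + 1) Q := by
    have := hQ.contDiff
    norm_num
    exact this
  exact (contDiff_succ_iff_deriv.1 h).2.2

theorem IsSolitaryWave.hasDerivAt' (hQ : IsSolitaryWave κ c Q) (x : ℝ) :
    HasDerivAt (deriv Q) (deriv (deriv Q) x) x :=
  (hQ.contDiff_deriv.differentiable (by norm_num) x).hasDerivAt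

theorem IsSolitaryWave.energy (hQ : IsSolitaryWave κ c Q) (x : ℝ) :
    (c - Q x) * deriv Q x ^ 2 = Q x ^ 2 * (c - 2 * κ - Q x) := by
  set F : ℝ → ℝ := fun x => (c - Q x) * deriv Q x ^ 2 - Q x ^ 2 * (c - 2 * κ - Q x) with hF
  have hd : ∀ x, HasDerivAt F 0 x := by
    intro x
    have h1 := hQ.hasDerivAt x
    have h2 := hQ.hasDerivAt' x
    have h3 := ((h1.const_sub c).mul (h2.pow 2)).sub ((h1.pow 2).mul (h1.const_sub (c - 2 * κ)))
    refine h3.congr_deriv ?_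
    simp only [Pi.pow_apply]
    push_cast
    linear_combination (2 * deriv Q x) * hQ.profile x
  have hconst : ∀ y, F y = F x := fun y =>
    is_const_of_deriv_eq_zero (fun z => (hd z).differentiableAt) (fun z => (hd z).deriv) y x
  have hmvt : ∀ n : ℕ, ∃ ξ : ℝ, (n : ℝ) < ξ ∧ deriv Q ξ = Q (n + 1) - Q n := by
    intro n
    obtain ⟨ξ, hξ, h⟩ := exists_deriv_eq_slope Q (show (n : ℝ) < n + 1 by linarith)
      hQ.contDiff.continuous.continuousOn
      (hQ.contDiff.differentiable (by norm_num)).differentiableOn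
    refine ⟨ξ, hξ.1, ?_⟩
    rw [h]
    simp
  choose ξ hξ hξ' using hmvt
  have hξt : Tendsto ξ atTop atTop :=
    tendsto_atTop_mono (fun n => (hξ n).le) tendsto_natCast_atTop_atTop
  have hQξ : Tendsto (fun n => Q (ξ n)) atTop (𝓝 0) := hQ.tendsto_atTop.comp hξt
  have hQ'ξ : Tendsto (fun n => deriv Q (ξ n)) atTop (𝓝 0) := by
    simp only [hξ']
    have h1 : Tendsto (fun n : ℕ => Q ((n : ℝ) + 1)) atTop (𝓝 0) :=
      hQ.tendsto_atTop.comp (tendsto_atTop_add_const_right _ _ tendsto_natCast_atTop_atTop)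
    have h2 : Tendsto (fun n : ℕ => Q (n : ℝ)) atTop (𝓝 0) :=
      hQ.tendsto_atTop.comp tendsto_natCast_atTop_atTop
    simpa using h1.sub h2
  have hlim : Tendsto (fun n => F (ξ n)) atTop (𝓝 ((c - 0) * 0 ^ 2 - 0 ^ 2 * (c - 2 * κ - 0))) :=
    ((hQξ.const_sub c).mul (hQ'ξ.pow 2)).sub ((hQξ.pow 2).mul (hQξ.const_sub (c - 2 * κ)))
  simp only [hconst] at hlim
  have h0 := tendsto_nhds_unique tendsto_const_nhds hlim
  simp only [hF] at h0
  linarith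

theorem IsSolitaryWave.le (hκ : 0 < κ) (hc : 2 * κ < c) (hQ : IsSolitaryWave κ c Q) (x : ℝ) :
    Q x ≤ c - 2 * κ := by
  have hne : ∀ y, Q y ≠ c := by
    intro y hy
    have h := hQ.energy y
    rw [hy] at h
    have : 0 < c ^ 2 * κ := by
      have : 0 < c := by linarith
      positivity
    nlinarith
  have hlt : Q x < c := by
    by_contra! hx
    obtain ⟨y, hy⟩ := ((hQ.tendsto_atTop.eventually (gt_mem_nhds (show (0 : ℝ) < c by linarith)))).exists
    obtain ⟨z, hz⟩ := mem_range_of_exists_le_of_exists_ge hQ.contDiff.continuous ⟨y, hy.le⟩ ⟨x, hx⟩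
    exact hne z hz
  by_contra! h
  have h1 := hQ.energy x
  have h2 : 0 ≤ (c - Q x) * deriv Q x ^ 2 := mul_nonneg (by linarith) (sq_nonneg _)
  have h3 : 0 < Q x ^ 2 := pow_pos (by linarith) 2
  nlinarith

theorem IsSolitaryWave.bdd_inv (hκ : 0 < κ) (hc : 2 * κ < c) (hQ : IsSolitaryWave κ c Q) :
    Bdd (fun x => (c - Q x)⁻¹) := by
  refine ⟨(2 * κ)⁻¹, fun x => ?_⟩
  have h := hQ.le hκ hc x
  rw [norm_inv, Real.norm_of_nonneg (by linarith)]
  exact inv_anti₀ (by linarith) (by linarith)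

theorem IsSolitaryWave.deriv2_eq (hκ : 0 < κ) (hc : 2 * κ < c) (hQ : IsSolitaryWave κ c Q) :
    deriv (deriv Q) = fun x =>
      ((c - 2 * κ) * Q x + -(3 / 2) * (Q x * Q x) + 1 / 2 * (deriv Q x * deriv Q x))
        * (c - Q x)⁻¹ := by
  funext x
  have h := hQ.le hκ hc x
  have h' : c - Q x ≠ 0 := by
    have : 0 < c - Q x := by linarith
    exact this.ne'
  rw [eq_mul_inv_iff_mul_eq₀ h']
  linear_combination hQ.profile x

theorem IsSolitaryWave.smooth (hκ : 0 < κ) (hc : 2 * κ < c) (hQ : IsSolitaryWave κ c Q) :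
    ContDiff ℝ ∞ Q := by
  have key : ∀ n : ℕ, ContDiff ℝ (n + 2 : ℕ) Q := by
    intro n
    induction n with
    | zero => exact hQ.contDiff
    | succ n ih =>
      have ih1 : ContDiff ℝ ((n + 1 : ℕ) + 1) Q := by exact_mod_cast ih
      have hd : ContDiff ℝ (n + 1 : ℕ) (deriv Q) := (contDiff_succ_iff_deriv.1 ih1).2.2
      have h0 : ContDiff ℝ (n + 1 : ℕ) Q := ih1.of_le (by exact_mod_cast Nat.le_succ _)
      have hdd : ContDiff ℝ (n + 1 : ℕ) (deriv (deriv Q)) := by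
        rw [hQ.deriv2_eq hκ hc]
        refine ContDiff.mul (by fun_prop) (ContDiff.inv (by fun_prop) fun x => ?_)
        have := hQ.le hκ hc x
        have : 0 < c - Q x := by linarith
        exact this.ne'
      have hd2 : ContDiff ℝ ((n + 1 : ℕ) + 1) (deriv Q) :=
        contDiff_succ_iff_deriv.2 ⟨hd.differentiable (by simp), by simp, hdd⟩
      have hd2' : ContDiff ℝ (n + 2 : ℕ) (deriv Q) := by exact_mod_cast hd2
      have : ContDiff ℝ ((n + 2 : ℕ) + 1) Q :=
        contDiff_succ_iff_deriv.2 ⟨hQ.contDiff.differentiable (by norm_num), by simp, hd2'⟩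
      exact_mod_cast this
  rw [contDiff_infty]
  exact fun n => (key n).of_le (by exact_mod_cast Nat.le_add_right n 2)

theorem IsSolitaryWave.smooth_iter (hκ : 0 < κ) (hc : 2 * κ < c) (hQ : IsSolitaryWave κ c Q)
    (j : ℕ) : ContDiff ℝ ∞ (iteratedDeriv j Q) := by
  induction j with
  | zero => simpa using hQ.smooth hκ hc
  | succ j ih =>
    rw [iteratedDeriv_succ]
    exact (contDiff_infty_iff_deriv.1 ih).2

theorem IsSolitaryWave.bdd0 (hQ : IsSolitaryWave κ c Q) : Bdd Q := by
  have h : Tendsto Q (cocompact ℝ) (𝓝 0) := by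
    rw [cocompact_eq_atBot_atTop]
    exact hQ.tendsto_atBot.sup hQ.tendsto_atTop
  let f : ZeroAtInftyContinuousMap ℝ ℝ := ⟨⟨Q, hQ.contDiff.continuous⟩, h⟩
  exact ⟨‖f.toBCF‖, fun x => f.toBCF.norm_coe_le_norm x⟩

theorem IsSolitaryWave.bdd1 (hκ : 0 < κ) (hc : 2 * κ < c) (hQ : IsSolitaryWave κ c Q) :
    Bdd (deriv Q) := by
  have h : Bdd fun x => Q x * Q x * (c - 2 * κ + (-1) * Q x) * (c - Q x)⁻¹ :=
    ((hQ.bdd0.mul hQ.bdd0).mul ((Bdd.const _).add ((Bdd.const _).mul hQ.bdd0))).mul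
      (hQ.bdd_inv hκ hc)
  obtain ⟨C, hC⟩ := h
  refine ⟨C + 1, fun x => ?_⟩
  have h0 : 0 < c - Q x := by
    have := hQ.le hκ hc x
    linarith
  have h1 : deriv Q x ^ 2 = Q x * Q x * (c - 2 * κ + (-1) * Q x) * (c - Q x)⁻¹ := by
    rw [eq_mul_inv_iff_mul_eq₀ h0.ne']
    linear_combination hQ.energy x
  have h2 : deriv Q x ^ 2 ≤ C := by
    rw [h1]
    exact (le_abs_self _).trans (hC x)
  rw [Real.norm_eq_abs]
  nlinarith [sq_abs (deriv Q x), sq_nonneg (|deriv Q x| - 1), abs_nonneg (deriv Q x)]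

theorem IsSolitaryWave.bdd2 (hκ : 0 < κ) (hc : 2 * κ < c) (hQ : IsSolitaryWave κ c Q) :
    Bdd (deriv (deriv Q)) := by
  rw [hQ.deriv2_eq hκ hc]
  have h0 := hQ.bdd0
  have h1 := hQ.bdd1 hκ hc
  exact ((((Bdd.const _).mul h0).add ((Bdd.const _).mul (h0.mul h0))).add
    ((Bdd.const _).mul (h1.mul h1))).mul (hQ.bdd_inv hκ hc)

theorem IsSolitaryWave.bdd3 (hκ : 0 < κ) (hc : 2 * κ < c) (hQ : IsSolitaryWave κ c Q) :
    Bdd (deriv (deriv (deriv Q))) := by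
  have h0 := hQ.bdd0
  have h1 := hQ.bdd1 hκ hc
  have h2 := hQ.bdd2 hκ hc
  have e : deriv (deriv (deriv Q)) = fun x =>
      ((c - 2 * κ) * deriv Q x + (-3) * (Q x * deriv Q x)
        + 2 * (deriv Q x * deriv (deriv Q) x)) * (c - Q x)⁻¹ := by
    funext x
    have hpos : 0 < c - Q x := by
      have := hQ.le hκ hc x
      linarith
    rw [eq_mul_inv_iff_mul_eq₀ hpos.ne']
    have d0 := hQ.hasDerivAt x
    have d1 := hQ.hasDerivAt' x
    have d2 : HasDerivAt (deriv (deriv Q)) (deriv (deriv (deriv Q)) x) x := by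
      have := hQ.smooth_iter hκ hc 2
      rw [iteratedDeriv_succ, iteratedDeriv_one] at this
      exact (this.differentiable (by simp) x).hasDerivAt
    have hE : (fun x => (c - Q x) * deriv (deriv Q) x) = fun x =>
        (c - 2 * κ) * Q x + -(3 / 2) * (Q x * Q x) + 1 / 2 * (deriv Q x * deriv Q x) := by
      funext y
      linear_combination hQ.profile y
    have l := (d0.const_sub c).mul d2
    have r := ((d0.const_mul (c - 2 * κ)).add ((d0.mul d0).const_mul (-(3 / 2)))).add
      ((d1.mul d1).const_mul (1 / 2))
    have hlr := l.unique (r.congr_of_eventuallyEq (Eventually.of_forall fun y => congrFun hE y))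
    linear_combination hlr
  rw [e]
  exact ((((Bdd.const _).mul h1).add ((Bdd.const _).mul (h0.mul h1))).add
    ((Bdd.const _).mul (h1.mul h2))).mul (hQ.bdd_inv hκ hc)

theorem IsSolitaryWave.bdd_iter (hκ : 0 < κ) (hc : 2 * κ < c) (hQ : IsSolitaryWave κ c Q)
    (j : Fin 4) : Bdd (iteratedDeriv j Q) := by
  fin_cases j
  · simpa using hQ.bdd0
  · simpa using hQ.bdd1 hκ hc
  · simpa [iteratedDeriv_succ] using hQ.bdd2 hκ hc
  · simpa [iteratedDeriv_succ] using hQ.bdd3 hκ hc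

/-- The derivatives `Q, Q', Q'', Q'''` of a solitary wave as bounded continuous functions. -/
def waveDeriv (hκ : 0 < κ) (hc : 2 * κ < c) (hQ : IsSolitaryWave κ c Q) (j : Fin 4) : ℝ →ᵇ ℝ :=
  BoundedContinuousFunction.ofNormedAddCommGroup (iteratedDeriv j Q)
    (hQ.smooth_iter hκ hc j).continuous _ (hQ.bdd_iter hκ hc j).choose_spec

end Wave

/-! ### Sobolev spaces on the line -/

/-- The Hilbert space `L²(ℝ)` of complex-valued functions. -/
abbrev L2 : Type := Lp ℂ 2 (volume : Measure ℝ)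

/-- `g` is the weak derivative of `f` on the real line. -/
def HasWeakDeriv (f g : ℝ → ℂ) : Prop :=
  ∀ φ : ℝ → ℝ, ContDiff ℝ ∞ φ → HasCompactSupport φ →
    ∫ x, deriv φ x • f x = -∫ x, φ x • g x

theorem integrable_test (f : L2) {φ : ℝ → ℝ} (hφ : Continuous φ) (hs : HasCompactSupport φ) :
    Integrable fun x => φ x • f x :=
  ((Lp.memLp f).locallyIntegrable one_le_two).integrable_smul_left_of_hasCompactSupport hφ hs

theorem integrable_test_deriv (f : L2) {φ : ℝ → ℝ} (hφ : ContDiff ℝ ∞ φ)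
    (hs : HasCompactSupport φ) : Integrable fun x => deriv φ x • f x :=
  integrable_test f (contDiff_infty_iff_deriv.1 hφ).2.continuous hs.deriv

theorem HasWeakDeriv.congr {f f' g g' : ℝ → ℂ} (h : HasWeakDeriv f g) (hf : f' =ᵐ[volume] f)
    (hg : g' =ᵐ[volume] g) : HasWeakDeriv f' g' := by
  intro φ hφ hs
  have h1 : ∫ x, deriv φ x • f' x = ∫ x, deriv φ x • f x :=
    integral_congr_ae (hf.mono fun x hx => by simp only [hx])
  have h2 : ∫ x, φ x • g' x = ∫ x, φ x • g x :=
    integral_congr_ae (hg.mono fun x hx => by simp only [hx])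
  rw [h1, h2]
  exact h φ hφ hs

theorem HasWeakDeriv.add {f f' g g' : L2} (h : HasWeakDeriv f g) (h' : HasWeakDeriv f' g') :
    HasWeakDeriv (f + f' : L2) (g + g' : L2) := by
  refine HasWeakDeriv.congr (f := fun x => f x + f' x) (g := fun x => g x + g' x) ?_
    (Lp.coeFn_add f f') (Lp.coeFn_add g g')
  intro φ hφ hs
  simp only [smul_add]
  rw [integral_add (integrable_test_deriv f hφ hs) (integrable_test_deriv f' hφ hs),
    integral_add (integrable_test g hφ.continuous hs) (integrable_test g' hφ.continuous hs),
    h φ hφ hs, h' φ hφ hs]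
  ring

theorem HasWeakDeriv.smul {f g : L2} (a : ℂ) (h : HasWeakDeriv f g) :
    HasWeakDeriv (a • f : L2) (a • g : L2) := by
  refine HasWeakDeriv.congr (f := fun x => a • f x) (g := fun x => a • g x) ?_
    (Lp.coeFn_smul a f) (Lp.coeFn_smul a g)
  intro φ hφ hs
  have e (r : ℝ) (z : ℂ) : r • a • z = a • r • z := smul_comm _ _ _
  simp only [e]
  rw [integral_smul, integral_smul, h φ hφ hs, smul_neg]

theorem HasWeakDeriv.zero : HasWeakDeriv (0 : L2) (0 : L2) :=
  HasWeakDeriv.congr (f := fun _ => (0 : ℂ)) (g := fun _ => (0 : ℂ))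
    (fun φ _ _ => by simp) (Lp.coeFn_zero ℂ 2 volume) (Lp.coeFn_zero ℂ 2 volume)

theorem HasWeakDeriv.unique {f g g' : L2} (h : HasWeakDeriv f g) (h' : HasWeakDeriv f g') :
    g = g' := by
  have hz : ∀ᵐ x, (g - g' : L2) x = 0 := by
    refine ae_eq_zero_of_integral_contDiff_smul_eq_zero
      ((Lp.memLp _).locallyIntegrable one_le_two) fun φ hφ hs => ?_
    have e : ∫ x, φ x • (g - g' : L2) x = ∫ x, (φ x • g x - φ x • g' x) :=
      integral_congr_ae ((Lp.coeFn_sub g g').mono fun x hx => by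
        simp only [hx, Pi.sub_apply, smul_sub])
    rw [e, integral_sub (integrable_test g hφ.continuous hs)
      (integrable_test g' hφ.continuous hs)]
    have := h φ hφ hs
    rw [h' φ hφ hs] at this
    rw [neg_injective this, sub_self]
  have : g - g' = 0 := by
    rw [Lp.eq_zero_iff_ae_eq_zero]
    exact hz
  exact sub_eq_zero.1 this

/-- The Sobolev space `H^k(ℝ)`. An element `f` is recorded together with its weak derivatives, as
`(f, f', …, f^(k))`, and normed by `‖f‖² = ∑_{j ≤ k} ‖f^(j)‖²`, with `L²` norms on the right. -/
def Sobolev (k : ℕ) : Submodule ℂ (PiLp 2 fun _ : Fin (k + 1) => L2) where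
  carrier := {u | ∀ j : Fin k, HasWeakDeriv (u j.castSucc) (u j.succ)}
  zero_mem' := fun _ => HasWeakDeriv.zero
  add_mem' := fun hu hv j => (hu j).add (hv j)
  smul_mem' := fun a _ hu j => (hu j).smul a

/-- The `j`-th weak derivative of an element of `H^k(ℝ)`, `j ≤ k`. -/
def jet (k : ℕ) (j : Fin (k + 1)) : Sobolev k →ₗ[ℂ] L2 where
  toFun u := (u : PiLp 2 fun _ : Fin (k + 1) => L2) j
  map_add' _ _ := rfl
  map_smul' _ _ := rfl

theorem jet_weakDeriv (k : ℕ) (u : Sobolev k) (j : Fin k) :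
    HasWeakDeriv (jet k j.castSucc u) (jet k j.succ u) := u.2 j

/-- An element of `H^k(ℝ)` is determined by its underlying `L²` function. -/
theorem jet_zero_injective (k : ℕ) : Function.Injective (jet k 0) := by
  intro u v h
  have key : ∀ j : Fin (k + 1), jet k j u = jet k j v := by
    intro j
    induction j using Fin.induction with
    | zero => exact h
    | succ j ih =>
      have hu := jet_weakDeriv k u j
      rw [ih] at hu
      exact hu.unique (jet_weakDeriv k v j)
  exact Subtype.ext (PiLp.ext key)

/-- The inclusion `H^m(ℝ) ⊆ H^k(ℝ)`, `k ≤ m`. -/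
def incl {k m : ℕ} (h : k ≤ m) : Sobolev m →ₗ[ℂ] Sobolev k where
  toFun u := ⟨WithLp.toLp 2 fun j => jet m (j.castLE (Nat.succ_le_succ h)) u,
    fun j => jet_weakDeriv m u (j.castLE h)⟩
  map_add' _ _ := rfl
  map_smul' _ _ := rfl

/-- The derivative `∂ₓ : H^{k+1}(ℝ) → H^k(ℝ)`. -/
def dx (k : ℕ) : Sobolev (k + 1) →ₗ[ℂ] Sobolev k where
  toFun u := ⟨WithLp.toLp 2 fun j => jet (k + 1) j.succ u,
    fun j => jet_weakDeriv (k + 1) u j.succ⟩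
  map_add' _ _ := rfl
  map_smul' _ _ := rfl

theorem neg_ae {p : ℝ → Prop} (h : ∀ᵐ x : ℝ, p x) : ∀ᵐ x : ℝ, p (-x) :=
  (Measure.measurePreserving_neg (volume : Measure ℝ)).quasiMeasurePreserving.ae h

/-- The functions in `L²(ℝ)` with `f(-x) = s f(x)`, for a sign `s`. -/
def L2parity (s : ℂ) : Submodule ℂ L2 where
  carrier := {f | ∀ᵐ x : ℝ, f (-x) = s * f x}
  zero_mem' := by
    have h := Lp.coeFn_zero ℂ 2 (volume : Measure ℝ)
    filter_upwards [h, neg_ae h] with x h1 h2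
    rw [h1, h2]
    simp
  add_mem' := by
    intro f g hf hg
    have h := Lp.coeFn_add f g
    filter_upwards [hf, hg, h, neg_ae h] with x h1 h2 h3 h4
    rw [h3, h4]
    simp only [Pi.add_apply, h1, h2]
    ring
  smul_mem' := by
    intro a f hf
    have h := Lp.coeFn_smul a f
    filter_upwards [hf, h, neg_ae h] with x h1 h3 h4
    rw [h3, h4]
    simp only [Pi.smul_apply, h1, smul_eq_mul]
    ring

/-- The space `L²_odd(ℝ)`. -/
abbrev L2odd : Submodule ℂ L2 := L2parity (-1)

/-- The space `H^k_odd(ℝ)` of odd functions in `H^k(ℝ)`. -/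
def SobolevOdd (k : ℕ) : Submodule ℂ (PiLp 2 fun _ : Fin (k + 1) => L2) where
  carrier := {u | u ∈ Sobolev k ∧ u 0 ∈ L2odd}
  zero_mem' := ⟨(Sobolev k).zero_mem, L2odd.zero_mem⟩
  add_mem' := fun hu hv => ⟨(Sobolev k).add_mem hu.1 hv.1, L2odd.add_mem hu.2 hv.2⟩
  smul_mem' := fun a _ hu => ⟨(Sobolev k).smul_mem a hu.1, L2odd.smul_mem a hu.2⟩

/-- The inclusion `H^k_odd(ℝ) ⊆ H^k(ℝ)`. -/
def oddIncl (k : ℕ) : SobolevOdd k →ₗ[ℂ] Sobolev k :=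
  Submodule.inclusion fun _ hu => hu.1

theorem oddIncl_injective (k : ℕ) : Function.Injective (oddIncl k) :=
  Submodule.inclusion_injective _

theorem HasWeakDeriv.parity {f g : L2} {s : ℂ} (h : HasWeakDeriv f g) (hf : f ∈ L2parity s) :
    g ∈ L2parity (-s) := by
  let r : L2 → L2 := fun f =>
    Lp.compMeasurePreserving Neg.neg (Measure.measurePreserving_neg (volume : Measure ℝ)) f
  have hr : ∀ f : L2, (r f : ℝ → ℂ) =ᵐ[volume] fun x => f (-x) := fun f =>
    Lp.coeFn_compMeasurePreserving f _
  have hf' : r f = s • f := by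
    refine Lp.ext ?_
    filter_upwards [hr f, Lp.coeFn_smul s f, hf] with x h1 h2 h3
    rw [h1, h2, h3]
    rfl
  have hw : HasWeakDeriv (r f) ((-1 : ℂ) • r g : L2) := by
    refine HasWeakDeriv.congr (f := fun x => f (-x)) (g := fun x => -g (-x)) ?_ (hr f) ?_
    · intro φ hφ hs
      have hφ' : ContDiff ℝ ∞ fun x => φ (-x) := hφ.comp contDiff_neg
      have hs' : HasCompactSupport fun x => φ (-x) := hs.comp_homeomorph (Homeomorph.neg ℝ)
      have e := h _ hφ' hs'
      have d : ∀ x, deriv (fun x => φ (-x)) x = -deriv φ (-x) := fun x => deriv_comp_neg φ x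
      have e1 : ∫ x, deriv φ x • f (-x) = ∫ x, deriv φ (-x) • f x := by
        rw [← integral_neg_eq_self]
        simp
      have e2 : ∫ x, φ x • g (-x) = ∫ x, φ (-x) • g x := by
        rw [← integral_neg_eq_self]
        simp
      simp only [d, neg_smul, integral_neg] at e
      simp only [smul_neg, integral_neg]
      rw [e1, e2, neg_injective e, neg_neg]
    · filter_upwards [Lp.coeFn_smul (-1 : ℂ) (r g), hr g] with x h1 h2
      rw [h1]
      simp [h2]
  rw [hf'] at hw
  have hg : (-1 : ℂ) • r g = s • g := hw.unique (h.smul s)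
  have hg' : r g = (-s) • g := by
    rw [neg_smul, ← hg, neg_smul, one_smul, neg_neg]
  have h1 := hr g
  rw [hg'] at h1
  filter_upwards [h1, Lp.coeFn_smul (-s) g] with x h2 h3
  rw [← h2, h3]
  rfl

theorem jet_parity (k : ℕ) {s : ℂ} (u : Sobolev k) (h : jet k 0 u ∈ L2parity s)
    (j : Fin (k + 1)) : jet k j u ∈ L2parity ((-1) ^ (j : ℕ) * s) := by
  induction j using Fin.induction with
  | zero => simpa using h
  | succ j ih =>
    have := (jet_weakDeriv k u j).parity ih
    simpa [pow_succ] using this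

theorem memLp_mul (a : ℝ →ᵇ ℝ) (f : L2) : MemLp (fun x => (a x : ℂ) * f x) 2 volume :=
  (Lp.memLp f).of_le_mul (c := ‖a‖)
    ((Complex.continuous_ofReal.comp a.continuous).aestronglyMeasurable.mul
      (Lp.aestronglyMeasurable f))
    (Eventually.of_forall fun x => by
      rw [norm_mul, Complex.norm_real]
      exact mul_le_mul_of_nonneg_right (a.norm_coe_le_norm x) (norm_nonneg _))

/-- Multiplication of an `L²` function by a bounded continuous real function. -/
def mulOp (a : ℝ →ᵇ ℝ) : L2 →ₗ[ℂ] L2 where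
  toFun f := (memLp_mul a f).toLp _
  map_add' f g := by
    refine Lp.ext ?_
    refine (MemLp.coeFn_toLp _).trans (EventuallyEq.symm ((Lp.coeFn_add _ _).trans ?_))
    refine ((MemLp.coeFn_toLp _).add (MemLp.coeFn_toLp _)).trans ?_
    filter_upwards [Lp.coeFn_add f g] with x h
    rw [h]
    simp [mul_add]
  map_smul' r f := by
    refine Lp.ext ?_
    refine (MemLp.coeFn_toLp _).trans (EventuallyEq.symm ((Lp.coeFn_smul _ _).trans ?_))
    refine ((MemLp.coeFn_toLp _).const_smul r).trans ?_
    filter_upwards [Lp.coeFn_smul r f] with x h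
    rw [h]
    simp only [Pi.smul_apply, smul_eq_mul]
    ring

theorem coeFn_mulOp (a : ℝ →ᵇ ℝ) (f : L2) :
    (mulOp a f : ℝ → ℂ) =ᵐ[volume] fun x => (a x : ℂ) * f x :=
  (memLp_mul a f).coeFn_toLp

theorem mulOp_add (a b : ℝ →ᵇ ℝ) (f : L2) : mulOp (a + b) f = mulOp a f + mulOp b f := by
  refine Lp.ext ?_
  filter_upwards [coeFn_mulOp (a + b) f, coeFn_mulOp a f, coeFn_mulOp b f,
    Lp.coeFn_add (mulOp a f) (mulOp b f)] with x h1 h2 h3 h4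
  rw [h1, h4, Pi.add_apply, h2, h3, BoundedContinuousFunction.add_apply]
  push_cast
  ring

theorem mulOp_sub (a b : ℝ →ᵇ ℝ) (f : L2) : mulOp (a - b) f = mulOp a f - mulOp b f := by
  have h := mulOp_add (a - b) b f
  rw [sub_add_cancel] at h
  exact eq_sub_of_add_eq h.symm

theorem mulOp_const_mul (r : ℝ) (a : ℝ →ᵇ ℝ) (f : L2) :
    mulOp (BoundedContinuousFunction.const ℝ r * a) f = (r : ℂ) • mulOp a f := by
  refine Lp.ext ?_
  filter_upwards [coeFn_mulOp (BoundedContinuousFunction.const ℝ r * a) f, coeFn_mulOp a f,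
    Lp.coeFn_smul (r : ℂ) (mulOp a f)] with x h1 h2 h3
  rw [h1, h3, Pi.smul_apply, h2]
  simp [mul_assoc]

theorem mulOp_parity {a : ℝ →ᵇ ℝ} {s : ℝ} {t : ℂ} {f : L2} (ha : ∀ x, a (-x) = s * a x)
    (hf : f ∈ L2parity t) : mulOp a f ∈ L2parity (s * t) := by
  have h := coeFn_mulOp a f
  filter_upwards [hf, h, neg_ae h] with x h1 h2 h3
  rw [h3, h2, h1, ha]
  push_cast
  ring

theorem HasWeakDeriv.mulOp {a b : ℝ →ᵇ ℝ} (hsm : ContDiff ℝ ∞ a) (hd : ∀ x, deriv a x = b x)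
    {f g : L2} (h : HasWeakDeriv f g) :
    HasWeakDeriv (mulOp a f) (CHKP.mulOp b f + CHKP.mulOp a g : L2) := by
  refine HasWeakDeriv.congr (f := fun x => (a x : ℂ) * f x)
    (g := fun x => (b x : ℂ) * f x + (a x : ℂ) * g x) ?_ (coeFn_mulOp a f) ?_
  · intro φ hφ hs
    have hm : ContDiff ℝ ∞ fun x => φ x * a x := hφ.mul hsm
    have hms : HasCompactSupport fun x => φ x * a x := hs.mul_right
    have e := h _ hm hms
    have hder : ∀ x, deriv (fun x => φ x * a x) x = deriv φ x * a x + φ x * b x := by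
      intro x
      rw [← hd]
      exact deriv_fun_mul (hφ.differentiable (by simp) x) (hsm.differentiable (by simp) x)
    have i1 : Integrable fun x => (deriv φ x * a x) • f x :=
      integrable_test f ((contDiff_infty_iff_deriv.1 hφ).2.continuous.mul a.continuous)
        hs.deriv.mul_right
    have i2 : Integrable fun x => (φ x * b x) • f x :=
      integrable_test f (hφ.continuous.mul b.continuous) hs.mul_right
    have i3 : Integrable fun x => (φ x * a x) • g x :=
      integrable_test g (hφ.continuous.mul a.continuous) hs.mul_right
    simp only [hder, add_smul] at e
    rw [integral_add i1 i2] at e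
    have e1 : ∫ x, deriv φ x • ((a x : ℂ) * f x) = ∫ x, (deriv φ x * a x) • f x := by
      congr 1
      funext x
      simp [mul_assoc]
    have e2 : ∫ x, φ x • ((b x : ℂ) * f x + (a x : ℂ) * g x)
        = ∫ x, ((φ x * b x) • f x + (φ x * a x) • g x) := by
      congr 1
      funext x
      simp [mul_assoc]
    rw [e1, e2, integral_add i2 i3]
    linear_combination e
  · refine (Lp.coeFn_add _ _).trans ?_
    filter_upwards [coeFn_mulOp b f, coeFn_mulOp a g] with x h1 h2
    simp [h1, h2]

/-! ### Spectral notions for unbounded operators -/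

section Spectral

variable {E : Type*} [NormedAddCommGroup E] [NormedSpace ℂ E]

/-- Unbounded (not necessarily everywhere defined) linear operators on a normed space. -/
abbrev UnboundedOp (E : Type*) [NormedAddCommGroup E] [NormedSpace ℂ E] := E →ₗ.[ℂ] E

/-- The unbounded operator on `E` whose domain is the range of an injective map `i : D → E`,
and which sends `i d` to `A d`. -/
def unbounded {D : Type*} [AddCommGroup D] [Module ℂ D] (i : D →ₗ[ℂ] E)
    (hi : Function.Injective i) (A : D →ₗ[ℂ] E) : UnboundedOp E where
  domain := LinearMap.range i
  toFun := A ∘ₗ (LinearEquiv.ofInjective i hi).symm.toLinearMap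

theorem unbounded_apply {D : Type*} [AddCommGroup D] [Module ℂ D] (i : D →ₗ[ℂ] E)
    (hi : Function.Injective i) (A : D →ₗ[ℂ] E) (d : D) :
    unbounded i hi A ⟨i d, LinearMap.mem_range_self i d⟩ = A d := by
  have h : (LinearEquiv.ofInjective i hi).symm ⟨i d, LinearMap.mem_range_self i d⟩ = d :=
    (LinearEquiv.symm_apply_eq _).2 rfl
  exact congrArg A h

/-- The resolvent set of `T`: those `μ` for which `T - μ : D(T) → E` is a bijection with an
inverse `R` that is bounded on `E`. -/
def resolventSet (T : UnboundedOp E) : Set ℂ :=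
  {μ | ∃ R : E →L[ℂ] E,
    (∀ y : E, ∃ h : R y ∈ T.domain, T ⟨R y, h⟩ - μ • R y = y) ∧
    ∀ x : T.domain, R (T x - μ • (x : E)) = x}

/-- The spectrum of `T`. -/
def spectrum (T : UnboundedOp E) : Set ℂ := (resolventSet T)ᶜ

/-- `μ` is an eigenvalue of `T`. -/
def IsEigenvalue (T : UnboundedOp E) (μ : ℂ) : Prop :=
  ∃ x : T.domain, (x : E) ≠ 0 ∧ T x = μ • (x : E)

/-- `x` lies in the kernel of `(T - μ)^n`. -/
def InKerPow (T : UnboundedOp E) (μ : ℂ) : ℕ → E → Prop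
  | 0, x => x = 0
  | n + 1, x => ∃ h : x ∈ T.domain, InKerPow T μ n (T ⟨x, h⟩ - μ • x)

/-- `μ` is a simple eigenvalue of `T`: the generalized eigenspace, i.e. the union of the kernels
of the powers of `T - μ`, is one-dimensional. -/
def IsSimpleEigenvalue (T : UnboundedOp E) (μ : ℂ) : Prop :=
  ∃ v : E, v ≠ 0 ∧ ∀ x, (∃ n, InKerPow T μ n x) ↔ ∃ a : ℂ, x = a • v

end Spectral

/-! ### The operators -/

section Operators

variable {κ c : ℝ} {Q : ℝ → ℝ}

theorem waveDeriv_deriv (hκ : 0 < κ) (hc : 2 * κ < c) (hQ : IsSolitaryWave κ c Q)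
    (j : Fin 3) (x : ℝ) :
    HasDerivAt (waveDeriv hκ hc hQ j.castSucc) (waveDeriv hκ hc hQ j.succ x) x := by
  change HasDerivAt (iteratedDeriv j Q) (iteratedDeriv (j + 1) Q x) x
  rw [iteratedDeriv_succ]
  exact ((hQ.smooth_iter hκ hc j).differentiable (by simp) x).hasDerivAt

theorem waveDeriv_smooth (hκ : 0 < κ) (hc : 2 * κ < c) (hQ : IsSolitaryWave κ c Q)
    (j : Fin 4) : ContDiff ℝ ∞ (waveDeriv hκ hc hQ j) := hQ.smooth_iter hκ hc j

theorem waveDeriv_parity (hκ : 0 < κ) (hc : 2 * κ < c) (hQ : IsSolitaryWave κ c Q)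
    (hev : Function.Even Q) (j : Fin 4) (x : ℝ) :
    waveDeriv hκ hc hQ j (-x) = (-1) ^ (j : ℕ) * waveDeriv hκ hc hQ j x := by
  change iteratedDeriv j Q (-x) = (-1) ^ (j : ℕ) * iteratedDeriv j Q x
  have h := iteratedDeriv_comp_neg (j : ℕ) Q (-x)
  have e : (fun x => Q (-x)) = Q := funext hev
  rw [e, neg_neg] at h
  simpa using h

/-- `M = ∂ₓ(Q - c)∂ₓ + Q'' - 3Q + c - 2κ` on `H²(ℝ)`, with the first term written out, that is
`M v = (Q - c) v'' + Q' v' + (Q'' - 3Q + c - 2κ) v`. -/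
def opM (hκ : 0 < κ) (hc : 2 * κ < c) (hQ : IsSolitaryWave κ c Q) : Sobolev 2 →ₗ[ℂ] L2 :=
  let q := waveDeriv hκ hc hQ
  let C := BoundedContinuousFunction.const ℝ
  mulOp (q 0 - C c) ∘ₗ jet 2 2 + mulOp (q 1) ∘ₗ jet 2 1
    + mulOp (q 2 - C 3 * q 0 + C (c - 2 * κ)) ∘ₗ jet 2 0

/-- `L = -∂ₓ M ∂ₓ` on `H⁴(ℝ)`, carried out by the product rule:
`L ψ = (c - Q) ψ'''' - 2Q' ψ''' - (2Q'' - 3Q + c - 2κ) ψ'' - (Q''' - 3Q') ψ'`. -/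
def opL (hκ : 0 < κ) (hc : 2 * κ < c) (hQ : IsSolitaryWave κ c Q) : Sobolev 4 →ₗ[ℂ] L2 :=
  let q := waveDeriv hκ hc hQ
  let C := BoundedContinuousFunction.const ℝ
  mulOp (C c - q 0) ∘ₗ jet 4 4 - mulOp (C 2 * q 1) ∘ₗ jet 4 3
    - mulOp (C 2 * q 2 - C 3 * q 0 + C (c - 2 * κ)) ∘ₗ jet 4 2
    - mulOp (q 3 - C 3 * q 1) ∘ₗ jet 4 1

/-- The operator `opL` is indeed `-∂ₓ M ∂ₓ`. -/
theorem opL_spec (hκ : 0 < κ) (hc : 2 * κ < c) (hQ : IsSolitaryWave κ c Q) (ψ : Sobolev 4) :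
    HasWeakDeriv (opM hκ hc hQ (incl (by norm_num : 2 ≤ 3) (dx 3 ψ))) (-opL hκ hc hQ ψ : L2) := by
  have s := waveDeriv_smooth hκ hc hQ
  have d0 : ∀ x, HasDerivAt (waveDeriv hκ hc hQ 0) (waveDeriv hκ hc hQ 1 x) x :=
    waveDeriv_deriv hκ hc hQ 0
  have d1 : ∀ x, HasDerivAt (waveDeriv hκ hc hQ 1) (waveDeriv hκ hc hQ 2 x) x :=
    waveDeriv_deriv hκ hc hQ 1
  have d2 : ∀ x, HasDerivAt (waveDeriv hκ hc hQ 2) (waveDeriv hκ hc hQ 3 x) x :=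
    waveDeriv_deriv hκ hc hQ 2
  have w1 : HasWeakDeriv (jet 4 1 ψ) (jet 4 2 ψ) := jet_weakDeriv 4 ψ 1
  have w2 : HasWeakDeriv (jet 4 2 ψ) (jet 4 3 ψ) := jet_weakDeriv 4 ψ 2
  have w3 : HasWeakDeriv (jet 4 3 ψ) (jet 4 4 ψ) := jet_weakDeriv 4 ψ 3
  set q := waveDeriv hκ hc hQ with hq
  let C := BoundedContinuousFunction.const (β := ℝ) ℝ
  have t1 := HasWeakDeriv.mulOp (a := q 0 - C c) (b := q 1)
    ((s 0).sub contDiff_const) (fun x => ((d0 x).sub_const c).deriv) w3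
  have t2 := HasWeakDeriv.mulOp (a := q 1) (b := q 2) (s 1) (fun x => (d1 x).deriv) w2
  have t3 := HasWeakDeriv.mulOp (a := q 2 - C 3 * q 0 + C (c - 2 * κ)) (b := q 3 - C 3 * q 1)
    (((s 2).sub (contDiff_const.mul (s 0))).add contDiff_const)
    (fun x => (((d2 x).sub ((d0 x).const_mul 3)).add_const (c - 2 * κ)).deriv) w1
  have e : -opL hκ hc hQ ψ = (mulOp (q 1) (jet 4 3 ψ) + mulOp (q 0 - C c) (jet 4 4 ψ))
      + (mulOp (q 2) (jet 4 2 ψ) + mulOp (q 1) (jet 4 3 ψ))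
      + (mulOp (q 3 - C 3 * q 1) (jet 4 1 ψ)
        + mulOp (q 2 - C 3 * q 0 + C (c - 2 * κ)) (jet 4 2 ψ)) := by
    change -(mulOp (C c - q 0) (jet 4 4 ψ) - mulOp (C 2 * q 1) (jet 4 3 ψ)
      - mulOp (C 2 * q 2 - C 3 * q 0 + C (c - 2 * κ)) (jet 4 2 ψ)
      - mulOp (q 3 - C 3 * q 1) (jet 4 1 ψ)) = _
    simp only [mulOp_sub, mulOp_add, C, mulOp_const_mul]
    push_cast
    module
  rw [e]
  exact (t1.add t2).add t3

/-- The operator `L : H⁴(ℝ) ⊆ L²(ℝ) → L²(ℝ)`. -/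
def L (hκ : 0 < κ) (hc : 2 * κ < c) (hQ : IsSolitaryWave κ c Q) : UnboundedOp L2 :=
  unbounded (jet 4 0) (jet_zero_injective 4) (opL hκ hc hQ)

theorem opL_odd (hκ : 0 < κ) (hc : 2 * κ < c) (hQ : IsSolitaryWave κ c Q)
    (hev : Function.Even Q) (ψ : SobolevOdd 4) : opL hκ hc hQ (oddIncl 4 ψ) ∈ L2odd := by
  have p := waveDeriv_parity hκ hc hQ hev
  have hψ := jet_parity 4 (oddIncl 4 ψ) ψ.2.2
  have j1 : jet 4 1 (oddIncl 4 ψ) ∈ L2parity 1 := by simpa using hψ 1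
  have j2 : jet 4 2 (oddIncl 4 ψ) ∈ L2parity (-1) := by simpa using hψ 2
  have j3 : jet 4 3 (oddIncl 4 ψ) ∈ L2parity 1 := by simpa [pow_succ] using hψ 3
  have j4 : jet 4 4 (oddIncl 4 ψ) ∈ L2parity (-1) := by simpa [pow_succ] using hψ 4
  have p0 : ∀ x, waveDeriv hκ hc hQ 0 (-x) = waveDeriv hκ hc hQ 0 x := by simpa using p 0
  have p1 : ∀ x, waveDeriv hκ hc hQ 1 (-x) = -waveDeriv hκ hc hQ 1 x := by simpa using p 1
  have p2 : ∀ x, waveDeriv hκ hc hQ 2 (-x) = waveDeriv hκ hc hQ 2 x := by simpa using p 2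
  have p3 : ∀ x, waveDeriv hκ hc hQ 3 (-x) = -waveDeriv hκ hc hQ 3 x := by
    simpa [pow_succ] using p 3
  refine Submodule.sub_mem _ (Submodule.sub_mem _ (Submodule.sub_mem _ ?_ ?_) ?_) ?_
  · have := mulOp_parity (s := 1) (a := BoundedContinuousFunction.const ℝ c - waveDeriv hκ hc hQ 0)
      (fun x => by simp [p0]) j4
    simpa using this
  · have := mulOp_parity (s := -1)
      (a := BoundedContinuousFunction.const ℝ 2 * waveDeriv hκ hc hQ 1)
      (fun x => by simp [p1]) j3
    simpa using this
  · have := mulOp_parity (s := 1) (a := BoundedContinuousFunction.const ℝ 2 * waveDeriv hκ hc hQ 2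
      - BoundedContinuousFunction.const ℝ 3 * waveDeriv hκ hc hQ 0
      + BoundedContinuousFunction.const ℝ (c - 2 * κ))
      (fun x => by simp [p0, p2]) j2
    simpa using this
  · have := mulOp_parity (s := -1) (a := waveDeriv hκ hc hQ 3
      - BoundedContinuousFunction.const ℝ 3 * waveDeriv hκ hc hQ 1)
      (fun x => by simp [p1, p3]; ring) j1
    simpa using this

/-- The differential operator `L` as a map `H⁴_odd(ℝ) → L²_odd(ℝ)`. -/
def opLodd (hκ : 0 < κ) (hc : 2 * κ < c) (hQ : IsSolitaryWave κ c Q) (hev : Function.Even Q) :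
    SobolevOdd 4 →ₗ[ℂ] L2odd :=
  (opL hκ hc hQ ∘ₗ oddIncl 4).codRestrict L2odd (opL_odd hκ hc hQ hev)

/-- The inclusion `H^k_odd(ℝ) ⊆ L²_odd(ℝ)`. -/
def inclL2odd (k : ℕ) : SobolevOdd k →ₗ[ℂ] L2odd :=
  (jet k 0 ∘ₗ oddIncl k).codRestrict L2odd fun u => u.2.2

theorem inclL2odd_injective (k : ℕ) : Function.Injective (inclL2odd k) := fun _ _ h =>
  oddIncl_injective k (jet_zero_injective k (congrArg Subtype.val h))

/-- The inclusion `H^m_odd(ℝ) ⊆ H^k_odd(ℝ)`, `k ≤ m`. -/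
def inclOdd {k m : ℕ} (h : k ≤ m) : SobolevOdd m →ₗ[ℂ] SobolevOdd k :=
  ((Sobolev k).subtype ∘ₗ incl h ∘ₗ oddIncl m).codRestrict (SobolevOdd k) fun u =>
    ⟨(incl h (oddIncl m u)).2, u.2.2⟩

theorem inclOdd_injective {k m : ℕ} (h : k ≤ m) : Function.Injective (inclOdd h) := fun _ _ e =>
  inclL2odd_injective m (Subtype.ext (congrArg (fun u => jet k 0 (oddIncl k u)) e))

/-- The operator `L : H⁴_odd(ℝ) ⊆ L²_odd(ℝ) → L²_odd(ℝ)`. -/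
def Lodd (hκ : 0 < κ) (hc : 2 * κ < c) (hQ : IsSolitaryWave κ c Q) (hev : Function.Even Q) :
    UnboundedOp L2odd :=
  unbounded (inclL2odd 4) (inclL2odd_injective 4) (opLodd hκ hc hQ hev)

/-- The space `X = L²_odd(ℝ) × H²_odd(ℝ)`, with the sum of the two norms. -/
def X : Type := WithLp 1 (L2odd × SobolevOdd 2)

instance : NormedAddCommGroup X := WithLp.instProdNormedAddCommGroup 1 L2odd (SobolevOdd 2)

instance : NormedSpace ℂ X := WithLp.instProdNormedSpace 1 ℂ L2odd (SobolevOdd 2)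

/-- The element `(f, g)` of `X`. -/
def X.mk (f : L2odd) (g : SobolevOdd 2) : X := WithLp.toLp 1 (f, g)

theorem X.norm_mk (f : L2odd) (g : SobolevOdd 2) : ‖X.mk f g‖ = ‖f‖ + ‖g‖ := by
  have h := WithLp.prod_norm_eq_of_L1 (WithLp.toLp 1 (f, g))
  exact h

/-- The space `Y = H²_odd(ℝ) × H⁴_odd(ℝ)`, with the sum of the two norms. -/
def Y : Type := WithLp 1 (SobolevOdd 2 × SobolevOdd 4)

instance : NormedAddCommGroup Y := WithLp.instProdNormedAddCommGroup 1 (SobolevOdd 2) (SobolevOdd 4)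

instance : NormedSpace ℂ Y := WithLp.instProdNormedSpace 1 ℂ (SobolevOdd 2) (SobolevOdd 4)

/-- The element `(f, g)` of `Y`. -/
def Y.mk (f : SobolevOdd 2) (g : SobolevOdd 4) : Y := WithLp.toLp 1 (f, g)

/-- The inclusion `Y ⊆ X`. -/
def inclYX : Y →ₗ[ℂ] X where
  toFun W := X.mk (inclL2odd 2 (WithLp.fst W)) (inclOdd (by norm_num : 2 ≤ 4) (WithLp.snd W))
  map_add' _ _ := rfl
  map_smul' _ _ := rfl

theorem inclYX_injective : Function.Injective inclYX := fun U V h => by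
  have h1 : inclL2odd 2 (WithLp.fst U) = inclL2odd 2 (WithLp.fst V) := congrArg WithLp.fst h
  have h2 : inclOdd (by norm_num : 2 ≤ 4) (WithLp.snd U)
      = inclOdd (by norm_num : 2 ≤ 4) (WithLp.snd V) := congrArg WithLp.snd h
  have e : WithLp.ofLp U = WithLp.ofLp V :=
    Prod.ext (inclL2odd_injective 2 h1) (inclOdd_injective _ h2)
  exact WithLp.ofLp_injective 1 e

/-- The map `(W₁, W₂) ↦ (L W₂, W₁)` from `Y` to `X`. -/
def opCurlyL (hκ : 0 < κ) (hc : 2 * κ < c) (hQ : IsSolitaryWave κ c Q) (hev : Function.Even Q) :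
    Y →ₗ[ℂ] X where
  toFun W := X.mk (opLodd hκ hc hQ hev (WithLp.snd W)) (WithLp.fst W)
  map_add' U V := congrArg (fun z => X.mk z (WithLp.fst U + WithLp.fst V))
    (map_add (opLodd hκ hc hQ hev) (WithLp.snd U) (WithLp.snd V))
  map_smul' a U := congrArg (fun z => X.mk z (a • WithLp.fst U))
    (map_smul (opLodd hκ hc hQ hev) a (WithLp.snd U))

/-- The operator `𝓛 = [[0, L], [1, 0]] : Y ⊆ X → X`. -/
def curlyL (hκ : 0 < κ) (hc : 2 * κ < c) (hQ : IsSolitaryWave κ c Q) (hev : Function.Even Q) :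
    UnboundedOp X :=
  unbounded inclYX inclYX_injective (opCurlyL hκ hc hQ hev)

end Operators
end CHKP
end

noncomputable section

namespace CHKP

/-! ### Absolutely continuous functions on the line -/

/-! Write $p=c-Q$ and $V=Q''-3Q+c-2\kappa$, so that $M=-\partial_x p\,\partial_x+V$ and
$\langle\psi,L\psi\rangle=\int p|\psi''|^2+V|\psi'|^2$. Differentiating the profile equation gives
$MQ'=0$, and $Q'$ vanishes only at the origin. Everything rests on these two facts.

At most one negative direction: on each half-line Jacobi's substitution turns the form into $\int
p\,|\psi''-(Q''/Q')\psi'|^2$ plus boundary terms, which vanish when $\psi'(0)=0$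
(`form_Ioi_nonneg`). The form is therefore nonnegative on the kernel of one linear functional, so
$L$ has at most one negative eigenvalue, with at most one eigenvector up to scalars
(`negIndexLeOne_opL`, `eigen_unique`).

Existence of a negative eigenvalue: on odd functions the form vanishes at $Q'$
(`exists_qform_eq_zero`), while $L$ has trivial kernel there. If every negative number were in the
resolvent set, the form would be nonnegative, and Cauchy–Schwarz would put $Q'$ in the kernel
(`exists_neg_eigenvalue`). The eigenvalue found among odd functions is then the only negative one of
$L$ on the whole space.

No eigenvalue $E\ge0$ on odd functions: if $Lf=Ef$ with $E>0$, the equation at infinity has one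
decaying mode, one growing mode and two oscillating ones. A decaying solution follows the decaying
mode, faster than $Q'$ (`stable_dominates`, `IsDecaying.exists_sign`). Then $n=Mf'$ satisfies
$n'=-Ef$, and the weighted Wronskian of $f'$ and $Q'$ has derivative $Q'n$. Following these signs
from infinity towards the origin, $f$ decreases from its last zero on, yet is positive afterwards:
contradiction (`IsDecaying.eq_zero_of_pos`). For $E=0$ the same two quantities vanish, so $f'$ is a
multiple of $Q'$ on the half-line, and $f''(0)=0$ makes the multiple zero.

Resolvent: the role of self-adjointness is played by `CoerciveOnto`: $L+K$ is coercive and onto for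
some $K$, by continuation from $(1-\partial_x^2)^2$ with a uniform elliptic bound. Continuation then
reaches every nonreal point, and a rank-one perturbation handles the negative points that are not
eigenvalues (`mem_resolventSet_of_neg`).

Finally $(\mathcal L-\mu)(f,g)=(Lg-\mu f,\,f-\mu g)$; eliminating $f$ leaves $L-\mu^2$. Thus
eigenvalues and resolvent sets correspond under $\mu\mapsto\mu^2$, and symmetry of $L$ with
$\mu\ne0$ excludes Jordan chains. A spectral point other than $\pm\mathrm i\sqrt{|\lambda|}$ has
$\mu^2\ge0$, so it is real. -/

/-- `F` is locally absolutely continuous with derivative `g`. -/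
structure IsPrimitive (F g : ℝ → ℂ) : Prop where
  locInt : LocallyIntegrable g
  sub_eq : ∀ x y, F y - F x = ∫ t in x..y, g t

theorem IsPrimitive.intervalIntegrable {F g : ℝ → ℂ} (h : IsPrimitive F g) (a b : ℝ) :
    IntervalIntegrable g volume a b :=
  (h.locInt.integrableOn_isCompact isCompact_uIcc).intervalIntegrable

theorem IsPrimitive.eq_add {F g : ℝ → ℂ} (h : IsPrimitive F g) (a x : ℝ) :
    F x = F a + ∫ t in a..x, g t := by
  rw [← h.sub_eq]; ring

theorem IsPrimitive.continuous {F g : ℝ → ℂ} (h : IsPrimitive F g) : Continuous F := by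
  have e : F = fun x => F 0 + ∫ t in (0 : ℝ)..x, g t := funext fun x => h.eq_add 0 x
  rw [e]
  exact continuous_const.add
    (intervalIntegral.continuous_primitive (fun a b => h.intervalIntegrable a b) 0)

/-- Fubini on the square $(a,b]^2$, cut along its diagonal. This is integration by parts for
integrable functions and yields the product rule for `IsPrimitive` without pointwise
differentiability. -/
theorem integral_mul_primitive_add {g₁ g₂ : ℝ → ℂ} {a b : ℝ} (hab : a ≤ b)
    (h₁ : IntegrableOn g₁ (Set.Ioc a b)) (h₂ : IntegrableOn g₂ (Set.Ioc a b)) :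
    (∫ x in a..b, g₁ x * ∫ y in a..x, g₂ y) + ∫ x in a..b, (∫ y in a..x, g₁ y) * g₂ x
      = (∫ x in a..b, g₁ x) * ∫ x in a..b, g₂ x := by
  set μ := (volume : Measure ℝ).restrict (Set.Ioc a b) with hμ
  have hint : Integrable (fun z : ℝ × ℝ => g₁ z.1 * g₂ z.2) (μ.prod μ) := h₁.mul_prod h₂
  have hS : MeasurableSet {z : ℝ × ℝ | z.2 ≤ z.1} := measurableSet_le measurable_snd measurable_fst
  have hsplit := integral_add_compl hS hint
  have e0 : ∫ z, g₁ z.1 * g₂ z.2 ∂(μ.prod μ) = (∫ x in a..b, g₁ x) * ∫ x in a..b, g₂ x := by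
    rw [integral_prod_mul, intervalIntegral.integral_of_le hab, intervalIntegral.integral_of_le hab]
  have e1 : ∫ z in {z : ℝ × ℝ | z.2 ≤ z.1}, g₁ z.1 * g₂ z.2 ∂(μ.prod μ)
      = ∫ x in a..b, g₁ x * ∫ y in a..x, g₂ y := by
    rw [← integral_indicator hS, integral_prod _ (hint.indicator hS),
      intervalIntegral.integral_of_le hab]
    refine setIntegral_congr_fun measurableSet_Ioc fun x hx => ?_
    have : ∀ y, {z : ℝ × ℝ | z.2 ≤ z.1}.indicator (fun z => g₁ z.1 * g₂ z.2) (x, y)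
        = g₁ x * (Set.Iic x).indicator g₂ y := by
      intro y
      by_cases h : y ≤ x <;> simp [Set.indicator, h]
    simp only [this]
    rw [integral_const_mul, integral_indicator measurableSet_Iic, hμ,
      Measure.restrict_restrict measurableSet_Iic, intervalIntegral.integral_of_le hx.1.le]
    congr 3
    ext y
    simp only [Set.mem_inter_iff, Set.mem_Iic, Set.mem_Ioc]
    exact ⟨fun h => ⟨h.2.1, h.1⟩, fun h => ⟨h.2, h.1, h.2.trans hx.2⟩⟩
  have e2 : ∫ z in {z : ℝ × ℝ | z.2 ≤ z.1}ᶜ, g₁ z.1 * g₂ z.2 ∂(μ.prod μ)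
      = ∫ x in a..b, (∫ y in a..x, g₁ y) * g₂ x := by
    rw [← integral_indicator hS.compl, integral_prod_symm _ (hint.indicator hS.compl),
      intervalIntegral.integral_of_le hab]
    refine setIntegral_congr_fun measurableSet_Ioc fun y hy => ?_
    have : ∀ x, {z : ℝ × ℝ | z.2 ≤ z.1}ᶜ.indicator (fun z => g₁ z.1 * g₂ z.2) (x, y)
        = (Set.Iio y).indicator g₁ x * g₂ y := by
      intro x
      by_cases h : y ≤ x
      · simp [Set.indicator, h]
      · simp [Set.indicator, h, not_le.1 h]
    simp only [this]
    rw [integral_mul_const, integral_indicator measurableSet_Iio, hμ,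
      Measure.restrict_restrict measurableSet_Iio, intervalIntegral.integral_of_le hy.1.le,
      integral_Ioc_eq_integral_Ioo]
    congr 3
    ext x
    simp only [Set.mem_inter_iff, Set.mem_Iio, Set.mem_Ioc, Set.mem_Ioo]
    exact ⟨fun h => ⟨h.2.1, h.1⟩, fun h => ⟨h.2, h.1, h.2.le.trans hy.2⟩⟩
  rw [← e0, ← hsplit, e1, e2]

theorem IsPrimitive.mul {F₁ F₂ g₁ g₂ : ℝ → ℂ} (h₁ : IsPrimitive F₁ g₁) (h₂ : IsPrimitive F₂ g₂) :
    IsPrimitive (fun x => F₁ x * F₂ x) (fun x => g₁ x * F₂ x + F₁ x * g₂ x) := by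
  have i1 : LocallyIntegrable fun x => g₁ x * F₂ x := by
    have := h₁.locInt.smul_continuous (𝕜 := ℂ) h₂.continuous
    simpa [mul_comm] using this
  have i2 : LocallyIntegrable fun x => F₁ x * g₂ x := by
    have := h₂.locInt.smul_continuous (𝕜 := ℂ) h₁.continuous
    simpa [mul_comm] using this
  have key : ∀ x y, x ≤ y → F₁ y * F₂ y - F₁ x * F₂ x
      = ∫ t in x..y, g₁ t * F₂ t + F₁ t * g₂ t := by
    intro x y hxy
    have j1 := h₁.intervalIntegrable x y
    have j2 := h₂.intervalIntegrable x y
    have k1 : IntervalIntegrable (fun t => g₁ t * F₂ t) volume x y :=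
      (i1.integrableOn_isCompact isCompact_uIcc).intervalIntegrable
    have k2 : IntervalIntegrable (fun t => F₁ t * g₂ t) volume x y :=
      (i2.integrableOn_isCompact isCompact_uIcc).intervalIntegrable
    have key := integral_mul_primitive_add hxy j1.1 j2.1
    simp only [← h₁.sub_eq, ← h₂.sub_eq] at key
    rw [intervalIntegral.integral_add k1 k2]
    have l1 : ∫ t in x..y, g₁ t * (F₂ t - F₂ x)
        = (∫ t in x..y, g₁ t * F₂ t) - (F₁ y - F₁ x) * F₂ x := by
      simp only [mul_sub]
      rw [intervalIntegral.integral_sub k1 (j1.mul_const _),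
        intervalIntegral.integral_mul_const, h₁.sub_eq]
    have l2 : ∫ t in x..y, (F₁ t - F₁ x) * g₂ t
        = (∫ t in x..y, F₁ t * g₂ t) - F₁ x * (F₂ y - F₂ x) := by
      simp only [sub_mul]
      rw [intervalIntegral.integral_sub k2 (j2.const_mul _),
        intervalIntegral.integral_const_mul, h₂.sub_eq]
    rw [l1, l2] at key
    linear_combination -key
  refine ⟨i1.add i2, fun x y => ?_⟩
  rcases le_total x y with h | h
  · exact key x y h
  · rw [intervalIntegral.integral_symm, ← key y x h]; ring

theorem IsPrimitive.of_hasDerivAt {F g : ℝ → ℂ} (h : ∀ x, HasDerivAt F (g x) x)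
    (hg : Continuous g) : IsPrimitive F g :=
  ⟨hg.locallyIntegrable, fun x y => (intervalIntegral.integral_eq_sub_of_hasDerivAt
    (fun t _ => h t) (hg.intervalIntegrable x y)).symm⟩

theorem IsPrimitive.hasDerivAt {F g : ℝ → ℂ} (h : IsPrimitive F g) (hg : Continuous g) (x : ℝ) :
    HasDerivAt F (g x) x := by
  have e : F = fun x => F 0 + ∫ t in (0 : ℝ)..x, g t := funext fun x => h.eq_add 0 x
  rw [e]
  exact (hg.integral_hasStrictDerivAt 0 x).hasDerivAt.const_add _

theorem IsPrimitive.congr {F g g' : ℝ → ℂ} (h : IsPrimitive F g) (hg : g' =ᵐ[volume] g) :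
    IsPrimitive F g' :=
  ⟨h.locInt.congr hg.symm, fun x y => by
    rw [h.sub_eq]; exact intervalIntegral.integral_congr_ae (hg.mono fun t ht _ => ht.symm)⟩

theorem IsPrimitive.conj {F g : ℝ → ℂ} (h : IsPrimitive F g) :
    IsPrimitive (fun x => star (F x)) (fun x => star (g x)) := by
  refine ⟨fun x => ?_, fun x y => ?_⟩
  · obtain ⟨s, hs, hi⟩ := h.locInt x
    exact ⟨s, hs, (Complex.conjCLE.toContinuousLinearMap.integrable_comp hi)⟩
  · rw [← star_sub, h.sub_eq]
    exact (intervalIntegral.intervalIntegral_conj (f := g)).symm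

/-- The derivative of $|F|^2$ is integrable, so $|F|^2$ has limits at both ends; since $|F|^2$ is
itself integrable, the limits are zero. -/
theorem IsPrimitive.tendsto_zero {F g : ℝ → ℂ} (h : IsPrimitive F g) (hF : MemLp F 2)
    (hg : MemLp g 2) : Tendsto F atTop (𝓝 0) ∧ Tendsto F atBot (𝓝 0) := by
  have hp := h.conj.mul h
  have hFs : MemLp (fun x => star (F x)) 2 := hF.star
  have hgs : MemLp (fun x => star (g x)) 2 := hg.star
  have i0 : Integrable fun x => star (F x) * F x := hFs.integrable_mul hF
  have i1 : Integrable fun x => star (g x) * F x + star (F x) * g x :=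
    (hgs.integrable_mul hF).add (hFs.integrable_mul hg)
  have hsq : ∀ z : ℂ, star z * z = ((‖z‖ ^ 2 : ℝ) : ℂ) := by
    intro z
    have := Complex.conj_mul' z
    simpa using this
  have fin : ∀ l : Filter ℝ, Tendsto (fun x => star (F x) * F x) l (𝓝 0) → Tendsto F l (𝓝 0) := by
    intro l hl
    simp only [hsq] at hl
    have h1 : Tendsto (fun x => ‖F x‖ ^ 2) l (𝓝 0) := by
      have := (Complex.continuous_re.tendsto 0).comp hl
      simpa only [Function.comp_def, Complex.ofReal_re, Complex.zero_re] using this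
    have h2 := h1.sqrt
    simp only [Real.sqrt_sq (norm_nonneg _), Real.sqrt_zero] at h2
    exact tendsto_zero_iff_norm_tendsto_zero.2 h2
  constructor
  · have ht : Tendsto (fun x => star (F x) * F x) atTop (𝓝 (star (F 0) * F 0
        + ∫ t in Set.Ioi (0 : ℝ), star (g t) * F t + star (F t) * g t)) :=
      (tendsto_const_nhds.add (intervalIntegral_tendsto_integral_Ioi 0 i1.integrableOn
        tendsto_id)).congr fun x => (hp.eq_add 0 x).symm
    have hz := (i0.integrableAtFilter atTop).eq_zero_of_tendsto
      (fun s hs => by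
        obtain ⟨a, ha⟩ := mem_atTop_sets.1 hs
        exact measure_mono_top (fun x hx => ha x (le_of_lt hx)) (Real.volume_Ioi (a := a))) ht
    rw [hz] at ht
    exact fin _ ht
  · have ht : Tendsto (fun x => star (F x) * F x) atBot (𝓝 (star (F 0) * F 0
        - ∫ t in Set.Iic (0 : ℝ), star (g t) * F t + star (F t) * g t)) :=
      (tendsto_const_nhds.sub (intervalIntegral_tendsto_integral_Iic 0 i1.integrableOn
        tendsto_id)).congr fun x => by
          have := hp.sub_eq x 0
          simp only [id]
          linear_combination this
    have hz := (i0.integrableAtFilter atBot).eq_zero_of_tendsto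
      (fun s hs => by
        obtain ⟨a, ha⟩ := mem_atBot_sets.1 hs
        exact measure_mono_top (fun x hx => ha x (le_of_lt hx)) (Real.volume_Iio (a := a))) ht
    rw [hz] at ht
    exact fin _ ht

theorem IsPrimitive.integral_eq_zero {F g : ℝ → ℂ} (h : IsPrimitive F g) (hg : Integrable g)
    (ht : Tendsto F atTop (𝓝 0)) (hb : Tendsto F atBot (𝓝 0)) : ∫ x, g x = 0 := by
  have h1 := intervalIntegral_tendsto_integral hg tendsto_neg_atTop_atBot tendsto_id
  simp only [← h.sub_eq] at h1
  have h2 : Tendsto (fun x => F (id x) - F (-x)) atTop (𝓝 (0 - 0)) :=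
    ht.sub (hb.comp tendsto_neg_atTop_atBot)
  rw [sub_zero] at h2
  exact tendsto_nhds_unique h1 h2

/-! ### Weak derivatives -/

theorem IsPrimitive.hasWeakDeriv {F g : ℝ → ℂ} (h : IsPrimitive F g) : HasWeakDeriv F g := by
  intro φ hφ hs
  have hd : ∀ x, HasDerivAt (fun x => (φ x : ℂ)) ((deriv φ x : ℝ) : ℂ) x := fun x =>
    ((hφ.differentiable (by simp) x).hasDerivAt).ofReal_comp
  have hc : Continuous fun x => ((deriv φ x : ℝ) : ℂ) :=
    Complex.continuous_ofReal.comp (contDiff_infty_iff_deriv.1 hφ).2.continuous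
  have hm := (IsPrimitive.of_hasDerivAt hd hc).mul h
  have i1 : Integrable fun x => deriv φ x • F x :=
    h.continuous.locallyIntegrable.integrable_smul_left_of_hasCompactSupport
      (contDiff_infty_iff_deriv.1 hφ).2.continuous hs.deriv
  have i2 : Integrable fun x => φ x • g x :=
    h.locInt.integrable_smul_left_of_hasCompactSupport hφ.continuous hs
  have hsF : HasCompactSupport fun x => (φ x : ℂ) * F x :=
    (hs.comp_left (g := fun r : ℝ => (r : ℂ)) (by simp)).mul_right
  have hz := hm.integral_eq_zero (by simpa only [Complex.real_smul, Pi.add_def] using i1.add i2)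
    (by
      have := hsF.is_zero_at_infty
      rw [cocompact_eq_atBot_atTop] at this
      exact this.mono_left le_sup_right)
    (by
      have := hsF.is_zero_at_infty
      rw [cocompact_eq_atBot_atTop] at this
      exact this.mono_left le_sup_left)
  have : ∫ x, (deriv φ x • F x + φ x • g x) = 0 := by simpa using hz
  rw [integral_add i1 i2] at this
  exact eq_neg_of_add_eq_zero_left this

/-- A locally integrable function with vanishing weak derivative is constant. -/
theorem HasWeakDeriv.ae_const {h : ℝ → ℂ} (hl : LocallyIntegrable h)
    (hw : HasWeakDeriv h fun _ => 0) : ∃ C : ℂ, ∀ᵐ x, h x = C := by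
  let b : ContDiffBump (0 : ℝ) := ⟨1, 2, by norm_num, by norm_num⟩
  set φ₀ : ℝ → ℝ := b.normed volume with hφ₀
  have s0 : ContDiff ℝ ∞ φ₀ := b.contDiff_normed
  have c0 : HasCompactSupport φ₀ := b.hasCompactSupport_normed
  have I0 : ∫ x, φ₀ x = 1 := b.integral_normed
  refine ⟨∫ x, φ₀ x • h x, ?_⟩
  have key : ∀ᵐ x, h x - (∫ x, φ₀ x • h x) = 0 := by
    refine ae_eq_zero_of_integral_contDiff_smul_eq_zero (hl.sub (locallyIntegrable_const _))
      fun φ hφ hs => ?_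
    set m := ∫ x, φ x with hm
    -- Subtracting a multiple of the unit bump makes the mean zero, so that the primitive of `k` has
    -- compact support and is an admissible test function.
    let k : ℝ → ℝ := fun x => φ x - m * φ₀ x
    have hk : ContDiff ℝ ∞ k := hφ.sub (contDiff_const.mul s0)
    have ks : HasCompactSupport k := hs.sub (c0.mul_left (f := fun _ => m))
    have ki : Integrable k := hk.continuous.integrable_of_hasCompactSupport ks
    have kz : ∫ x, k x = 0 := by
      have i1 : Integrable φ := hφ.continuous.integrable_of_hasCompactSupport hs
      have i2 : Integrable φ₀ := s0.continuous.integrable_of_hasCompactSupport c0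
      change ∫ x, (φ x - m * φ₀ x) = 0
      rw [integral_sub i1 (i2.const_mul m), integral_const_mul, I0]
      simp [hm]
    obtain ⟨R, hR⟩ := ks.isCompact.isBounded.subset_closedBall 0
    set S := |R| + 1 with hS
    have hkz : ∀ x, S ≤ |x| → k x = 0 := fun x hx => by
      by_contra hne
      have := hR (subset_tsupport k hne)
      simp only [Metric.mem_closedBall, dist_zero_right, Real.norm_eq_abs] at this
      linarith [le_abs_self R]
    let P : ℝ → ℝ := fun x => ∫ t in (-S)..x, k t
    have hPd : ∀ x, HasDerivAt P (k x) x := fun x =>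
      (hk.continuous.integral_hasStrictDerivAt (-S) x).hasDerivAt
    have hPderiv : deriv P = k := funext fun x => (hPd x).deriv
    have hP : ContDiff ℝ ∞ P := contDiff_infty_iff_deriv.2
      ⟨fun x => (hPd x).differentiableAt, by rw [hPderiv]; exact hk⟩
    have hPs : HasCompactSupport P := by
      refine HasCompactSupport.of_support_subset_isCompact (isCompact_Icc (a := -S) (b := S))
        fun x hx => ?_
      by_contra hn
      apply hx
      simp only [Set.mem_Icc, not_and_or, not_le] at hn
      rcases hn with hn | hn
      · refine intervalIntegral.integral_zero_ae (Eventually.of_forall fun t ht => hkz t ?_)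
        rw [Set.uIoc_of_ge hn.le] at ht
        have := ht.2
        rw [le_abs]; right; linarith
      · change ∫ t in (-S)..x, k t = 0
        rw [intervalIntegral.integral_eq_integral_of_support_subset, kz]
        intro t ht
        have : |t| < S := not_le.1 fun h => ht (hkz t h)
        rw [abs_lt] at this
        exact ⟨this.1, (this.2.trans hn).le⟩
    have e := hw P hP hPs
    simp only [hPderiv, smul_zero, integral_zero, neg_zero] at e
    have j1 : Integrable fun x => φ x • h x :=
      hl.integrable_smul_left_of_hasCompactSupport hφ.continuous hs
    have j2 : Integrable fun x => φ₀ x • h x :=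
      hl.integrable_smul_left_of_hasCompactSupport s0.continuous c0
    have e' : ∫ x, (φ x • h x - m • φ₀ x • h x) = 0 := by
      rw [← e]
      refine integral_congr_ae (Eventually.of_forall fun x => ?_)
      simp only [k, sub_smul, mul_smul]
    rw [integral_sub j1 (show Integrable fun x => m • φ₀ x • h x from j2.smul m),
      integral_smul] at e'
    have j3 : Integrable fun x => φ x • ∫ x, φ₀ x • h x :=
      (hφ.continuous.integrable_of_hasCompactSupport hs).smul_const _
    simp only [smul_sub]
    rw [integral_sub j1 j3, integral_smul_const]
    exact e'
  filter_upwards [key] with x hx using sub_eq_zero.1 hx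

theorem L2.locallyIntegrable (f : L2) : LocallyIntegrable f :=
  (Lp.memLp f).locallyIntegrable one_le_two

/-- The absolutely continuous representative of an `L²` function with weak derivative in `L²`. -/
theorem HasWeakDeriv.exists_isPrimitive {f g : L2} (h : HasWeakDeriv f g) :
    ∃ F : ℝ → ℂ, IsPrimitive F g ∧ f =ᵐ[volume] F := by
  have hg := L2.locallyIntegrable g
  have hi : ∀ a b, IntervalIntegrable g volume a b := fun a b =>
    (hg.integrableOn_isCompact isCompact_uIcc).intervalIntegrable
  let F₀ : ℝ → ℂ := fun x => ∫ t in (0 : ℝ)..x, g t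
  have h0 : IsPrimitive F₀ g := ⟨hg, fun x y => by
    have := intervalIntegral.integral_add_adjacent_intervals (hi 0 x) (hi x y)
    simp only [F₀]
    rw [← this]; ring⟩
  have hw : HasWeakDeriv (fun x => f x - F₀ x) fun _ => 0 := by
    intro φ hφ hs
    have e1 := h φ hφ hs
    have e2 := h0.hasWeakDeriv φ hφ hs
    simp only [smul_sub, smul_zero, integral_zero, neg_zero]
    rw [integral_sub (integrable_test_deriv f hφ hs), e1, e2, sub_self]
    exact h0.continuous.locallyIntegrable.integrable_smul_left_of_hasCompactSupport
      (contDiff_infty_iff_deriv.1 hφ).2.continuous hs.deriv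
  obtain ⟨C, hC⟩ := HasWeakDeriv.ae_const
    ((L2.locallyIntegrable f).sub h0.continuous.locallyIntegrable) hw
  refine ⟨fun x => F₀ x + C, ⟨hg, fun x y => ?_⟩, ?_⟩
  · rw [← h0.sub_eq]; ring
  · filter_upwards [hC] with x hx
    have hx' : f x - F₀ x = C := hx
    linear_combination hx'

theorem inner_L2_eq (f g : L2) : inner ℂ f g = ∫ x, star (f x) * g x := by
  rw [L2.inner_def]
  refine integral_congr_ae (Eventually.of_forall fun x => ?_)
  simp [mul_comm]

/-- Integration by parts for weak derivatives in `L²`. -/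
theorem HasWeakDeriv.inner_eq {f₁ g₁ f₂ g₂ : L2} (h₁ : HasWeakDeriv f₁ g₁)
    (h₂ : HasWeakDeriv f₂ g₂) : inner ℂ g₁ f₂ = -inner ℂ f₁ g₂ := by
  obtain ⟨F₁, hF₁, e₁⟩ := h₁.exists_isPrimitive
  obtain ⟨F₂, hF₂, e₂⟩ := h₂.exists_isPrimitive
  have m₁ : MemLp F₁ 2 := (Lp.memLp f₁).ae_eq e₁
  have m₂ : MemLp F₂ 2 := (Lp.memLp f₂).ae_eq e₂
  have t₁ := hF₁.tendsto_zero m₁ (Lp.memLp g₁)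
  have t₂ := hF₂.tendsto_zero m₂ (Lp.memLp g₂)
  have hm := hF₁.conj.mul hF₂
  have ms₁ : MemLp (fun x => star (F₁ x)) 2 := m₁.star
  have ns₁ : MemLp (fun x => star (g₁ x)) 2 := (Lp.memLp g₁).star
  have i1 : Integrable fun x => star (g₁ x) * F₂ x := ns₁.integrable_mul m₂
  have i2 : Integrable fun x => star (F₁ x) * g₂ x := ms₁.integrable_mul (Lp.memLp g₂)
  have hz := hm.integral_eq_zero (i1.add i2) (by simpa using t₁.1.star.mul t₂.1)
    (by simpa using t₁.2.star.mul t₂.2)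
  rw [integral_add i1 i2] at hz
  have a1 : inner ℂ g₁ f₂ = ∫ x, star (g₁ x) * F₂ x := by
    rw [inner_L2_eq]
    exact integral_congr_ae (e₂.mono fun x hx => by simp only [hx])
  have a2 : inner ℂ f₁ g₂ = ∫ x, star (F₁ x) * g₂ x := by
    rw [inner_L2_eq]
    exact integral_congr_ae (e₁.mono fun x hx => by simp only [hx])
  rw [a1, a2]
  exact eq_neg_of_add_eq_zero_left hz

/-- A continuous function of compact support as an element of `L²`. -/
def testL2 {φ : ℝ → ℝ} (hφ : Continuous φ) (hs : HasCompactSupport φ) : L2 :=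
  MemLp.toLp (fun x => (φ x : ℂ)) (by
    have : HasCompactSupport fun x => (φ x : ℂ) :=
      hs.comp_left (g := fun r : ℝ => (r : ℂ)) (by simp)
    exact (Complex.continuous_ofReal.comp hφ).memLp_of_hasCompactSupport this)

theorem inner_testL2 {φ : ℝ → ℝ} (hφ : Continuous φ) (hs : HasCompactSupport φ) (f : L2) :
    inner ℂ (testL2 hφ hs) f = ∫ x, φ x • f x := by
  rw [inner_L2_eq]
  refine integral_congr_ae ?_
  filter_upwards [MemLp.coeFn_toLp (μ := volume) (p := 2) (f := fun x => (φ x : ℂ)) _] with x hx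
  rw [testL2, hx]
  simp

/-- Each test function imposes one equation between continuous $L^2$ inner products. This is what
makes the Sobolev spaces complete, as the Riesz and closed graph arguments below require. -/
theorem isClosed_hasWeakDeriv {Z : Type*} [TopologicalSpace Z] {f g : Z → L2}
    (hf : Continuous f) (hg : Continuous g) : IsClosed {z | HasWeakDeriv (f z) (g z)} := by
  have e : {z | HasWeakDeriv (f z) (g z)} = ⋂ (φ : ℝ → ℝ) (hφ : ContDiff ℝ ∞ φ)
      (hs : HasCompactSupport φ), {z | inner ℂ (testL2 (contDiff_infty_iff_deriv.1 hφ).2.continuous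
        hs.deriv) (f z) = -inner ℂ (testL2 hφ.continuous hs) (g z)} := by
    ext z
    simp only [Set.mem_ofPred_eq, Set.mem_iInter, inner_testL2]
    rfl
  rw [e]
  exact isClosed_iInter fun φ => isClosed_iInter fun hφ => isClosed_iInter fun hs =>
    isClosed_eq (continuous_const.inner hf) (continuous_const.inner hg).neg

/-! ### Reflection -/

/-- The reflection `f ↦ f(-·)` of `L²`. -/
def reflect : L2 →ₗᵢ[ℂ] L2 :=
  Lp.compMeasurePreservingₗᵢ ℂ Neg.neg (Measure.measurePreserving_neg (volume : Measure ℝ))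

theorem coeFn_reflect (f : L2) : (reflect f : ℝ → ℂ) =ᵐ[volume] fun x => f (-x) :=
  Lp.coeFn_compMeasurePreserving f _

theorem mem_L2parity_iff {s : ℂ} {f : L2} : f ∈ L2parity s ↔ reflect f = s • f := by
  constructor
  · intro hf
    refine Lp.ext ?_
    have hf' : ∀ᵐ x : ℝ, f (-x) = s * f x := hf
    filter_upwards [coeFn_reflect f, Lp.coeFn_smul s f, hf'] with x h1 h2 h3
    rw [h1, h2, h3]
    rfl
  · intro h
    have h1 := coeFn_reflect f
    rw [h] at h1
    filter_upwards [h1, Lp.coeFn_smul s f] with x h2 h3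
    rw [← h2, h3]
    rfl

theorem HasWeakDeriv.reflect {f g : L2} (h : HasWeakDeriv f g) :
    HasWeakDeriv (reflect f) (-reflect g : L2) := by
  refine HasWeakDeriv.congr (f := fun x => f (-x)) (g := fun x => -g (-x)) ?_ (coeFn_reflect f) ?_
  · intro φ hφ hs
    have e := h _ (hφ.comp contDiff_neg) (hs.comp_homeomorph (Homeomorph.neg ℝ))
    have d : ∀ x, deriv (φ ∘ fun x => -x) x = -deriv φ (-x) := fun x => deriv_comp_neg φ x
    have e1 : ∫ x, deriv φ x • f (-x) = ∫ x, deriv φ (-x) • f x := by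
      rw [← integral_neg_eq_self]
      simp
    have e2 : ∫ x, φ x • g (-x) = ∫ x, φ (-x) • g x := by
      rw [← integral_neg_eq_self]
      simp
    simp only [d, neg_smul, integral_neg] at e
    simp only [smul_neg, integral_neg]
    rw [e1, e2, neg_injective e, neg_neg]
    rfl
  · filter_upwards [Lp.coeFn_neg (CHKP.reflect g), coeFn_reflect g] with x h1 h2
    rw [h1]
    simp [h2]

theorem isClosed_L2parity (s : ℂ) : IsClosed (L2parity s : Set L2) := by
  have e : (L2parity s : Set L2) = {f | reflect f = s • f} := by
    ext f
    exact mem_L2parity_iff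
  rw [e]
  exact isClosed_eq reflect.continuous (continuous_const_smul s)

instance : CompleteSpace L2odd := (isClosed_L2parity (-1)).completeSpace_coe

theorem isClosed_sobolev (k : ℕ) :
    IsClosed (Sobolev k : Set (PiLp 2 fun _ : Fin (k + 1) => L2)) := by
  have e : (Sobolev k : Set (PiLp 2 fun _ : Fin (k + 1) => L2))
      = ⋂ j : Fin k, {u | HasWeakDeriv (u j.castSucc) (u j.succ)} := by
    ext u
    simp only [Set.mem_iInter]
    rfl
  rw [e]
  exact isClosed_iInter fun j => isClosed_hasWeakDeriv (PiLp.continuous_apply 2 _ _)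
    (PiLp.continuous_apply 2 _ _)

instance (k : ℕ) : CompleteSpace (Sobolev k) := (isClosed_sobolev k).completeSpace_coe

theorem isClosed_sobolevOdd (k : ℕ) :
    IsClosed (SobolevOdd k : Set (PiLp 2 fun _ : Fin (k + 1) => L2)) :=
  (isClosed_sobolev k).inter ((isClosed_L2parity (-1)).preimage (PiLp.continuous_apply 2 _ 0))

instance (k : ℕ) : CompleteSpace (SobolevOdd k) := (isClosed_sobolevOdd k).completeSpace_coe

/-! ### Symmetric operators whose form has one negative direction -/

section Abstract

variable {H D : Type*} [NormedAddCommGroup H] [InnerProductSpace ℂ H]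
  [AddCommGroup D] [Module ℂ D]

/-- Neumann series: with `S` a linear right inverse of `B`, the operator $C S$ has norm less than
one, so $1+CS$ is invertible and $(B+C)S(1+CS)^{-1}=1$. No topology on `D` is used. -/
theorem surjective_add_of_lt [CompleteSpace H] {B C : D →ₗ[ℂ] H} {M : ℝ} (hM1 : M < 1)
    (hM : ∀ d, ‖C d‖ ≤ M * ‖B d‖) (hB : Function.Surjective B) : Function.Surjective (B + C) := by
  obtain ⟨S, hS⟩ := B.exists_rightInverse_of_surjective (LinearMap.range_eq_top.2 hB)
  have hS' : ∀ y, B (S y) = y := fun y => LinearMap.congr_fun hS y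
  let K : H →L[ℂ] H := (C ∘ₗ S).mkContinuous (max M 0) fun y => by
    have := hM (S y)
    rw [hS'] at this
    exact this.trans (mul_le_mul_of_nonneg_right (le_max_left _ _) (norm_nonneg _))
  have hK : ‖-K‖ < 1 := by
    rw [norm_neg]
    exact (LinearMap.mkContinuous_norm_le _ (le_max_right _ _) _).trans_lt
      (max_lt hM1 one_pos)
  obtain ⟨U, hU⟩ := isUnit_one_sub_of_norm_lt_one hK
  intro y
  refine ⟨S (((U⁻¹ : (H →L[ℂ] H)ˣ) : H →L[ℂ] H) y), ?_⟩
  have e : (U : H →L[ℂ] H) (((U⁻¹ : (H →L[ℂ] H)ˣ) : H →L[ℂ] H) y) = y := by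
    rw [← mul_apply_eq_comp, Units.mul_inv, one_apply_eq_self]
  rw [hU] at e
  rw [LinearMap.add_apply, hS']
  simpa [K] using e

/-- Method of continuity. The relative bound is uniform in $t$, so the segment can be cut into $N>M$
steps, each short enough for the Neumann series. -/
theorem surjective_of_homotopy [CompleteSpace H] {B C : D →ₗ[ℂ] H} {M : ℝ}
    (hM : ∀ t ∈ Set.Icc (0 : ℝ) 1, ∀ d, ‖C d‖ ≤ M * ‖B d + (t : ℂ) • C d‖)
    (hB : Function.Surjective B) : Function.Surjective (B + C) := by
  obtain ⟨N, hN⟩ := exists_nat_gt (max M 0)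
  have hN0 : (0 : ℝ) < N := (le_max_right _ _).trans_lt hN
  have hMN : M < N := (le_max_left _ _).trans_lt hN
  have key : ∀ k : ℕ, k ≤ N → Function.Surjective (B + ((k / N : ℝ) : ℂ) • C) := by
    intro k
    induction k with
    | zero => intro _; simpa using hB
    | succ k ih =>
      intro hk
      have hs := surjective_add_of_lt (B := B + ((k / N : ℝ) : ℂ) • C)
        (C := ((1 / N : ℝ) : ℂ) • C) (M := M / N) ((div_lt_one hN0).2 hMN) (fun d => ?_)
        (ih (by omega))
      · have e : B + ((k / N : ℝ) : ℂ) • C + ((1 / N : ℝ) : ℂ) • C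
            = B + (((k + 1 : ℕ) / N : ℝ) : ℂ) • C := by
          rw [add_assoc, ← add_smul]
          congr 2
          push_cast
          ring
        rwa [e] at hs
      · have hkN : (k : ℝ) ≤ N := by exact_mod_cast (Nat.le_succ k).trans hk
        have := hM (k / N) ⟨by positivity, (div_le_one hN0).2 hkN⟩ d
        rw [LinearMap.smul_apply, norm_smul, Complex.norm_real, Real.norm_of_nonneg (by positivity),
          LinearMap.add_apply, LinearMap.smul_apply]
        calc 1 / (N : ℝ) * ‖C d‖ ≤ 1 / N * (M * ‖B d + ((k / N : ℝ) : ℂ) • C d‖) := by gcongr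
          _ = _ := by ring
  have := key N le_rfl
  rw [div_self hN0.ne'] at this
  simpa using this

theorem surjective_of_homotopy_bound [CompleteSpace H] {i B C : D →ₗ[ℂ] H} {M δ : ℝ} (hδ : 0 < δ)
    (hM0 : 0 ≤ M)
    (hC : ∀ d, ‖C d‖ ≤ M * ‖i d‖)
    (h : ∀ t ∈ Set.Icc (0 : ℝ) 1, ∀ d, δ * ‖i d‖ ≤ ‖B d + (t : ℂ) • C d‖)
    (hB : Function.Surjective B) : Function.Surjective (B + C) := by
  refine surjective_of_homotopy (M := M / δ) (fun t ht d => (hC d).trans ?_) hB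
  calc M * ‖i d‖ = M / δ * (δ * ‖i d‖) := by field_simp
    _ ≤ _ := mul_le_mul_of_nonneg_left (h t ht d) (by positivity)

theorem bound_of_coercive {i B : D →ₗ[ℂ] H} {δ : ℝ} {d : D}
    (h : δ * ‖i d‖ ^ 2 ≤ (inner ℂ (i d) (B d)).re) : δ * ‖i d‖ ≤ ‖B d‖ := by
  rcases eq_or_lt_of_le (norm_nonneg (i d)) with h0 | h0
  · rw [← h0, mul_zero]; exact norm_nonneg _
  · have h1 : (inner ℂ (i d) (B d)).re ≤ ‖i d‖ * ‖B d‖ :=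
      (Complex.re_le_norm _).trans (norm_inner_le_norm _ _)
    nlinarith

/-- The real part of the form is affine along the segment from `B` to `B + C`, so coercivity at the
two ends holds throughout and supplies the lower bound required by continuation. -/
theorem surjective_of_coercive [CompleteSpace H] {i B C : D →ₗ[ℂ] H} {M δ : ℝ} (hδ : 0 < δ)
    (hM0 : 0 ≤ M) (hC : ∀ d, ‖C d‖ ≤ M * ‖i d‖)
    (h0 : ∀ d, δ * ‖i d‖ ^ 2 ≤ (inner ℂ (i d) (B d)).re)
    (h1 : ∀ d, δ * ‖i d‖ ^ 2 ≤ (inner ℂ (i d) (B d + C d)).re)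
    (hB : Function.Surjective B) : Function.Surjective (B + C) := by
  refine surjective_of_homotopy_bound hδ hM0 hC (fun t ht d => ?_) hB
  refine bound_of_coercive (B := B + (t : ℂ) • C) ?_
  have e : (inner ℂ (i d) ((B + (t : ℂ) • C) d)).re
      = (1 - t) * (inner ℂ (i d) (B d)).re + t * (inner ℂ (i d) (B d + C d)).re := by
    simp only [LinearMap.add_apply, LinearMap.smul_apply, inner_add_right, inner_smul_right,
      Complex.add_re, Complex.re_ofReal_mul]
    ring
  rw [e]
  have a := mul_le_mul_of_nonneg_left (h0 d) (sub_nonneg.2 ht.2)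
  have b := mul_le_mul_of_nonneg_left (h1 d) ht.1
  linarith

/-! ### Unbounded operators described through a parametrised domain -/

section Normed

variable {E : Type*} [NormedAddCommGroup E] [NormedSpace ℂ E]

theorem mem_domain_unbounded {i : D →ₗ[ℂ] E} {hi : Function.Injective i} {A : D →ₗ[ℂ] E} (d : D) :
    i d ∈ (unbounded i hi A).domain := LinearMap.mem_range_self i d

theorem mem_resolventSet_unbounded_iff {i : D →ₗ[ℂ] E} {hi : Function.Injective i}
    {A : D →ₗ[ℂ] E} {z : ℂ} : z ∈ resolventSet (unbounded i hi A) ↔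
      ∃ R : E →L[ℂ] E, (∀ y, ∃ d, i d = R y ∧ A d - z • i d = y) ∧
        ∀ d, R (A d - z • i d) = i d := by
  constructor
  · rintro ⟨R, h1, h2⟩
    refine ⟨R, fun y => ?_, fun d => ?_⟩
    · obtain ⟨⟨d, hd⟩, e⟩ := h1 y
      refine ⟨d, hd, ?_⟩
      have e' : (unbounded i hi A) ⟨R y, ⟨d, hd⟩⟩ = A d := by
        rw [← unbounded_apply i hi A d]
        congr 1
        exact Subtype.ext hd.symm
      rw [e'] at e
      rw [hd, e]
    · have := h2 ⟨i d, mem_domain_unbounded d⟩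
      rwa [unbounded_apply] at this
  · rintro ⟨R, h1, h2⟩
    refine ⟨R, fun y => ?_, ?_⟩
    · obtain ⟨d, hd, e⟩ := h1 y
      refine ⟨⟨d, hd⟩, ?_⟩
      have e' : (unbounded i hi A) ⟨R y, ⟨d, hd⟩⟩ = A d := by
        rw [← unbounded_apply i hi A d]
        congr 1
        exact Subtype.ext hd.symm
      rw [e', ← hd, e]
    · rintro ⟨x, d, rfl⟩
      have := h2 d
      rwa [← unbounded_apply i hi A d] at this

theorem isEigenvalue_unbounded_iff {i : D →ₗ[ℂ] E} {hi : Function.Injective i}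
    {A : D →ₗ[ℂ] E} {z : ℂ} : IsEigenvalue (unbounded i hi A) z ↔ ∃ d, d ≠ 0 ∧ A d = z • i d := by
  constructor
  · rintro ⟨⟨x, d, rfl⟩, h0, h⟩
    refine ⟨d, fun h => h0 (by simp [h]), ?_⟩
    rw [← unbounded_apply i hi A d]
    exact h
  · rintro ⟨d, h0, h⟩
    refine ⟨⟨i d, mem_domain_unbounded d⟩, fun h => h0 (hi (by simpa using h)), ?_⟩
    rw [unbounded_apply]
    exact h

theorem inKerPow_succ_unbounded_iff {i : D →ₗ[ℂ] E} {hi : Function.Injective i}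
    {A : D →ₗ[ℂ] E} {z : ℂ} {n : ℕ} {x : E} : InKerPow (unbounded i hi A) z (n + 1) x ↔
      ∃ d, i d = x ∧ InKerPow (unbounded i hi A) z n (A d - z • i d) := by
  constructor
  · rintro ⟨⟨d, rfl⟩, h⟩
    refine ⟨d, rfl, ?_⟩
    rw [← unbounded_apply i hi A d]
    exact h
  · rintro ⟨d, rfl, h⟩
    refine ⟨mem_domain_unbounded d, ?_⟩
    rw [unbounded_apply]
    exact h

theorem mem_resolventSet_of_bound {i : D →ₗ[ℂ] E} {hi : Function.Injective i}
    {A : D →ₗ[ℂ] E} {z : ℂ} {δ : ℝ} (hδ : 0 < δ) (hb : ∀ d, δ * ‖i d‖ ≤ ‖A d - z • i d‖)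
    (hs : Function.Surjective (A - z • i)) : z ∈ resolventSet (unbounded i hi A) := by
  obtain ⟨S, hS⟩ := (A - z • i).exists_rightInverse_of_surjective (LinearMap.range_eq_top.2 hs)
  have hS' : ∀ y, A (S y) - z • i (S y) = y := fun y => LinearMap.congr_fun hS y
  have hinj : ∀ d, A d - z • i d = 0 → i d = 0 := fun d h => by
    have := hb d
    rw [h, norm_zero] at this
    exact norm_eq_zero.1 (le_antisymm (by
      by_contra! h'
      nlinarith) (norm_nonneg _))
  refine mem_resolventSet_unbounded_iff.2 ⟨(i ∘ₗ S).mkContinuous δ⁻¹ fun y => ?_,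
    fun y => ⟨S y, rfl, hS' y⟩, fun d => ?_⟩
  · have := hb (S y)
    rw [hS'] at this
    rw [LinearMap.comp_apply, inv_mul_eq_div, le_div_iff₀ hδ]
    linarith
  · change i (S (A d - z • i d)) = i d
    rw [← sub_eq_zero, ← map_sub]
    refine hinj _ ?_
    have := hS' (A d - z • i d)
    rw [map_sub A, map_sub i, smul_sub, sub_sub_sub_comm, this, sub_self]

end Normed

/-- The quadratic form of the operator `i d ↦ A d`. -/
def qform (i A : D →ₗ[ℂ] H) (u : D) : ℝ := (inner ℂ (i u) (A u)).re

/-- The operator `i d ↦ A d` is symmetric. -/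
def IsSymm (i A : D →ₗ[ℂ] H) : Prop := ∀ u v, inner ℂ (i u) (A v) = inner ℂ (A u) (i v)

/-- Every two-dimensional space contains a direction in which the form is nonnegative. -/
def NegIndexLeOne (i A : D →ₗ[ℂ] H) : Prop :=
  ∀ u v : D, ∃ a b : ℂ, (a ≠ 0 ∨ b ≠ 0) ∧ 0 ≤ qform i A (a • u + b • v)

variable {i A : D →ₗ[ℂ] H}

theorem qform_add (hs : IsSymm i A) (u v : D) :
    qform i A (u + v) = qform i A u + qform i A v + 2 * (inner ℂ (i u) (A v)).re := by
  have h : (inner ℂ (i v) (A u)).re = (inner ℂ (i u) (A v)).re := by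
    rw [hs, ← inner_conj_symm, Complex.conj_re]
  simp only [qform, map_add, inner_add_left, inner_add_right, Complex.add_re, h]
  ring

theorem qform_smul (a : ℂ) (u : D) : qform i A (a • u) = ‖a‖ ^ 2 * qform i A u := by
  simp only [qform, map_smul, inner_smul_left, inner_smul_right]
  rw [← mul_assoc, Complex.mul_conj', ← Complex.ofReal_pow,
    Complex.re_ofReal_mul]

theorem qform_eigen {u : D} {μ : ℝ} (h : A u = (μ : ℂ) • i u) :
    qform i A u = μ * ‖i u‖ ^ 2 := by
  rw [qform, h, inner_smul_right, inner_self_eq_norm_sq_to_K, Complex.re_ofReal_mul]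
  norm_cast

theorem IsSymm.inner_im (hs : IsSymm i A) (u : D) : (inner ℂ (i u) (A u)).im = 0 := by
  have h := hs u u
  rw [← inner_conj_symm (A u)] at h
  have := congrArg Complex.im h
  rw [Complex.conj_im] at this
  linarith

theorem IsSymm.eigenvalue_im (hs : IsSymm i A) (hi : Function.Injective i) {u : D} {μ : ℂ}
    (hu : u ≠ 0) (h : A u = μ • i u) : μ.im = 0 := by
  have h1 := hs.inner_im u
  rw [h, inner_smul_right, inner_self_eq_norm_sq_to_K] at h1
  have h2 : ‖i u‖ ≠ 0 := norm_ne_zero_iff.2 fun h => hu (hi (by simpa using h))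
  have h3 : (μ * ((‖i u‖ ^ 2 : ℝ) : ℂ)).im = 0 := by
    push_cast
    exact h1
  rw [Complex.im_mul_ofReal] at h3
  exact (mul_eq_zero.1 h3).resolve_right (pow_ne_zero 2 h2)

/-- Eigenvectors for distinct eigenvalues are orthogonal both in `H` and for the form, which would
then be negative on every nonzero combination. For equal eigenvalues every combination is again an
eigenvector, so a combination with nonnegative form must vanish. -/
theorem eigen_unique (hi : Function.Injective i) (hs : IsSymm i A) (hn : NegIndexLeOne i A)
    {μ ν : ℝ} (hμ : μ < 0) (hν : ν < 0) {u v : D} (hu : u ≠ 0) (hv : v ≠ 0)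
    (hAu : A u = (μ : ℂ) • i u) (hAv : A v = (ν : ℂ) • i v) : μ = ν ∧ ∃ a : ℂ, v = a • u := by
  have iu : 0 < ‖i u‖ := norm_pos_iff.2 fun h => hu (hi (by simpa using h))
  have iv : 0 < ‖i v‖ := norm_pos_iff.2 fun h => hv (hi (by simpa using h))
  obtain ⟨a, b, hab, hq⟩ := hn u v
  by_cases hμν : μ = ν
  · refine ⟨hμν, ?_⟩
    subst hμν
    have e : A (a • u + b • v) = (μ : ℂ) • i (a • u + b • v) := by
      simp only [map_add, map_smul, hAu, hAv]
      module
    rw [qform_eigen e] at hq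
    have h0 : i (a • u + b • v) = 0 := by
      by_contra hne
      have : 0 < ‖i (a • u + b • v)‖ ^ 2 := pow_pos (norm_pos_iff.2 hne) 2
      nlinarith
    have h1 : a • u + b • v = 0 := hi (by rw [h0, map_zero])
    have hb : b ≠ 0 := by
      rintro rfl
      rw [zero_smul, add_zero] at h1
      exact (smul_ne_zero (hab.resolve_right fun h => h rfl) hu) h1
    refine ⟨-(b⁻¹ * a), ?_⟩
    have : b⁻¹ • (a • u + b • v) = 0 := by rw [h1, smul_zero]
    rw [smul_add, smul_smul, smul_smul, inv_mul_cancel₀ hb, one_smul] at this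
    rw [neg_smul]
    exact eq_neg_of_add_eq_zero_right this
  · exfalso
    have h := hs u v
    rw [hAu, hAv, inner_smul_left, inner_smul_right, Complex.conj_ofReal] at h
    have h0 : inner ℂ (i u) (i v) = 0 := by
      have : ((μ : ℂ) - ν) * inner ℂ (i u) (i v) = 0 := by rw [sub_mul, h, sub_self]
      refine (mul_eq_zero.1 this).resolve_left fun h => hμν ?_
      exact_mod_cast sub_eq_zero.1 h
    rw [qform_add hs, qform_smul, qform_smul, qform_eigen hAu, qform_eigen hAv] at hq
    have h1 : inner ℂ (i (a • u)) (A (b • v)) = 0 := by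
      simp only [map_smul, hAv, inner_smul_left, inner_smul_right, h0, mul_zero]
    rw [h1, Complex.zero_re] at hq
    have p1 : 0 ≤ ‖a‖ ^ 2 * ‖i u‖ ^ 2 := by positivity
    have p2 : 0 ≤ ‖b‖ ^ 2 * ‖i v‖ ^ 2 := by positivity
    rcases hab with h | h
    · have : 0 < ‖a‖ ^ 2 * ‖i u‖ ^ 2 := by
        have := norm_pos_iff.2 h
        positivity
      nlinarith
    · have : 0 < ‖b‖ ^ 2 * ‖i v‖ ^ 2 := by
        have := norm_pos_iff.2 h
        positivity
      nlinarith

end Abstract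

/-! ### Resolvent points and the negative eigenvalue of a symmetric operator -/

section Abstract

variable {H D : Type*} [NormedAddCommGroup H] [InnerProductSpace ℂ H]
  [AddCommGroup D] [Module ℂ D] {i A : D →ₗ[ℂ] H}

/-- The form of `i d ↦ A d` is bounded below, and `A + K` is onto for some `K` for which it is
coercive. -/
def CoerciveOnto (i A : D →ₗ[ℂ] H) : Prop :=
  ∃ K δ : ℝ, 0 < δ ∧ (∀ d, δ * ‖i d‖ ^ 2 ≤ qform i A d + K * ‖i d‖ ^ 2) ∧
    Function.Surjective (A + (K : ℂ) • i)

theorem inner_self_smul_re (i : D →ₗ[ℂ] H) (d : D) (z : ℂ) :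
    (inner ℂ (i d) (z • i d)).re = z.re * ‖i d‖ ^ 2 := by
  rw [inner_smul_right, inner_self_eq_norm_sq_to_K]
  have : ((‖i d‖ : ℂ)) ^ 2 = ((‖i d‖ ^ 2 : ℝ) : ℂ) := by push_cast; rfl
  erw [this, Complex.re_mul_ofReal]

theorem inner_self_smul_im (i : D →ₗ[ℂ] H) (d : D) (z : ℂ) :
    (inner ℂ (i d) (z • i d)).im = z.im * ‖i d‖ ^ 2 := by
  rw [inner_smul_right, inner_self_eq_norm_sq_to_K]
  have : ((‖i d‖ : ℂ)) ^ 2 = ((‖i d‖ ^ 2 : ℝ) : ℂ) := by push_cast; rfl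
  erw [this, Complex.im_mul_ofReal]

/-- The form of a symmetric operator is real, so the imaginary part of $\langle u,(A-z)u\rangle$ is
$-\operatorname{Im}z\,\|u\|^2$. -/
theorem IsSymm.im_bound (hs : IsSymm i A) (z : ℂ) (d : D) :
    |z.im| * ‖i d‖ ≤ ‖A d - z • i d‖ := by
  rcases eq_or_lt_of_le (norm_nonneg (i d)) with h0 | h0
  · rw [← h0, mul_zero]; exact norm_nonneg _
  · have h1 : |(inner ℂ (i d) (A d - z • i d)).im| ≤ ‖i d‖ * ‖A d - z • i d‖ :=
      (Complex.abs_im_le_norm _).trans (norm_inner_le_norm _ _)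
    rw [inner_sub_right, Complex.sub_im, hs.inner_im, inner_self_smul_im, zero_sub, abs_neg,
      abs_mul, abs_of_nonneg (sq_nonneg ‖i d‖)] at h1
    nlinarith

/-- Surjectivity is transported from $-K$ to $z$ along two segments: vertically, where coercivity
survives because only the imaginary part of the form changes, then horizontally, where the bound by
$|\operatorname{Im}z|$ stays available. -/
theorem mem_resolventSet_of_im_ne_zero [CompleteSpace H] (hi : Function.Injective i)
    (hs : IsSymm i A)
    (hc : CoerciveOnto i A) {z : ℂ} (hz : z.im ≠ 0) : z ∈ resolventSet (unbounded i hi A) := by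
  obtain ⟨K, δ, hδ, hq, hsurj⟩ := hc
  have s1 : Function.Surjective (A + (K : ℂ) • i + (-(Complex.I * z.im)) • i) := by
    refine surjective_of_coercive (i := i) (M := |z.im|) hδ (abs_nonneg _) (fun d => ?_)
      (fun d => ?_) (fun d => ?_) hsurj
    · simp [norm_smul]
    · simp only [LinearMap.add_apply, LinearMap.smul_apply, inner_add_right, Complex.add_re,
        inner_self_smul_re, Complex.ofReal_re]
      exact hq d
    · simp only [LinearMap.add_apply, LinearMap.smul_apply, inner_add_right, Complex.add_re,
        inner_self_smul_re, Complex.ofReal_re]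
      simpa [qform] using hq d
  have s2 := surjective_of_homotopy_bound (i := i) (C := (-((z.re + K : ℝ) : ℂ)) • i)
    (M := |z.re + K|) (abs_pos.2 hz) (abs_nonneg _) (fun d => by
      rw [LinearMap.smul_apply, norm_smul, norm_neg, Complex.norm_real, Real.norm_eq_abs])
    (fun t _ d => ?_) s1
  · refine mem_resolventSet_of_bound (abs_pos.2 hz) (hs.im_bound z) ?_
    convert s2 using 2
    have : z = z.re + Complex.I * z.im := by rw [mul_comm, Complex.re_add_im]
    nth_rw 1 [this]
    push_cast
    module
  · have := hs.im_bound (-K + Complex.I * z.im + t * (z.re + K)) d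
    convert this using 2
    · simp
    · simp only [LinearMap.add_apply, LinearMap.smul_apply]
      push_cast
      module

/-- The operators $A+K$ and $A-z+P$ are both coercive and differ by an operator bounded in the norm
of `H`. -/
theorem surjective_sub_of_qform [CompleteSpace H] {z : ℝ} (hc : CoerciveOnto i A)
    {P : D →ₗ[ℂ] H} {M δ : ℝ}
    (hP : ∀ d, ‖P d‖ ≤ M * ‖i d‖) (hM : 0 ≤ M)
    (hδ : 0 < δ)
    (h : ∀ d, δ * ‖i d‖ ^ 2 ≤ (inner ℂ (i d) (A d - (z : ℂ) • i d + P d)).re) :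
    Function.Surjective (A - (z : ℂ) • i + P) := by
  obtain ⟨K, ε, hε, hq, hsurj⟩ := hc
  have e : A - (z : ℂ) • i + P = A + (K : ℂ) • i + (P - ((z + K : ℝ) : ℂ) • i) := by
    push_cast
    module
  rw [e]
  have e' : ∀ d, (inner ℂ (i d) ((A + (K : ℂ) • i) d)).re = qform i A d + K * ‖i d‖ ^ 2 :=
    fun d => by
    simp only [LinearMap.add_apply, LinearMap.smul_apply, inner_add_right, Complex.add_re,
        inner_self_smul_re, Complex.ofReal_re, qform]
  refine surjective_of_coercive (i := i) (M := M + |z + K|) (δ := min δ ε) (lt_min hδ hε)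
    (by positivity) (fun d => ?_) (fun d => ?_) (fun d => ?_) hsurj
  · rw [LinearMap.sub_apply, LinearMap.smul_apply, add_mul]
    refine (norm_sub_le _ _).trans (add_le_add (hP d) ?_)
    rw [norm_smul, Complex.norm_real, Real.norm_eq_abs]
  · rw [e']
    exact (mul_le_mul_of_nonneg_right (min_le_right _ _) (sq_nonneg _)).trans (hq d)
  · refine (mul_le_mul_of_nonneg_right (min_le_left _ _) (sq_nonneg _)).trans ((h d).trans_eq ?_)
    congr 2
    simp only [LinearMap.add_apply, LinearMap.sub_apply, LinearMap.smul_apply]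
    push_cast
    module

/-- A symmetric operator that is bijective at a real point has that point in its resolvent set. -/
theorem mem_resolventSet_of_bijective [CompleteSpace H] (hi : Function.Injective i)
    (hs : IsSymm i A) {z : ℝ}
    (hsurj : Function.Surjective (A - (z : ℂ) • i))
    (hinj : ∀ d, A d = (z : ℂ) • i d → d = 0) : (z : ℂ) ∈ resolventSet (unbounded i hi A) := by
  obtain ⟨S, hS⟩ := (A - (z : ℂ) • i).exists_rightInverse_of_surjective
    (LinearMap.range_eq_top.2 hsurj)
  have hS' : ∀ y, A (S y) - (z : ℂ) • i (S y) = y := fun y => LinearMap.congr_fun hS y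
  -- An everywhere defined symmetric operator on a Hilbert space is bounded (Hellinger–Toeplitz), so
  -- no quantitative lower bound is needed.
  have hsym : (i ∘ₗ S).IsSymmetric := by
    intro x y
    simp only [LinearMap.comp_apply]
    conv_lhs => rw [← hS' y]
    conv_rhs => rw [← hS' x]
    rw [inner_sub_left, inner_sub_right, hs, inner_smul_left, inner_smul_right, Complex.conj_ofReal]
  refine mem_resolventSet_unbounded_iff.2 ⟨⟨i ∘ₗ S, hsym.continuous⟩, fun y => ⟨S y, rfl, hS' y⟩,
    fun d => ?_⟩
  change i (S (A d - (z : ℂ) • i d)) = i d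
  congr 1
  rw [← sub_eq_zero]
  refine hinj _ ?_
  have := hS' (A d - (z : ℂ) • i d)
  rw [← sub_eq_zero, map_sub A, map_sub i, smul_sub, sub_sub_sub_comm, this, sub_self]

/-- If the form is nonnegative, $A-z$ is coercive. Otherwise one negative direction exhausts the
negative part of the form, and adding a large rank-one operator in that direction restores
coercivity. The perturbation is then removed algebraically, using that $z$ is not an eigenvalue. -/
theorem mem_resolventSet_of_neg [CompleteSpace H] (hi : Function.Injective i) (hs : IsSymm i A)
    (hn : NegIndexLeOne i A) (hc : CoerciveOnto i A) {z : ℝ} (hz : z < 0)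
    (hinj : ∀ d, A d = (z : ℂ) • i d → d = 0) : (z : ℂ) ∈ resolventSet (unbounded i hi A) := by
  refine mem_resolventSet_of_bijective hi hs ?_ hinj
  by_cases hpos : ∀ d, 0 ≤ qform i A d
  · have := surjective_sub_of_qform (z := z) (P := 0) (M := 0) (δ := -z) hc (by simp)
      le_rfl (by linarith) (fun d => ?_)
    · simpa using this
    · simp only [LinearMap.zero_apply, add_zero, inner_sub_right, Complex.sub_re,
        inner_self_smul_re, Complex.ofReal_re]
      have := hpos d
      rw [qform] at this
      linarith
  push Not at hpos
  obtain ⟨u₀, hu₀⟩ := hpos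
  set f₀ := A u₀ with hf₀
  -- The condition says that `w` is orthogonal to `u₀` for the form. Were the form negative at `w`,
  -- it would be negative on the whole span of `u₀` and `w` apart from zero.
  have horth : ∀ w, inner ℂ f₀ (i w) = 0 → 0 ≤ qform i A w := by
    intro w hw
    by_contra! hneg
    obtain ⟨a, b, hab, h⟩ := hn u₀ w
    have h1 : inner ℂ (i (a • u₀)) (A (b • w)) = 0 := by
      rw [hs, map_smul, map_smul, inner_smul_left, inner_smul_right, hw, mul_zero, mul_zero]
    rw [qform_add hs, h1, qform_smul, qform_smul] at h
    simp only [Complex.zero_re, mul_zero, add_zero] at h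
    have p1 := mul_nonneg (sq_nonneg ‖a‖) (neg_nonneg.2 hu₀.le)
    have p2 := mul_nonneg (sq_nonneg ‖b‖) (neg_nonneg.2 hneg.le)
    rcases hab with h' | h'
    · have := mul_pos (pow_pos (norm_pos_iff.2 h') 2) (neg_pos.2 hu₀)
      linarith
    · have := mul_pos (pow_pos (norm_pos_iff.2 h') 2) (neg_pos.2 hneg)
      linarith
  have hne : inner ℂ f₀ (i u₀) ≠ 0 := by
    intro h
    rw [hf₀, ← hs] at h
    rw [qform, h] at hu₀
    exact lt_irrefl _ hu₀
  set v₀ := (inner ℂ f₀ (i u₀))⁻¹ • u₀ with hv₀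
  have hv1 : inner ℂ f₀ (i v₀) = 1 := by
    rw [hv₀, map_smul, inner_smul_right, inv_mul_cancel₀ hne]
  have hf₀ne : f₀ ≠ 0 := fun h => hne (by rw [h, inner_zero_left])
  set a := ‖A v₀ - (z : ℂ) • i v₀‖ with ha
  set b := |qform i A v₀ - z * ‖i v₀‖ ^ 2| with hb
  -- With $d=w+\alpha v_0$, the three summands absorb, in order, the cross term after Young's
  -- inequality, the diagonal term at $v_0$, and the share of $\alpha v_0$ in $\|d\|^2$.
  set C := 2 * a ^ 2 / (-z) + b + (-z) / 2 * ‖i v₀‖ ^ 2 with hC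
  have hzpos : 0 < -z := by linarith
  have hC0 : 0 ≤ C := by positivity
  let P : D →ₗ[ℂ] H := ((C : ℂ) • (innerSL ℂ f₀).toLinearMap.smulRight f₀) ∘ₗ i
  have hP : ∀ d, P d = (C * inner ℂ f₀ (i d)) • f₀ := fun d => by
    simp [P, mul_smul]
  have hPin : ∀ d, (inner ℂ (i d) (P d)).re = C * ‖inner ℂ f₀ (i d)‖ ^ 2 := fun d => by
    rw [hP, inner_smul_right, ← inner_conj_symm (i d) f₀, mul_assoc, Complex.mul_conj',
      ← Complex.ofReal_pow, Complex.re_ofReal_mul, Complex.ofReal_re]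
  have hcoer : ∀ d, (-z) / 4 * ‖i d‖ ^ 2
      ≤ (inner ℂ (i d) (A d - (z : ℂ) • i d + P d)).re := by
    intro d
    set α := inner ℂ f₀ (i d) with hα
    set w := d - α • v₀ with hw
    have hw0 : inner ℂ f₀ (i w) = 0 := by
      rw [hw, map_sub, map_smul, inner_sub_right, inner_smul_right, hv1, mul_one, sub_self]
    have hqw := horth w hw0
    have hd : d = w + α • v₀ := by rw [hw, sub_add_cancel]
    have hA' : IsSymm i (A - (z : ℂ) • i) := fun u v => by
      simp only [LinearMap.sub_apply, LinearMap.smul_apply, inner_sub_left, inner_sub_right,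
        inner_smul_left, inner_smul_right, Complex.conj_ofReal, hs u v]
    have hqz : ∀ u, qform i (A - (z : ℂ) • i) u = qform i A u - z * ‖i u‖ ^ 2 := fun u => by
      simp only [qform, LinearMap.sub_apply, LinearMap.smul_apply, inner_sub_right,
        Complex.sub_re, inner_self_smul_re, Complex.ofReal_re]
    have e1 : (inner ℂ (i d) (A d - (z : ℂ) • i d + P d)).re
        = qform i (A - (z : ℂ) • i) d + C * ‖α‖ ^ 2 := by
      rw [inner_add_right, Complex.add_re, hPin]
      rfl
    have e2 : qform i (A - (z : ℂ) • i) d = (qform i A w - z * ‖i w‖ ^ 2)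
        + ‖α‖ ^ 2 * (qform i A v₀ - z * ‖i v₀‖ ^ 2)
        + 2 * (α * inner ℂ (i w) (A v₀ - (z : ℂ) • i v₀)).re := by
      conv_lhs => rw [hd]
      rw [qform_add hA', qform_smul, hqz, hqz, LinearMap.map_smul (A - (z : ℂ) • i) α v₀,
        inner_smul_right]
      rfl
    have e3 : -(‖α‖ * (‖i w‖ * a)) ≤ (α * inner ℂ (i w) (A v₀ - (z : ℂ) • i v₀)).re := by
      refine neg_le_of_abs_le ((Complex.abs_re_le_norm _).trans ?_)
      rw [norm_mul]
      exact mul_le_mul_of_nonneg_left (norm_inner_le_norm _ _) (norm_nonneg _)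
    have e4 : -b ≤ qform i A v₀ - z * ‖i v₀‖ ^ 2 := neg_abs_le _
    have e5 : ‖i d‖ ^ 2 ≤ 2 * ‖i w‖ ^ 2 + 2 * (‖α‖ ^ 2 * ‖i v₀‖ ^ 2) := by
      have : ‖i d‖ ≤ ‖i w‖ + ‖α‖ * ‖i v₀‖ := by
        conv_lhs => rw [hd]
        rw [map_add, map_smul, ← norm_smul]
        exact norm_add_le _ _
      have h2 := pow_le_pow_left₀ (norm_nonneg _) this 2
      nlinarith [sq_nonneg (‖i w‖ - ‖α‖ * ‖i v₀‖)]
    have e6 : 2 * (‖α‖ * (‖i w‖ * a)) ≤ (-z) / 2 * ‖i w‖ ^ 2 + 2 * a ^ 2 / (-z) * ‖α‖ ^ 2 := by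
      have h : 0 ≤ ((-z) * ‖i w‖ - 2 * (a * ‖α‖)) ^ 2 / (2 * (-z)) := by positivity
      have e : ((-z) * ‖i w‖ - 2 * (a * ‖α‖)) ^ 2 / (2 * (-z)) = (-z) / 2 * ‖i w‖ ^ 2
        + 2 * a ^ 2 / (-z) * ‖α‖ ^ 2 - 2 * (‖α‖ * (‖i w‖ * a)) := by
        have hz0 : z ≠ 0 := hz.ne
        field_simp
        ring
      linarith
    have e7 : -b * ‖α‖ ^ 2 ≤ ‖α‖ ^ 2 * (qform i A v₀ - z * ‖i v₀‖ ^ 2) := by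
      rw [mul_comm]
      exact mul_le_mul_of_nonneg_left e4 (sq_nonneg _)
    have e8 : (-z) / 4 * ‖i d‖ ^ 2 ≤ (-z) / 4 * (2 * ‖i w‖ ^ 2 + 2 * (‖α‖ ^ 2 * ‖i v₀‖ ^ 2)) :=
      mul_le_mul_of_nonneg_left e5 (by linarith)
    rw [e1, e2, hC]
    linarith
  have hS := surjective_sub_of_qform (z := z) (P := P) (M := C * ‖f₀‖ * ‖f₀‖) (δ := (-z) / 4) hc
    (fun d => ?_) (by positivity) (by linarith) hcoer
  -- The solution `g` for the right-hand side `f₀` satisfies $(A-z)g\in\mathbb C f_0$. Its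
  -- coefficient is nonzero, since otherwise injectivity gives $g=0$ and the coefficient would be
  -- one. A multiple of `g` therefore cancels the rank-one term in any solution of the perturbed
  -- equation.
  · obtain ⟨g, hg⟩ := hS f₀
    simp only [LinearMap.add_apply, LinearMap.sub_apply, LinearMap.smul_apply, hP] at hg
    have hg' : A g - (z : ℂ) • i g = (1 - C * inner ℂ f₀ (i g)) • f₀ := by
      rw [sub_smul, one_smul]
      exact eq_sub_of_add_eq hg
    have hne1 : 1 - C * inner ℂ f₀ (i g) ≠ 0 := by
      intro h
      rw [h, zero_smul, sub_eq_zero] at hg'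
      have hg0 := hinj g hg'
      rw [hg0] at h
      simp at h
    intro y
    obtain ⟨d, hd⟩ := hS y
    simp only [LinearMap.add_apply, LinearMap.sub_apply, LinearMap.smul_apply, hP] at hd
    have hd' : A d - (z : ℂ) • i d = y - (C * inner ℂ f₀ (i d)) • f₀ := eq_sub_of_add_eq hd
    refine ⟨d + ((1 - C * inner ℂ f₀ (i g))⁻¹ * (C * inner ℂ f₀ (i d))) • g, ?_⟩
    rw [LinearMap.map_add, LinearMap.map_smul]
    simp only [LinearMap.sub_apply, LinearMap.smul_apply]
    rw [hg', hd', smul_smul, mul_assoc, mul_comm _ (1 - _), inv_mul_cancel_left₀ hne1,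
      sub_add_cancel]
  · rw [hP, norm_smul, norm_mul, Complex.norm_real, Real.norm_of_nonneg hC0]
    calc C * ‖inner ℂ f₀ (i d)‖ * ‖f₀‖ ≤ C * (‖f₀‖ * ‖i d‖) * ‖f₀‖ := by
          gcongr; exact norm_inner_le_norm _ _
      _ = _ := by ring

/-- Cauchy–Schwarz for a nonnegative form, from the discriminant of the form along $u-t\bar\beta v$,
where $\beta$ is the inner product on the left. -/
theorem norm_inner_sq_le_qform (hs : IsSymm i A) (hq : ∀ d, 0 ≤ qform i A d) (u v : D) :
    ‖inner ℂ (i u) (A v)‖ ^ 2 ≤ qform i A u * qform i A v := by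
  set β := inner ℂ (i u) (A v) with hβ
  have h : ∀ t : ℝ, 0 ≤ ‖β‖ ^ 2 * qform i A v * (t * t) + -2 * ‖β‖ ^ 2 * t + qform i A u := by
    intro t
    have := hq (u + (-(t : ℂ) * star β) • v)
    rw [qform_add hs, qform_smul, map_smul, inner_smul_right, ← hβ, mul_assoc] at this
    have e1 : star β * β = ((‖β‖ ^ 2 : ℝ) : ℂ) := by
      rw [Complex.ofReal_pow]
      exact Complex.conj_mul' β
    have e2 : ‖-(t : ℂ) * star β‖ ^ 2 = t ^ 2 * ‖β‖ ^ 2 := by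
      rw [norm_mul, norm_neg, norm_star, mul_pow, Complex.norm_real, Real.norm_eq_abs, sq_abs]
    rw [e1, e2, ← Complex.ofReal_neg, ← Complex.ofReal_mul, Complex.ofReal_re] at this
    linarith
  have hd := discrim_le_zero h
  rw [discrim] at hd
  rcases eq_or_lt_of_le (sq_nonneg ‖β‖) with h0 | h0
  · rw [← h0]; exact mul_nonneg (hq u) (hq v)
  · nlinarith

/-- If there were none, every negative number would lie in the resolvent set. A negative infimum of
the Rayleigh quotient would then be a resolvent point, which Cauchy–Schwarz forbids; so the form is
nonnegative, and a vector where it vanishes lies in the kernel. -/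
theorem exists_neg_eigenvalue [CompleteSpace H] (hi : Function.Injective i) (hs : IsSymm i A)
    (hn : NegIndexLeOne i A) (hc : CoerciveOnto i A) (hker : ∀ d, A d = 0 → d = 0) {u : D}
    (hu : u ≠ 0) (hqu : qform i A u = 0) :
    ∃ z : ℝ, z < 0 ∧ ∃ d, d ≠ 0 ∧ A d = (z : ℂ) • i d := by
  by_contra! hno
  have hres : ∀ z : ℝ, z < 0 → ∃ R : H →L[ℂ] H,
      (∀ y, ∃ d, i d = R y ∧ A d - (z : ℂ) • i d = y) := fun z hz => by
    obtain ⟨R, hR, -⟩ := mem_resolventSet_unbounded_iff.1 (mem_resolventSet_of_neg hi hs hn hc hz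
      fun d hd => by_contra fun h => hno z hz d h hd)
    exact ⟨R, hR⟩
  have hpos : ∀ d, 0 ≤ qform i A d := by
    by_contra! hneg
    obtain ⟨w, hw⟩ := hneg
    have hw0 : 0 < ‖i w‖ := norm_pos_iff.2 fun h => by
      rw [qform, h, inner_zero_left] at hw
      exact lt_irrefl _ hw
    set S : Set ℝ := {x | ∃ d, ‖i d‖ = 1 ∧ qform i A d = x} with hS
    have hnorm : ∀ d, 0 < ‖i d‖ → qform i A d / ‖i d‖ ^ 2 ∈ S := fun d hd => by
      refine ⟨((‖i d‖⁻¹ : ℝ) : ℂ) • d, ?_, ?_⟩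
      · rw [map_smul, norm_smul, Complex.norm_real, norm_inv, norm_norm, inv_mul_cancel₀ hd.ne']
      · rw [qform_smul, Complex.norm_real, norm_inv, norm_norm]
        field_simp
    have hbdd : BddBelow S := by
      obtain ⟨K, δ, hδ, hq, -⟩ := hc
      refine ⟨-K, ?_⟩
      rintro x ⟨d, hd, rfl⟩
      have := hq d
      rw [hd] at this
      linarith
    set s := sInf S with hs'
    have hs0 : s < 0 := (csInf_le hbdd (hnorm w hw0)).trans_lt
      (div_neg_of_neg_of_pos hw (by positivity))
    have hsq : ∀ d, 0 ≤ qform i (A - (s : ℂ) • i) d := fun d => by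
      have e : qform i (A - (s : ℂ) • i) d = qform i A d - s * ‖i d‖ ^ 2 := by
        simp only [qform, LinearMap.sub_apply, LinearMap.smul_apply, inner_sub_right,
          Complex.sub_re, inner_self_smul_re, Complex.ofReal_re]
      rw [e]
      rcases eq_or_lt_of_le (norm_nonneg (i d)) with h0 | h0
      · have : i d = 0 := norm_eq_zero.1 h0.symm
        simp [qform, this]
      · have := csInf_le hbdd (hnorm d h0)
        rw [← hs', le_div_iff₀ (by positivity)] at this
        linarith
    have hA' : IsSymm i (A - (s : ℂ) • i) := fun u v => by
      simp only [LinearMap.sub_apply, LinearMap.smul_apply, inner_sub_left, inner_sub_right,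
        inner_smul_left, inner_smul_right, Complex.conj_ofReal, hs u v]
    obtain ⟨R, hR⟩ := hres s hs0
    have hr : 0 < ‖R‖ + 1 := by positivity
    -- Cauchy–Schwarz for the nonnegative form of $A-s$, applied to a unit vector $d$ and
    -- $e=(A-s)^{-1}d$, gives $1\le(q(d)-s)\|R\|$, which keeps the Rayleigh quotients away from
    -- their infimum.
    have key : ∀ x ∈ S, s + (‖R‖ + 1)⁻¹ ≤ x := by
      rintro x ⟨d, hd, rfl⟩
      obtain ⟨e, he, he'⟩ := hR (i d)
      have h1 := norm_inner_sq_le_qform hA' hsq d e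
      have h2 : (A - (s : ℂ) • i) e = i d := he'
      have h3 : qform i (A - (s : ℂ) • i) e ≤ ‖R‖ := by
        rw [qform, h2, he]
        refine (Complex.re_le_norm _).trans ((norm_inner_le_norm _ _).trans ?_)
        rw [hd, mul_one]
        exact (R.le_opNorm _).trans_eq (by rw [hd, mul_one])
      have h4 : qform i (A - (s : ℂ) • i) d = qform i A d - s := by
        simp only [qform, LinearMap.sub_apply, LinearMap.smul_apply, inner_sub_right,
          Complex.sub_re, inner_self_smul_re, Complex.ofReal_re, hd]
        ring
      have h5 : ‖inner ℂ (i d) (i d)‖ = 1 := by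
        rw [inner_self_eq_norm_sq_to_K, hd]
        simp
      rw [h2, h5, h4] at h1
      have h6 : 0 ≤ qform i A d - s := by rw [← h4]; exact hsq d
      have h7 : 1 ≤ (qform i A d - s) * (‖R‖ + 1) := by nlinarith
      have := (inv_le_iff_one_le_mul₀ hr).2 h7
      linarith
    have := le_csInf ⟨_, hnorm w hw0⟩ key
    have := inv_pos.2 hr
    linarith
  have horth : ∀ v, inner ℂ (A u) (i v) = 0 := fun v => by
    have h := norm_inner_sq_le_qform hs hpos u v
    rw [hqu, zero_mul] at h
    have h1 : inner ℂ (i u) (A v) = 0 := norm_eq_zero.1 (pow_eq_zero_iff two_ne_zero |>.1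
      (le_antisymm h (sq_nonneg _)))
    rw [← hs, h1]
  -- $Au$ is orthogonal to the domain. Instead of a density argument, $Au=(A+1)d$ is solved and
  -- tested with $d$: positivity of the form gives $d=0$, hence $Au=0$.
  obtain ⟨R, hR⟩ := hres (-1) (by norm_num)
  obtain ⟨d, -, hd⟩ := hR (A u)
  have h1 := horth d
  rw [← hd] at h1
  have h2 : qform i A d + ‖i d‖ ^ 2 = 0 := by
    have h3 : (inner ℂ (i d) (A d - ((-1 : ℝ) : ℂ) • i d)).re = 0 := by
      rw [← inner_conj_symm, h1]; simp
    rw [inner_sub_right, Complex.sub_re, inner_self_smul_re, Complex.ofReal_re] at h3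
    rw [qform]
    linarith
  have h3 : i d = 0 := by
    have := hpos d
    have h4 : ‖i d‖ ^ 2 = 0 := le_antisymm (by linarith) (sq_nonneg _)
    exact norm_eq_zero.1 (pow_eq_zero_iff two_ne_zero |>.1 h4)
  have h4 : d = 0 := hi (by rw [h3, map_zero])
  rw [h4] at hd
  exact hu (hker u (by rw [← hd]; simp))

end Abstract

/-! ### The profile of the solitary wave -/

section Profile

variable {κ c : ℝ} {Q : ℝ → ℝ}

theorem IsSolitaryWave.pos_sub (hκ : 0 < κ) (hc : 2 * κ < c) (hQ : IsSolitaryWave κ c Q) (x : ℝ) :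
    0 < c - Q x := by
  have := hQ.le hκ hc x
  linarith

theorem IsSolitaryWave.hasDerivAt_iter (hκ : 0 < κ) (hc : 2 * κ < c) (hQ : IsSolitaryWave κ c Q)
    (n : ℕ) (x : ℝ) : HasDerivAt (iteratedDeriv n Q) (iteratedDeriv (n + 1) Q x) x := by
  rw [iteratedDeriv_succ]
  exact ((hQ.smooth_iter hκ hc n).differentiable (by simp) x).hasDerivAt

/-- The energy identity together with $c-2\kappa-Q\le c-Q$. -/
theorem IsSolitaryWave.sq_deriv_le (hκ : 0 < κ) (hc : 2 * κ < c) (hQ : IsSolitaryWave κ c Q)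
    (x : ℝ) : deriv Q x ^ 2 ≤ Q x ^ 2 := by
  have h := hQ.energy x
  have h0 := hQ.pos_sub hκ hc x
  have : (c - Q x) * deriv Q x ^ 2 ≤ (c - Q x) * Q x ^ 2 := by
    rw [h, mul_comm]
    exact mul_le_mul_of_nonneg_right (by linarith) (sq_nonneg _)
  exact le_of_mul_le_mul_left this h0

theorem IsSolitaryWave.abs_deriv_le (hκ : 0 < κ) (hc : 2 * κ < c) (hQ : IsSolitaryWave κ c Q)
    (x : ℝ) : |deriv Q x| ≤ |Q x| := sq_le_sq.1 (hQ.sq_deriv_le hκ hc x)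

/-- By $|Q'|\le|Q|$ the function $Q^2e^{2x}$ is nondecreasing and $Q^2e^{-2x}$ is nonincreasing, so
a single zero would spread to the whole line. -/
theorem IsSolitaryWave.ne_zero (hκ : 0 < κ) (hc : 2 * κ < c) (hQ : IsSolitaryWave κ c Q)
    (x : ℝ) : Q x ≠ 0 := by
  intro h0
  obtain ⟨y, hy⟩ := hQ.nontrivial
  apply hy
  have hb := hQ.abs_deriv_le hκ hc
  have hd : ∀ s t : ℝ, HasDerivAt (fun t => Q t ^ 2 * Real.exp (s * t))
      ((2 * Q t * deriv Q t + s * Q t ^ 2) * Real.exp (s * t)) t := fun s t => by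
    have h1 : HasDerivAt (fun t => Real.exp (s * t)) (Real.exp (s * t) * s) t := by
      simpa using ((hasDerivAt_id t).const_mul s).exp
    refine (((hQ.hasDerivAt t).pow 2).mul h1).congr_deriv ?_
    simp only [Pi.pow_apply]
    push_cast
    ring
  have hprod : ∀ t, |Q t * deriv Q t| ≤ Q t ^ 2 := fun t => by
    rw [abs_mul, ← sq_abs (Q t), sq]
    exact mul_le_mul_of_nonneg_left (hb t) (abs_nonneg _)
  have hmono : Monotone fun t => Q t ^ 2 * Real.exp (2 * t) :=
    monotone_of_hasDerivAt_nonneg (hd 2) fun t =>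
      mul_nonneg (by linarith [neg_le_of_abs_le (hprod t)]) (Real.exp_pos _).le
  have hanti : Antitone fun t => Q t ^ 2 * Real.exp (-2 * t) :=
    antitone_of_hasDerivAt_nonpos (hd (-2)) fun t =>
      mul_nonpos_of_nonpos_of_nonneg (by linarith [le_of_abs_le (hprod t)]) (Real.exp_pos _).le
  have hz : Q y ^ 2 ≤ 0 := by
    rcases le_total y x with h | h
    · have := hmono h
      simp only [h0] at this
      by_contra! hp
      nlinarith [mul_pos hp (Real.exp_pos (2 * y))]
    · have := hanti h
      simp only [h0] at this
      by_contra! hp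
      nlinarith [mul_pos hp (Real.exp_pos (-2 * y))]
  exact pow_eq_zero_iff two_ne_zero |>.1 (le_antisymm hz (sq_nonneg _))

theorem deriv_zero_of_even (hev : Function.Even Q) : deriv Q 0 = 0 := by
  have h := deriv_comp_neg Q 0
  have e : (fun x => Q (-x)) = Q := funext hev
  rw [e, neg_zero] at h
  linarith

theorem IsSolitaryWave.apply_zero (hκ : 0 < κ) (hc : 2 * κ < c) (hQ : IsSolitaryWave κ c Q)
    (hev : Function.Even Q) : Q 0 = c - 2 * κ := by
  have h := hQ.energy 0
  rw [deriv_zero_of_even hev] at h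
  have h1 : Q 0 ^ 2 * (c - 2 * κ - Q 0) = 0 := by rw [← h]; ring
  have := (mul_eq_zero.1 h1).resolve_left (pow_ne_zero 2 (hQ.ne_zero hκ hc 0))
  linarith

theorem IsSolitaryWave.pos (hκ : 0 < κ) (hc : 2 * κ < c) (hQ : IsSolitaryWave κ c Q)
    (hev : Function.Even Q) (x : ℝ) : 0 < Q x := by
  by_contra! h
  obtain ⟨z, hz⟩ := mem_range_of_exists_le_of_exists_ge hQ.contDiff.continuous ⟨x, h⟩
    ⟨0, show 0 ≤ Q 0 by rw [hQ.apply_zero hκ hc hev]; linarith⟩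
  exact hQ.ne_zero hκ hc z hz

theorem IsSolitaryWave.eq_of_deriv_eq_zero (hκ : 0 < κ) (hc : 2 * κ < c)
    (hQ : IsSolitaryWave κ c Q) {x : ℝ} (hx : deriv Q x = 0) : Q x = c - 2 * κ := by
  have h := hQ.energy x
  rw [hx] at h
  have h1 : Q x ^ 2 * (c - 2 * κ - Q x) = 0 := by rw [← h]; ring
  have := (mul_eq_zero.1 h1).resolve_left (pow_ne_zero 2 (hQ.ne_zero hκ hc x))
  linarith

theorem IsSolitaryWave.deriv2_neg (hκ : 0 < κ) (hc : 2 * κ < c)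
    (hQ : IsSolitaryWave κ c Q) {x : ℝ} (hx : deriv Q x = 0) : deriv (deriv Q) x < 0 := by
  have h := hQ.profile x
  rw [hx, hQ.eq_of_deriv_eq_zero hκ hc hx] at h
  have h2 : 0 < (c - 2 * κ) ^ 2 := pow_pos (by linarith) 2
  nlinarith

/-- Every critical value of $Q$ equals the maximum $c-2\kappa$. If $Q'(x)=0$, the minimum of $Q$ on
$[0,x]$ is also that value, so $Q$ is constant there, contrary to $Q''<0$ at critical points. -/
theorem IsSolitaryWave.deriv_ne_zero (hκ : 0 < κ) (hc : 2 * κ < c) (hQ : IsSolitaryWave κ c Q)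
    (hev : Function.Even Q) {x : ℝ} (hx : 0 < x) : deriv Q x ≠ 0 := by
  intro h
  have hQx := hQ.eq_of_deriv_eq_zero hκ hc h
  have hQ0 := hQ.apply_zero hκ hc hev
  obtain ⟨y, hy, hmin⟩ := isCompact_Icc.exists_isMinOn (Set.nonempty_Icc.2 hx.le)
    hQ.contDiff.continuous.continuousOn
  have hyd : deriv Q y = 0 := by
    by_cases hyd : Q y = c - 2 * κ
    · have h1 := hQ.energy y
      rw [hyd] at h1
      have h2 : deriv Q y ^ 2 = 0 := by
        have : 2 * κ * deriv Q y ^ 2 = 0 := by linarith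
        exact (mul_eq_zero.1 this).resolve_left (by linarith)
      exact pow_eq_zero_iff two_ne_zero |>.1 h2
    · have hy' : y ∈ Set.Ioo 0 x := by
        refine ⟨lt_of_le_of_ne hy.1 ?_, lt_of_le_of_ne hy.2 ?_⟩
        · rintro rfl; exact hyd hQ0
        · rintro rfl; exact hyd hQx
      exact (hmin.isLocalMin (Icc_mem_nhds hy'.1 hy'.2)).deriv_eq_zero
  have hQy := hQ.eq_of_deriv_eq_zero hκ hc hyd
  have hconst : ∀ t ∈ Set.Icc 0 x, Q t = c - 2 * κ := fun t ht =>
    le_antisymm (hQ.le hκ hc t) (hQy ▸ hmin ht)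
  have hev' : ∀ t ∈ Set.Ioo 0 x, deriv Q t = 0 := fun t ht => by
    have : Q =ᶠ[𝓝 t] fun _ => c - 2 * κ := by
      filter_upwards [Icc_mem_nhds ht.1 ht.2] with s hs using hconst s hs
    rw [this.deriv_eq]
    simp
  have hm : x / 2 ∈ Set.Ioo 0 x := ⟨by linarith, by linarith⟩
  have h2 : deriv Q =ᶠ[𝓝 (x / 2)] fun _ => 0 := by
    filter_upwards [Ioo_mem_nhds hm.1 hm.2] with s hs using hev' s hs
  have h3 := hQ.deriv2_neg hκ hc (hev' _ hm)
  rw [h2.deriv_eq] at h3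
  simp at h3

/-- $Q'$ keeps one sign on the half-line, and an increasing $Q$ could not tend to zero from
$Q(0)=c-2\kappa>0$. -/
theorem IsSolitaryWave.deriv_neg (hκ : 0 < κ) (hc : 2 * κ < c) (hQ : IsSolitaryWave κ c Q)
    (hev : Function.Even Q) {x : ℝ} (hx : 0 < x) : deriv Q x < 0 := by
  have hcont := hQ.contDiff_deriv.continuous
  by_contra! h
  have hall : ∀ t, 0 < t → 0 < deriv Q t := by
    intro t ht
    by_contra! h'
    obtain ⟨z, hz, hz0⟩ := isPreconnected_Ioi.intermediate_value₂ (s := Set.Ioi (0 : ℝ)) ht hx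
      hcont.continuousOn (continuousOn_const (c := (0 : ℝ))) h' h
    exact hQ.deriv_ne_zero hκ hc hev hz hz0
  have hmono : StrictMonoOn Q (Set.Ici 0) :=
    strictMonoOn_of_deriv_pos (convex_Ici 0) hQ.contDiff.continuous.continuousOn fun t ht =>
      hall t (by simpa using ht)
  obtain ⟨y, hy, hy0⟩ := ((hQ.tendsto_atTop.eventually
    (gt_mem_nhds (show (0 : ℝ) < c - 2 * κ by linarith))).and (eventually_gt_atTop 0)).exists
  have := hmono (Set.self_mem_Ici) hy0.le hy0
  rw [hQ.apply_zero hκ hc hev] at this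
  linarith

/-- `f` is dominated by a multiple of `Q`. -/
def DomBy (Q f : ℝ → ℝ) : Prop := ∃ C, ∀ x, |f x| ≤ C * Q x

theorem DomBy.add {f g : ℝ → ℝ} (hf : DomBy Q f) (hg : DomBy Q g) :
    DomBy Q fun x => f x + g x := by
  obtain ⟨C, hC⟩ := hf
  obtain ⟨D, hD⟩ := hg
  refine ⟨C + D, fun x => ?_⟩
  rw [add_mul]
  exact (abs_add_le _ _).trans (add_le_add (hC x) (hD x))

theorem DomBy.mul {f g : ℝ → ℝ} (hf : Bdd f) (hg : DomBy Q g) :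
    DomBy Q fun x => f x * g x := by
  obtain ⟨C, hC⟩ := hf
  obtain ⟨D, hD⟩ := hg
  refine ⟨C * D, fun x => ?_⟩
  rw [abs_mul, mul_assoc]
  exact mul_le_mul (hC x) (hD x) (abs_nonneg _) ((norm_nonneg _).trans (hC x))

theorem DomBy.const_mul {f : ℝ → ℝ} (r : ℝ) (hf : DomBy Q f) : DomBy Q fun x => r * f x :=
  DomBy.mul (Bdd.const r) hf

theorem DomBy.bdd {f : ℝ → ℝ} (hQ : Bdd Q) (hf : DomBy Q f) : Bdd f := by
  obtain ⟨C, hC⟩ := hf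
  obtain ⟨D, hD⟩ := (Bdd.const C).mul hQ
  exact ⟨D, fun x => (hC x).trans ((le_abs_self _).trans (hD x))⟩

theorem DomBy.of_mul {f g : ℝ → ℝ} (hκ : 0 < κ) (hc : 2 * κ < c) (hQ : IsSolitaryWave κ c Q)
    (h : ∀ x, (c - Q x) * f x = g x) (hg : DomBy Q g) : DomBy Q f := by
  have e : f = fun x => (c - Q x)⁻¹ * g x := by
    funext x
    rw [← h x, inv_mul_cancel_left₀ (hQ.pos_sub hκ hc x).ne']
  rw [e]
  exact DomBy.mul (hQ.bdd_inv hκ hc) hg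

theorem IsSolitaryWave.eq2 (hQ : IsSolitaryWave κ c Q) (x : ℝ) :
    (c - Q x) * iteratedDeriv 2 Q x
      = (c - 2 * κ) * Q x - 3 / 2 * Q x ^ 2 + 1 / 2 * iteratedDeriv 1 Q x ^ 2 := by
  rw [iteratedDeriv_succ, iteratedDeriv_one]
  linear_combination hQ.profile x

/-- The differentiated profile equation; it is the identity $MQ'=0$, used for every comparison with
$Q'$ below. -/
theorem IsSolitaryWave.eq3 (hκ : 0 < κ) (hc : 2 * κ < c) (hQ : IsSolitaryWave κ c Q) (x : ℝ) :
    (c - Q x) * iteratedDeriv 3 Q x = (c - 2 * κ) * iteratedDeriv 1 Q x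
      - 3 * Q x * iteratedDeriv 1 Q x + 2 * iteratedDeriv 1 Q x * iteratedDeriv 2 Q x := by
  have h := hQ.hasDerivAt_iter hκ hc
  have h0 : HasDerivAt Q (iteratedDeriv 1 Q x) x := by simpa using h 0 x
  have l := (h0.const_sub c).mul (h 2 x)
  have r := ((h0.const_mul (c - 2 * κ)).sub ((h0.pow 2).const_mul (3 / 2))).add
    (((h 1 x).pow 2).const_mul (1 / 2))
  have := l.unique (r.congr_of_eventuallyEq (Eventually.of_forall fun y => hQ.eq2 y))
  push_cast at this
  linear_combination this

theorem IsSolitaryWave.eq4 (hκ : 0 < κ) (hc : 2 * κ < c) (hQ : IsSolitaryWave κ c Q) (x : ℝ) :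
    (c - Q x) * iteratedDeriv 4 Q x = (c - 2 * κ) * iteratedDeriv 2 Q x
      - 3 * iteratedDeriv 1 Q x * iteratedDeriv 1 Q x
      - 3 * Q x * iteratedDeriv 2 Q x + 2 * iteratedDeriv 2 Q x * iteratedDeriv 2 Q x
      + 3 * iteratedDeriv 1 Q x * iteratedDeriv 3 Q x := by
  have h := hQ.hasDerivAt_iter hκ hc
  have h0 : HasDerivAt Q (iteratedDeriv 1 Q x) x := by simpa using h 0 x
  have l := (h0.const_sub c).mul (h 3 x)
  have r := (((h 1 x).const_mul (c - 2 * κ)).sub ((h0.const_mul 3).mul (h 1 x))).add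
    (((h 1 x).const_mul 2).mul (h 2 x))
  have := l.unique (r.congr_of_eventuallyEq (Eventually.of_forall fun y => hQ.eq3 hκ hc y))
  linear_combination this

theorem IsSolitaryWave.eq5 (hκ : 0 < κ) (hc : 2 * κ < c) (hQ : IsSolitaryWave κ c Q) (x : ℝ) :
    (c - Q x) * iteratedDeriv 5 Q x = (c - 2 * κ) * iteratedDeriv 3 Q x
      - 9 * iteratedDeriv 1 Q x * iteratedDeriv 2 Q x
      - 3 * Q x * iteratedDeriv 3 Q x + 7 * iteratedDeriv 2 Q x * iteratedDeriv 3 Q x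
      + 4 * iteratedDeriv 1 Q x * iteratedDeriv 4 Q x := by
  have h := hQ.hasDerivAt_iter hκ hc
  have h0 : HasDerivAt Q (iteratedDeriv 1 Q x) x := by simpa using h 0 x
  have l := (h0.const_sub c).mul (h 4 x)
  have r := (((((h 2 x).const_mul (c - 2 * κ)).sub (((h 1 x).const_mul 3).mul (h 1 x))).sub
    ((h0.const_mul 3).mul (h 2 x))).add (((h 2 x).const_mul 2).mul (h 2 x))).add
    (((h 1 x).const_mul 3).mul (h 3 x))
  have := l.unique (r.congr_of_eventuallyEq (Eventually.of_forall fun y => hQ.eq4 hκ hc y))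
  linear_combination this

/-- The differentiated equations express $(c-Q)Q^{(j)}$ as a sum of terms each containing an already
dominated factor, the remaining factors being bounded. The fifth derivative is needed to place $Q'$
in $H^4$. -/
theorem IsSolitaryWave.domBy (hκ : 0 < κ) (hc : 2 * κ < c) (hQ : IsSolitaryWave κ c Q)
    (hev : Function.Even Q) (j : ℕ) (hj : j ≤ 5) : DomBy Q (iteratedDeriv j Q) := by
  have b0 := hQ.bdd0
  have d0 : DomBy Q Q := ⟨1, fun x => by rw [one_mul, abs_of_pos (hQ.pos hκ hc hev x)]⟩
  have d1 : DomBy Q (iteratedDeriv 1 Q) := ⟨1, fun x => by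
    rw [one_mul, iteratedDeriv_one, ← abs_of_pos (hQ.pos hκ hc hev x)]
    simpa using hQ.abs_deriv_le hκ hc x⟩
  have b1 := d1.bdd b0
  have d2 : DomBy Q (iteratedDeriv 2 Q) := by
    refine DomBy.of_mul hκ hc hQ (fun x => hQ.eq2 x) ?_
    have := ((d0.const_mul (c - 2 * κ)).add ((d0.mul b0).const_mul (-(3 / 2)))).add
      ((d1.mul b1).const_mul (1 / 2))
    refine (congrArg (DomBy Q) ?_).mp this
    funext x
    ring
  have b2 := d2.bdd b0
  have d3 : DomBy Q (iteratedDeriv 3 Q) := by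
    refine DomBy.of_mul hκ hc hQ (fun x => hQ.eq3 hκ hc x) ?_
    have := ((d1.const_mul (c - 2 * κ)).add ((d1.mul b0).const_mul (-3))).add
      ((d2.mul b1).const_mul 2)
    refine (congrArg (DomBy Q) ?_).mp this
    funext x
    ring
  have b3 := d3.bdd b0
  have d4 : DomBy Q (iteratedDeriv 4 Q) := by
    refine DomBy.of_mul hκ hc hQ (fun x => hQ.eq4 hκ hc x) ?_
    have := ((((d2.const_mul (c - 2 * κ)).add ((d1.mul b1).const_mul (-3))).add
      ((d2.mul b0).const_mul (-3))).add ((d2.mul b2).const_mul 2)).add ((d3.mul b1).const_mul 3)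
    refine (congrArg (DomBy Q) ?_).mp this
    funext x
    ring
  have d5 : DomBy Q (iteratedDeriv 5 Q) := by
    refine DomBy.of_mul hκ hc hQ (fun x => hQ.eq5 hκ hc x) ?_
    have := ((((d3.const_mul (c - 2 * κ)).add ((d2.mul b1).const_mul (-9))).add
      ((d3.mul b0).const_mul (-3))).add ((d3.mul b2).const_mul 7)).add ((d4.mul b1).const_mul 4)
    refine (congrArg (DomBy Q) ?_).mp this
    funext x
    ring
  interval_cases j
  · simpa using d0
  · exact d1
  · exact d2
  · exact d3
  · exact d4
  · exact d5

theorem DomBy.tendsto {f : ℝ → ℝ} {l : Filter ℝ} (hf : DomBy Q f) (hQ : Tendsto Q l (𝓝 0)) :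
    Tendsto f l (𝓝 0) := by
  obtain ⟨C, hC⟩ := hf
  refine squeeze_zero_norm hC ?_
  simpa using hQ.const_mul C

/-- `Q'/Q → -√((c - 2κ)/c)` at infinity. -/
theorem IsSolitaryWave.tendsto_deriv_div (hκ : 0 < κ) (hc : 2 * κ < c)
    (hQ : IsSolitaryWave κ c Q) (hev : Function.Even Q) :
    Tendsto (fun x => iteratedDeriv 1 Q x / Q x) atTop (𝓝 (-√((c - 2 * κ) / c))) := by
  have h : Tendsto (fun x => -√((c - 2 * κ - Q x) / (c - Q x))) atTop
      (𝓝 (-√((c - 2 * κ - 0) / (c - 0)))) := by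
    refine (((hQ.tendsto_atTop.const_sub _).div (hQ.tendsto_atTop.const_sub c) ?_).sqrt).neg
    linarith
  simp only [sub_zero] at h
  refine h.congr' ?_
  filter_upwards [eventually_gt_atTop 0] with x hx
  have hp := hQ.pos hκ hc hev x
  have hd := hQ.deriv_neg hκ hc hev hx
  have hs := hQ.pos_sub hκ hc x
  have e : (c - 2 * κ - Q x) / (c - Q x) = (-(deriv Q x) / Q x) ^ 2 := by
    field_simp
    linear_combination -hQ.energy x
  rw [e, Real.sqrt_sq (div_nonneg (by linarith) hp.le), iteratedDeriv_one]
  ring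

/-- `Q''/Q → (c - 2κ)/c` at infinity. -/
theorem IsSolitaryWave.tendsto_deriv2_div (hκ : 0 < κ) (hc : 2 * κ < c)
    (hQ : IsSolitaryWave κ c Q) (hev : Function.Even Q) :
    Tendsto (fun x => iteratedDeriv 2 Q x / Q x) atTop (𝓝 ((c - 2 * κ) / c)) := by
  have h1 := hQ.tendsto_deriv_div hκ hc hev
  have t1 := (hQ.domBy hκ hc hev 1 (by norm_num)).tendsto hQ.tendsto_atTop
  have h : Tendsto (fun x => ((c - 2 * κ) - 3 / 2 * Q x
      + 1 / 2 * ((iteratedDeriv 1 Q x / Q x) * iteratedDeriv 1 Q x)) / (c - Q x)) atTop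
      (𝓝 (((c - 2 * κ) - 3 / 2 * 0 + 1 / 2 * (-√((c - 2 * κ) / c) * 0)) / (c - 0))) := by
    refine Tendsto.div ((tendsto_const_nhds.sub (hQ.tendsto_atTop.const_mul _)).add
      ((h1.mul t1).const_mul _)) (hQ.tendsto_atTop.const_sub c) ?_
    linarith
  simp only [mul_zero, sub_zero, add_zero] at h
  refine h.congr fun x => ?_
  have hp := (hQ.pos hκ hc hev x).ne'
  have hs := (hQ.pos_sub hκ hc x).ne'
  field_simp
  linear_combination -2 * hQ.eq2 x

/-- This limit bounds the Jacobi boundary term at infinity and is the decay rate with which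
eigenfunctions are compared. -/
theorem IsSolitaryWave.tendsto_deriv2_div_deriv (hκ : 0 < κ) (hc : 2 * κ < c)
    (hQ : IsSolitaryWave κ c Q) (hev : Function.Even Q) :
    Tendsto (fun x => iteratedDeriv 2 Q x / iteratedDeriv 1 Q x) atTop
      (𝓝 (-√((c - 2 * κ) / c))) := by
  have hpos : 0 < (c - 2 * κ) / c := div_pos (by linarith) (by linarith)
  have hs := Real.sqrt_pos.2 hpos
  have h := (hQ.tendsto_deriv2_div hκ hc hev).div (hQ.tendsto_deriv_div hκ hc hev)
    (neg_ne_zero.2 hs.ne')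
  have e : (c - 2 * κ) / c / -√((c - 2 * κ) / c) = -√((c - 2 * κ) / c) := by
    rw [div_neg, Real.div_sqrt]
  rw [e] at h
  refine h.congr fun x => ?_
  have hp := (hQ.pos hκ hc hev x).ne'
  simp only [Pi.div_apply]
  rw [div_div_div_cancel_right₀ hp]

/-- Near infinity $Q\le-(2/\nu)Q'$ with $\nu=\sqrt{(c-2\kappa)/c}$, and $Q'$ is integrable there
because $Q$ decreases to zero; evenness covers the other half-line. -/
theorem IsSolitaryWave.integrable (hκ : 0 < κ) (hc : 2 * κ < c)
    (hQ : IsSolitaryWave κ c Q) (hev : Function.Even Q) : Integrable Q := by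
  have hpos : 0 < (c - 2 * κ) / c := div_pos (by linarith) (by linarith)
  have hs := Real.sqrt_pos.2 hpos
  set ν := √((c - 2 * κ) / c)
  have h1 := hQ.tendsto_deriv_div hκ hc hev
  obtain ⟨X, hX⟩ := eventually_atTop.1
    ((h1.eventually (gt_mem_nhds (show -ν < -(ν / 2) by linarith))).and (eventually_gt_atTop 0))
  have hd : ∀ x, HasDerivAt Q (iteratedDeriv 1 Q x) x := fun x => by
    simpa using hQ.hasDerivAt_iter hκ hc 0 x
  have i1 : IntegrableOn (iteratedDeriv 1 Q) (Set.Ioi X) :=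
    integrableOn_Ioi_deriv_of_nonpos' (fun x _ => hd x) (fun x hx => by
      have h0 := (hX X le_rfl).2
      rw [iteratedDeriv_one]
      exact (hQ.deriv_neg hκ hc hev (h0.trans hx)).le) hQ.tendsto_atTop
  have hcQ := hQ.contDiff.continuous
  have i2 : IntegrableOn Q (Set.Ioi X) := by
    refine (i1.const_mul (-(2 / ν))).mono' hcQ.aestronglyMeasurable ?_
    refine (ae_restrict_iff' measurableSet_Ioi).2 (Eventually.of_forall fun x hx => ?_)
    have hp := hQ.pos hκ hc hev x
    have := (hX x (le_of_lt hx)).1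
    rw [div_lt_iff₀ hp] at this
    rw [Real.norm_of_nonneg hp.le]
    have e : Q x = 2 / ν * (ν / 2 * Q x) := by field_simp
    rw [e, neg_mul, ← mul_neg]
    exact mul_le_mul_of_nonneg_left (by linarith) (by positivity)
  have i3 : IntegrableOn Q (Set.Ioi 0) := by
    have hX0 := (hX X le_rfl).2
    rw [← Set.Ioc_union_Ioi_eq_Ioi hX0.le]
    exact ((hcQ.integrableOn_Icc (a := 0) (b := X)).mono_set Set.Ioc_subset_Icc_self).union i2
  have i4 : IntegrableOn Q (Set.Iic 0) := by
    have h : IntegrableOn Q (Set.Ici (-0)) := by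
      rw [neg_zero]
      exact Iff.mpr integrableOn_Ici_iff_integrableOn_Ioi i3
    have h2 := h.comp_neg_Iic
    have e : (fun x => Q (-x)) = Q := funext hev
    rwa [e] at h2
  rw [← integrableOn_univ, ← Set.Iic_union_Ioi (a := (0 : ℝ))]
  exact i4.union i3

theorem DomBy.memLp {f : ℝ → ℝ} (hκ : 0 < κ) (hc : 2 * κ < c)
    (hQ : IsSolitaryWave κ c Q) (hev : Function.Even Q) (hf : DomBy Q f) (hfc : Continuous f) :
    MemLp (fun x => (f x : ℂ)) 2 := by
  have hQ2 : MemLp Q 2 := by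
    rw [memLp_two_iff_integrable_sq hQ.contDiff.continuous.aestronglyMeasurable]
    obtain ⟨C, hC⟩ := hQ.bdd0
    simp only [sq]
    exact (hQ.integrable hκ hc hev).bdd_mul hQ.contDiff.continuous.aestronglyMeasurable
      (Eventually.of_forall hC)
  obtain ⟨C, hC⟩ := hf
  refine hQ2.of_le_mul (c := C) (Complex.continuous_ofReal.comp hfc).aestronglyMeasurable
    (Eventually.of_forall fun x => ?_)
  rw [Complex.norm_real, Real.norm_of_nonneg (hQ.pos hκ hc hev x).le]
  exact hC x

end Profile

/-! ### The form of `L` -/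

theorem inner_mulOp (a : ℝ →ᵇ ℝ) (f g : L2) : inner ℂ f (mulOp a g) = inner ℂ (mulOp a f) g := by
  rw [inner_L2_eq, inner_L2_eq]
  refine integral_congr_ae ?_
  filter_upwards [coeFn_mulOp a f, coeFn_mulOp a g] with x h1 h2
  rw [h1, h2, star_mul]
  simp
  ring

theorem norm_mulOp_le (a : ℝ →ᵇ ℝ) (f : L2) : ‖mulOp a f‖ ≤ ‖a‖ * ‖f‖ := by
  refine Lp.norm_le_mul_norm_of_ae_le_mul ?_
  filter_upwards [coeFn_mulOp a f] with x h
  rw [h, norm_mul, Complex.norm_real]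
  exact mul_le_mul_of_nonneg_right (a.norm_coe_le_norm x) (norm_nonneg _)

theorem integrable_norm_sq (f : L2) : Integrable fun x => ‖f x‖ ^ 2 :=
  (memLp_two_iff_integrable_sq_norm (Lp.aestronglyMeasurable f)).1 (Lp.memLp f)

theorem integrable_mul_norm_sq (a : ℝ →ᵇ ℝ) (f : L2) : Integrable fun x => a x * ‖f x‖ ^ 2 :=
  (integrable_norm_sq f).bdd_mul a.continuous.aestronglyMeasurable
    (Eventually.of_forall a.norm_coe_le_norm)

theorem inner_mulOp_self (a : ℝ →ᵇ ℝ) (f : L2) :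
    inner ℂ f (mulOp a f) = ((∫ x, a x * ‖f x‖ ^ 2 : ℝ) : ℂ) := by
  rw [inner_L2_eq, ← integral_complex_ofReal]
  refine integral_congr_ae ?_
  filter_upwards [coeFn_mulOp a f] with x h
  rw [h]
  have := Complex.conj_mul' (f x)
  simp only [Complex.star_def, Complex.ofReal_mul, Complex.ofReal_pow]
  linear_combination (a x : ℂ) * this

theorem norm_sq_eq_integral (f : L2) : ‖f‖ ^ 2 = ∫ x, ‖f x‖ ^ 2 := by
  have h : inner ℂ f f = ((∫ x, ‖f x‖ ^ 2 : ℝ) : ℂ) := by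
    rw [inner_L2_eq, ← integral_complex_ofReal]
    refine integral_congr_ae (Eventually.of_forall fun x => ?_)
    have := Complex.conj_mul' (f x)
    simpa using this
  rw [inner_self_eq_norm_sq_to_K] at h
  have := congrArg Complex.re h
  rw [Complex.ofReal_re] at this
  rw [← this]
  exact (Complex.ofReal_re (‖f‖ ^ 2)).symm.trans (congrArg Complex.re (Complex.ofReal_pow _ _))

theorem le_inner_mulOp_self {a : ℝ →ᵇ ℝ} {m : ℝ} (ha : ∀ x, m ≤ a x) (f : L2) :
    m * ‖f‖ ^ 2 ≤ (inner ℂ f (mulOp a f)).re := by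
  rw [inner_mulOp_self, Complex.ofReal_re, norm_sq_eq_integral, ← integral_const_mul]
  exact integral_mono ((integrable_norm_sq f).const_mul m) (integrable_mul_norm_sq a f)
    fun x => mul_le_mul_of_nonneg_right (ha x) (sq_nonneg _)

/-- The interpolation inequality `‖f'‖² ≤ ‖f‖ ‖f''‖`. -/
theorem HasWeakDeriv.norm_sq_le {f g h : L2} (hf : HasWeakDeriv f g) (hg : HasWeakDeriv g h) :
    ‖g‖ ^ 2 ≤ ‖f‖ * ‖h‖ := by
  have e : inner ℂ g g = -inner ℂ f h := hf.inner_eq hg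
  have e2 : ‖inner ℂ g g‖ = ‖g‖ ^ 2 := by
    rw [inner_self_eq_norm_sq_to_K]
    simp
  rw [← e2, e, norm_neg]
  exact norm_inner_le_norm _ _

section Form

variable {κ c : ℝ} {Q : ℝ → ℝ}

/-- The leading coefficient `c - Q`. -/
def coefP (hκ : 0 < κ) (hc : 2 * κ < c) (hQ : IsSolitaryWave κ c Q) : ℝ →ᵇ ℝ :=
  BoundedContinuousFunction.const ℝ c - waveDeriv hκ hc hQ 0

/-- The potential `Q'' - 3Q + c - 2κ`. -/
def coefV (hκ : 0 < κ) (hc : 2 * κ < c) (hQ : IsSolitaryWave κ c Q) : ℝ →ᵇ ℝ :=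
  waveDeriv hκ hc hQ 2 - BoundedContinuousFunction.const ℝ 3 * waveDeriv hκ hc hQ 0
    + BoundedContinuousFunction.const ℝ (c - 2 * κ)

theorem coefP_apply (hκ : 0 < κ) (hc : 2 * κ < c) (hQ : IsSolitaryWave κ c Q) (x : ℝ) :
    coefP hκ hc hQ x = c - Q x := by
  change c - iteratedDeriv 0 Q x = _
  rw [iteratedDeriv_zero]

theorem coefV_apply (hκ : 0 < κ) (hc : 2 * κ < c) (hQ : IsSolitaryWave κ c Q) (x : ℝ) :
    coefV hκ hc hQ x = iteratedDeriv 2 Q x - 3 * Q x + (c - 2 * κ) := by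
  change iteratedDeriv 2 Q x - 3 * iteratedDeriv 0 Q x + (c - 2 * κ) = _
  rw [iteratedDeriv_zero]

/-- Two integrations by parts. The symmetry and the lower bound of $L$ are read off from the
resulting form. -/
theorem inner_opL (hκ : 0 < κ) (hc : 2 * κ < c) (hQ : IsSolitaryWave κ c Q) (χ ψ : Sobolev 4) :
    inner ℂ (jet 4 0 χ) (opL hκ hc hQ ψ)
      = inner ℂ (jet 4 2 χ) (mulOp (coefP hκ hc hQ) (jet 4 2 ψ))
        + inner ℂ (jet 4 1 χ) (mulOp (coefV hκ hc hQ) (jet 4 1 ψ)) := by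
  have d0 : ∀ x, HasDerivAt (waveDeriv hκ hc hQ 0) (waveDeriv hκ hc hQ 1 x) x :=
    waveDeriv_deriv hκ hc hQ 0
  set q := waveDeriv hκ hc hQ with hq
  let C := BoundedContinuousFunction.const (β := ℝ) ℝ
  have w0 : HasWeakDeriv (jet 4 0 χ) (jet 4 1 χ) := jet_weakDeriv 4 χ 0
  have w1 : HasWeakDeriv (jet 4 1 χ) (jet 4 2 χ) := jet_weakDeriv 4 χ 1
  have w2 : HasWeakDeriv (jet 4 2 ψ) (jet 4 3 ψ) := jet_weakDeriv 4 ψ 2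
  have t1 := HasWeakDeriv.mulOp (a := q 0 - C c) (b := q 1)
    ((waveDeriv_smooth hκ hc hQ 0).sub contDiff_const) (fun x => ((d0 x).sub_const c).deriv) w2
  have h1 := w0.inner_eq (opL_spec hκ hc hQ ψ)
  rw [inner_neg_right, neg_neg] at h1
  have h2 := t1.inner_eq w1
  have h3 := w1.inner_eq t1
  rw [← h1]
  have e : opM hκ hc hQ (incl (by norm_num : 2 ≤ 3) (dx 3 ψ))
      = (mulOp (q 1) (jet 4 2 ψ) + mulOp (q 0 - C c) (jet 4 3 ψ))
        + mulOp (coefV hκ hc hQ) (jet 4 1 ψ) := by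
    change mulOp (q 0 - C c) (jet 4 3 ψ) + mulOp (q 1) (jet 4 2 ψ)
      + mulOp (coefV hκ hc hQ) (jet 4 1 ψ) = _
    rw [add_comm (mulOp (q 0 - C c) (jet 4 3 ψ))]
  have e2 : mulOp (coefP hκ hc hQ) (jet 4 2 ψ) = -mulOp (q 0 - C c) (jet 4 2 ψ) := by
    change mulOp (C c - q 0) _ = _
    rw [mulOp_sub, mulOp_sub, neg_sub]
  rw [e, inner_add_right, e2, inner_neg_right, h3, neg_neg]

theorem isSymm_opL (hκ : 0 < κ) (hc : 2 * κ < c) (hQ : IsSolitaryWave κ c Q) :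
    IsSymm (jet 4 0) (opL hκ hc hQ) := by
  intro u v
  rw [inner_opL, ← inner_conj_symm (opL hκ hc hQ u), inner_opL, map_add, inner_conj_symm,
    inner_conj_symm, inner_mulOp, inner_mulOp]

theorem qform_opL (hκ : 0 < κ) (hc : 2 * κ < c) (hQ : IsSolitaryWave κ c Q) (ψ : Sobolev 4) :
    qform (jet 4 0) (opL hκ hc hQ) ψ
      = (∫ x, coefP hκ hc hQ x * ‖jet 4 2 ψ x‖ ^ 2)
        + ∫ x, coefV hκ hc hQ x * ‖jet 4 1 ψ x‖ ^ 2 := by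
  rw [qform, inner_opL, inner_mulOp_self, inner_mulOp_self, Complex.add_re, Complex.ofReal_re,
    Complex.ofReal_re]

/-- The leading coefficient is at least $2\kappa$ since $Q\le c-2\kappa$. The potential term is
bounded through $\|\psi'\|^2\le\|\psi\|\|\psi''\|$ and Young's inequality, spending half of that
$2\kappa$. -/
theorem qform_coercive (hκ : 0 < κ) (hc : 2 * κ < c) (hQ : IsSolitaryWave κ c Q) :
    ∃ K : ℝ, 0 ≤ K ∧ ∀ ψ : Sobolev 4, κ * ‖jet 4 2 ψ‖ ^ 2 + ‖jet 4 0 ψ‖ ^ 2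
      ≤ qform (jet 4 0) (opL hκ hc hQ) ψ + K * ‖jet 4 0 ψ‖ ^ 2 := by
  set v := ‖coefV hκ hc hQ‖ with hv
  refine ⟨v ^ 2 / (4 * κ) + 1, by positivity, fun ψ => ?_⟩
  have h1 : 2 * κ * ‖jet 4 2 ψ‖ ^ 2 ≤
      (inner ℂ (jet 4 2 ψ) (mulOp (coefP hκ hc hQ) (jet 4 2 ψ))).re :=
    le_inner_mulOp_self (fun x => by
      rw [coefP_apply]
      linarith [hQ.le hκ hc x]) _
  have h2 : -v * ‖jet 4 1 ψ‖ ^ 2 ≤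
      (inner ℂ (jet 4 1 ψ) (mulOp (coefV hκ hc hQ) (jet 4 1 ψ))).re :=
    le_inner_mulOp_self (fun x => neg_le_of_abs_le ((coefV hκ hc hQ).norm_coe_le_norm x)) _
  have h3 : ‖jet 4 1 ψ‖ ^ 2 ≤ ‖jet 4 0 ψ‖ * ‖jet 4 2 ψ‖ :=
    HasWeakDeriv.norm_sq_le (jet_weakDeriv 4 ψ 0) (jet_weakDeriv 4 ψ 1)
  have h4 : v * ‖jet 4 1 ψ‖ ^ 2 ≤ v * (‖jet 4 0 ψ‖ * ‖jet 4 2 ψ‖) :=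
    mul_le_mul_of_nonneg_left h3 (norm_nonneg _)
  have h5 : v * (‖jet 4 0 ψ‖ * ‖jet 4 2 ψ‖)
      ≤ κ * ‖jet 4 2 ψ‖ ^ 2 + v ^ 2 / (4 * κ) * ‖jet 4 0 ψ‖ ^ 2 := by
    have h : 0 ≤ (2 * κ * ‖jet 4 2 ψ‖ - v * ‖jet 4 0 ψ‖) ^ 2 / (4 * κ) := by positivity
    have e : (2 * κ * ‖jet 4 2 ψ‖ - v * ‖jet 4 0 ψ‖) ^ 2 / (4 * κ) = κ * ‖jet 4 2 ψ‖ ^ 2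
        + v ^ 2 / (4 * κ) * ‖jet 4 0 ψ‖ ^ 2 - v * (‖jet 4 0 ψ‖ * ‖jet 4 2 ψ‖) := by
      field_simp
      ring
    linarith
  rw [qform, inner_opL, Complex.add_re]
  linarith

end Form

/-! ### Solving the constant coefficient problem -/

/-- The `j`-th weak derivative as a bounded operator. -/
def jetL (k : ℕ) (j : Fin (k + 1)) : Sobolev k →L[ℂ] L2 :=
  ⟨jet k j, (PiLp.continuous_apply 2 _ j).comp continuous_subtype_val⟩

/-- Riesz representation in $H^1$ of the functional $\varphi\mapsto\langle f,\varphi\rangle_{L^2}$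
gives the weak solution of $u-u''=f$. -/
theorem exists_helmholtz (f : L2) :
    ∃ u v : L2, HasWeakDeriv u v ∧ HasWeakDeriv v (u - f : L2) := by
  let ℓ : StrongDual ℂ (Sobolev 1) := (innerSL ℂ f) ∘L (jetL 1 0)
  let w := (InnerProductSpace.toDual ℂ (Sobolev 1)).symm ℓ
  have hw : ∀ φ : Sobolev 1, inner ℂ w φ = inner ℂ f (jet 1 0 φ) := fun φ => by
    have := InnerProductSpace.toDual_symm_apply (𝕜 := ℂ) (x := φ) (y := ℓ)
    exact this
  refine ⟨jet 1 0 w, jet 1 1 w, jet_weakDeriv 1 w 0, fun φ hφ hs => ?_⟩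
  have hφ' := (contDiff_infty_iff_deriv.1 hφ).2.continuous
  have hwd : HasWeakDeriv (testL2 hφ.continuous hs) (testL2 hφ' hs.deriv) := by
    have hp : IsPrimitive (fun x => (φ x : ℂ)) (fun x => ((deriv φ x : ℝ) : ℂ)) :=
      IsPrimitive.of_hasDerivAt
        (fun x => ((hφ.differentiable (by simp) x).hasDerivAt).ofReal_comp)
        (Complex.continuous_ofReal.comp hφ')
    exact hp.hasWeakDeriv.congr (MemLp.coeFn_toLp _) (MemLp.coeFn_toLp _)
  let Φ : Sobolev 1 := ⟨WithLp.toLp 2 ![testL2 hφ.continuous hs, testL2 hφ' hs.deriv], fun j => by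
    fin_cases j
    exact hwd⟩
  have h := hw Φ
  have h' : inner ℂ Φ w = inner ℂ (jet 1 0 Φ) f := by
    rw [← inner_conj_symm Φ w, h, inner_conj_symm]
  rw [Submodule.coe_inner, PiLp.inner_apply, Fin.sum_univ_two] at h'
  change inner ℂ (testL2 hφ.continuous hs) (jet 1 0 w)
    + inner ℂ (testL2 hφ' hs.deriv) (jet 1 1 w) = inner ℂ (testL2 hφ.continuous hs) f at h'
  have e := inner_testL2 hφ.continuous hs (jet 1 0 w - f)
  rw [inner_sub_right] at e
  rw [← e, ← inner_testL2 hφ' hs.deriv]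
  linear_combination h'

theorem exists_helmholtz_odd {f : L2} (hf : f ∈ L2odd) :
    ∃ u v : L2, u ∈ L2odd ∧ HasWeakDeriv u v ∧ HasWeakDeriv v (u - f : L2) := by
  obtain ⟨u, v, huv, hv⟩ := exists_helmholtz f
  refine ⟨u, v, ?_, huv, hv⟩
  rw [mem_L2parity_iff] at hf ⊢
  -- For odd $f$ the sum $U$ of $u$ and its reflection solves $U''=U$, and integration by parts
  -- gives $\|U'\|^2=-\|U\|^2$, hence $U=0$.
  have w1 : HasWeakDeriv (u + reflect u : L2) (v + -reflect v : L2) := huv.add huv.reflect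
  have w2 : HasWeakDeriv (v + -reflect v : L2) (u + reflect u : L2) := by
    have h := hv.add (hv.reflect.smul (-1))
    rw [neg_one_smul, neg_one_smul, neg_neg, map_sub, hf,
      show u - f + (reflect u - (-1 : ℂ) • f) = u + reflect u by module] at h
    exact h
  have h := w1.inner_eq w2
  have h0 : ‖u + reflect u‖ ^ 2 = 0 := by
    rw [inner_self_eq_norm_sq_to_K, inner_self_eq_norm_sq_to_K] at h
    have h1 : ‖v + -reflect v‖ ^ 2 = -‖u + reflect u‖ ^ 2 := by
      have h2 : ((‖v + -reflect v‖ ^ 2 : ℝ) : ℂ) = ((-‖u + reflect u‖ ^ 2 : ℝ) : ℂ) := by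
        push_cast
        exact h
      exact_mod_cast h2
    linarith [sq_nonneg ‖v + -reflect v‖, sq_nonneg ‖u + reflect u‖]
  have h3 : u + reflect u = 0 := norm_eq_zero.1 (pow_eq_zero_iff two_ne_zero |>.1 h0)
  rw [neg_one_smul]
  exact eq_neg_of_add_eq_zero_right h3

/-- `(1 - ∂ₓ²)²` on `H⁴`. -/
def bessel : Sobolev 4 →ₗ[ℂ] L2 := jet 4 0 - (2 : ℂ) • jet 4 2 + jet 4 4

theorem jet_odd (ψ : SobolevOdd 4) :
    jet 4 0 (oddIncl 4 ψ) ∈ L2odd ∧ jet 4 2 (oddIncl 4 ψ) ∈ L2odd ∧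
      jet 4 4 (oddIncl 4 ψ) ∈ L2odd := by
  have h := jet_parity 4 (oddIncl 4 ψ) ψ.2.2
  refine ⟨ψ.2.2, ?_, ?_⟩
  · simpa using h 2
  · simpa [pow_succ] using h 4

theorem bessel_odd (ψ : SobolevOdd 4) : bessel (oddIncl 4 ψ) ∈ L2odd := by
  obtain ⟨h0, h2, h4⟩ := jet_odd ψ
  exact L2odd.add_mem (L2odd.sub_mem h0 (L2odd.smul_mem _ h2)) h4

/-- `(1 - ∂ₓ²)²` from `H⁴_odd` to `L²_odd`. -/
def besselOdd : SobolevOdd 4 →ₗ[ℂ] L2odd :=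
  (bessel ∘ₗ oddIncl 4).codRestrict L2odd bessel_odd

/-- The Helmholtz problem is solved twice; the equations themselves provide the second, third and
fourth derivatives. -/
theorem besselOdd_surjective : Function.Surjective besselOdd := by
  rintro ⟨f, hf⟩
  obtain ⟨v, v₁, hv, hvv, hv₁⟩ := exists_helmholtz_odd hf
  obtain ⟨u, u₁, hu, huu, hu₁⟩ := exists_helmholtz_odd hv
  have w2 : HasWeakDeriv (u - v : L2) (u₁ - v₁ : L2) := by
    have h := huu.add (hvv.smul (-1))
    simpa [sub_eq_add_neg] using h
  have w3 : HasWeakDeriv (u₁ - v₁ : L2) (u - v - (v - f) : L2) := by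
    have h := hu₁.add (hv₁.smul (-1))
    rw [neg_one_smul, neg_one_smul] at h
    rw [sub_eq_add_neg u₁, sub_eq_add_neg _ (v - f)]
    exact h
  let ψ : SobolevOdd 4 := ⟨WithLp.toLp 2 ![u, u₁, u - v, u₁ - v₁, u - v - (v - f)],
    fun j => by
      fin_cases j
      · exact huu
      · exact hu₁
      · exact w2
      · exact w3, hu⟩
  refine ⟨ψ, Subtype.ext ?_⟩
  change u - (2 : ℂ) • (u - v) + (u - v - (v - f)) = f
  module

/-! ### Elliptic estimate and surjectivity of $L+K$ -/

section Onto

variable {κ c : ℝ} {Q : ℝ → ℝ}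

theorem norm_opL_sub_le (hκ : 0 < κ) (hc : 2 * κ < c) (hQ : IsSolitaryWave κ c Q) :
    ∃ C, 0 ≤ C ∧ ∀ ψ : Sobolev 4, ‖opL hκ hc hQ ψ - mulOp (coefP hκ hc hQ) (jet 4 4 ψ)‖
      ≤ C * (‖jet 4 1 ψ‖ + ‖jet 4 2 ψ‖ + ‖jet 4 3 ψ‖) := by
  set q := waveDeriv hκ hc hQ with hq
  let C := BoundedContinuousFunction.const (β := ℝ) ℝ
  set a3 := C 2 * q 1
  set a2 := C 2 * q 2 - C 3 * q 0 + C (c - 2 * κ)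
  set a1 := q 3 - C 3 * q 1
  refine ⟨‖a1‖ + ‖a2‖ + ‖a3‖, by positivity, fun ψ => ?_⟩
  have e : opL hκ hc hQ ψ - mulOp (coefP hκ hc hQ) (jet 4 4 ψ)
      = -(mulOp a3 (jet 4 3 ψ) + mulOp a2 (jet 4 2 ψ) + mulOp a1 (jet 4 1 ψ)) := by
    change mulOp (coefP hκ hc hQ) (jet 4 4 ψ) - mulOp a3 (jet 4 3 ψ) - mulOp a2 (jet 4 2 ψ)
      - mulOp a1 (jet 4 1 ψ) - mulOp (coefP hκ hc hQ) (jet 4 4 ψ) = _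
    abel
  rw [e, norm_neg]
  refine (norm_add₃_le).trans ?_
  have h1 := norm_mulOp_le a1 (jet 4 1 ψ)
  have h2 := norm_mulOp_le a2 (jet 4 2 ψ)
  have h3 := norm_mulOp_le a3 (jet 4 3 ψ)
  have n1 := norm_nonneg (jet 4 1 ψ)
  have n2 := norm_nonneg (jet 4 2 ψ)
  have n3 := norm_nonneg (jet 4 3 ψ)
  have m1 := norm_nonneg a1
  have m2 := norm_nonneg a2
  have m3 := norm_nonneg a3
  nlinarith [mul_nonneg m1 n2, mul_nonneg m1 n3, mul_nonneg m2 n1, mul_nonneg m2 n3,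
    mul_nonneg m3 n1, mul_nonneg m3 n2]

/-- The form of $(1-\partial_x^2)^2$ is $\|\psi\|^2+2\|\psi'\|^2+\|\psi''\|^2$. Both ends of the
homotopy are coercive with the constant $\min(1,\kappa)$, and the form is affine in $t$. -/
theorem coercive_opL_add (hκ : 0 < κ) (hc : 2 * κ < c) (hQ : IsSolitaryWave κ c Q) {K : ℝ}
    (hK : ∀ ψ : Sobolev 4, κ * ‖jet 4 2 ψ‖ ^ 2 + ‖jet 4 0 ψ‖ ^ 2
      ≤ qform (jet 4 0) (opL hκ hc hQ) ψ + K * ‖jet 4 0 ψ‖ ^ 2) {t : ℝ} (h0 : 0 ≤ t) (h1 : t ≤ 1)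
    (ψ : Sobolev 4) :
    min 1 κ * (‖jet 4 2 ψ‖ ^ 2 + ‖jet 4 0 ψ‖ ^ 2) ≤ (inner ℂ (jet 4 0 ψ)
      (((1 - t : ℝ) : ℂ) • bessel ψ + (t : ℂ) • (opL hκ hc hQ ψ + (K : ℂ) • jet 4 0 ψ))).re := by
  have w0 := jet_weakDeriv 4 ψ 0
  have w1 := jet_weakDeriv 4 ψ 1
  have w2 := jet_weakDeriv 4 ψ 2
  have w3 := jet_weakDeriv 4 ψ 3
  have e1 : inner ℂ (jet 4 0 ψ) (jet 4 2 ψ) = -inner ℂ (jet 4 1 ψ) (jet 4 1 ψ) := by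
    have a : inner ℂ (jet 4 1 ψ) (jet 4 1 ψ) = -inner ℂ (jet 4 0 ψ) (jet 4 2 ψ) := w0.inner_eq w1
    rw [a, neg_neg]
  have e2 : inner ℂ (jet 4 0 ψ) (jet 4 4 ψ) = inner ℂ (jet 4 2 ψ) (jet 4 2 ψ) := by
    have a : inner ℂ (jet 4 1 ψ) (jet 4 3 ψ) = -inner ℂ (jet 4 0 ψ) (jet 4 4 ψ) := w0.inner_eq w3
    have b : inner ℂ (jet 4 2 ψ) (jet 4 2 ψ) = -inner ℂ (jet 4 1 ψ) (jet 4 3 ψ) := w1.inner_eq w2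
    rw [b, a, neg_neg]
  have nsq : ∀ f : L2, (inner ℂ f f).re = ‖f‖ ^ 2 := fun f => inner_self_eq_norm_sq (𝕜 := ℂ) f
  have hb : (inner ℂ (jet 4 0 ψ) (bessel ψ)).re
      = ‖jet 4 0 ψ‖ ^ 2 + 2 * ‖jet 4 1 ψ‖ ^ 2 + ‖jet 4 2 ψ‖ ^ 2 := by
    simp only [bessel, LinearMap.add_apply, LinearMap.sub_apply, LinearMap.smul_apply,
      inner_add_right, inner_sub_right, inner_smul_right, e1, e2, Complex.add_re, Complex.sub_re]
    rw [nsq, nsq]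
    have : (2 * -inner ℂ (jet 4 1 ψ) (jet 4 1 ψ)).re = -(2 * ‖jet 4 1 ψ‖ ^ 2) := by
      rw [← nsq, mul_neg, Complex.neg_re]
      congr 1
      exact Complex.re_ofReal_mul 2 _
    rw [this]
    ring
  rw [inner_add_right, Complex.add_re, inner_smul_right, inner_smul_right, Complex.re_ofReal_mul,
    Complex.re_ofReal_mul, hb, inner_add_right, Complex.add_re, inner_self_smul_re,
    Complex.ofReal_re]
  have h2 := hK ψ
  rw [qform] at h2
  have m1 : min 1 κ ≤ 1 := min_le_left _ _
  have m2 : min 1 κ ≤ κ := min_le_right _ _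
  have s0 := sq_nonneg ‖jet 4 0 ψ‖
  have s1 := sq_nonneg ‖jet 4 1 ψ‖
  have s2 := sq_nonneg ‖jet 4 2 ψ‖
  have a1 := mul_le_mul_of_nonneg_left h2 h0
  have a2 : min 1 κ * (‖jet 4 2 ψ‖ ^ 2 + ‖jet 4 0 ψ‖ ^ 2)
      ≤ ‖jet 4 0 ψ‖ ^ 2 + 2 * ‖jet 4 1 ψ‖ ^ 2 + ‖jet 4 2 ψ‖ ^ 2 := by
    have := mul_le_mul_of_nonneg_right m1 (add_nonneg s2 s0)
    linarith
  have a3 : min 1 κ * (‖jet 4 2 ψ‖ ^ 2 + ‖jet 4 0 ψ‖ ^ 2)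
      ≤ κ * ‖jet 4 2 ψ‖ ^ 2 + ‖jet 4 0 ψ‖ ^ 2 := by
    have := mul_le_mul_of_nonneg_right m1 s0
    have := mul_le_mul_of_nonneg_right m2 s2
    linarith
  have b2 := mul_le_mul_of_nonneg_left a2 (sub_nonneg.2 h1)
  have b3 := mul_le_mul_of_nonneg_left a3 h0
  linarith

-- Coercivity controls $\psi$ and $\psi''$, interpolation controls $\psi'$. The leading coefficient
-- $(1-t)+tp$ is bounded below, so the equation controls $\psi''''$ up to $\psi'''$, which is
-- absorbed by $\|\psi'''\|^2\le\|\psi''\|\|\psi''''\|$. The constants do not depend on $t$, as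
-- continuation requires.
set_option maxHeartbeats 800000 in
theorem elliptic_bound (hκ : 0 < κ) (hc : 2 * κ < c) (hQ : IsSolitaryWave κ c Q) {K : ℝ}
    (hK : ∀ ψ : Sobolev 4, κ * ‖jet 4 2 ψ‖ ^ 2 + ‖jet 4 0 ψ‖ ^ 2
      ≤ qform (jet 4 0) (opL hκ hc hQ) ψ + K * ‖jet 4 0 ψ‖ ^ 2) :
    ∃ M, 0 ≤ M ∧ ∀ t ∈ Set.Icc (0 : ℝ) 1, ∀ ψ : Sobolev 4, ∀ j, ‖jet 4 j ψ‖ ≤ M *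
      ‖((1 - t : ℝ) : ℂ) • bessel ψ + (t : ℂ) • (opL hκ hc hQ ψ + (K : ℂ) • jet 4 0 ψ)‖ := by
  obtain ⟨C, hC0, hC⟩ := norm_opL_sub_le hκ hc hQ
  set m := min 1 κ with hm
  have hm0 : 0 < m := lt_min one_pos hκ
  set C' := 3 + 2 * C + |K| with hC'
  have hC'0 : 0 ≤ C' := by positivity
  set G := 2 / m * (m + C' + C ^ 2 / (2 * m)) with hG
  have hG0 : 0 ≤ G := by positivity
  refine ⟨(G + 1) / m, by positivity, fun t ht ψ => ?_⟩
  set f := ((1 - t : ℝ) : ℂ) • bessel ψ + (t : ℂ) • (opL hκ hc hQ ψ + (K : ℂ) • jet 4 0 ψ) with hf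
  set F := ‖f‖ / m with hF
  have hF0 : 0 ≤ F := by positivity
  have hfF : ‖f‖ = m * F := by rw [hF]; field_simp
  have n0 := norm_nonneg (jet 4 0 ψ)
  have n1 := norm_nonneg (jet 4 1 ψ)
  have n2 := norm_nonneg (jet 4 2 ψ)
  have n3 := norm_nonneg (jet 4 3 ψ)
  have n4 := norm_nonneg (jet 4 4 ψ)
  have hco : m * (‖jet 4 2 ψ‖ ^ 2 + ‖jet 4 0 ψ‖ ^ 2) ≤ ‖jet 4 0 ψ‖ * ‖f‖ :=
    (coercive_opL_add hκ hc hQ hK ht.1 ht.2 ψ).trans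
      ((Complex.re_le_norm _).trans (norm_inner_le_norm _ _))
  rw [hfF] at hco
  have hco' : ‖jet 4 2 ψ‖ ^ 2 + ‖jet 4 0 ψ‖ ^ 2 ≤ ‖jet 4 0 ψ‖ * F :=
    le_of_mul_le_mul_left (by linarith) hm0
  have b0 : ‖jet 4 0 ψ‖ ≤ F := by
    by_contra! h
    nlinarith [sq_nonneg ‖jet 4 2 ψ‖]
  have b2 : ‖jet 4 2 ψ‖ ≤ F := by
    by_contra! h
    nlinarith [sq_nonneg ‖jet 4 0 ψ‖]
  have i1 : ‖jet 4 1 ψ‖ ^ 2 ≤ ‖jet 4 0 ψ‖ * ‖jet 4 2 ψ‖ :=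
    HasWeakDeriv.norm_sq_le (jet_weakDeriv 4 ψ 0) (jet_weakDeriv 4 ψ 1)
  have i3 : ‖jet 4 3 ψ‖ ^ 2 ≤ ‖jet 4 2 ψ‖ * ‖jet 4 4 ψ‖ :=
    HasWeakDeriv.norm_sq_le (jet_weakDeriv 4 ψ 2) (jet_weakDeriv 4 ψ 3)
  have b1 : ‖jet 4 1 ψ‖ ≤ F := by
    have := mul_le_mul b0 b2 n2 hF0
    exact abs_le_of_sq_le_sq' (by nlinarith) hF0 |>.2
  set g := ((1 - t : ℝ) : ℂ) • jet 4 4 ψ + (t : ℂ) • mulOp (coefP hκ hc hQ) (jet 4 4 ψ) with hg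
  have hgl : m * ‖jet 4 4 ψ‖ ≤ ‖g‖ := by
    refine bound_of_coercive (i := jet 4 4) (B := ((1 - t : ℝ) : ℂ) • jet 4 4
      + (t : ℂ) • mulOp (coefP hκ hc hQ) ∘ₗ jet 4 4) ?_
    have h1 : 2 * κ * ‖jet 4 4 ψ‖ ^ 2 ≤
        (inner ℂ (jet 4 4 ψ) (mulOp (coefP hκ hc hQ) (jet 4 4 ψ))).re :=
      le_inner_mulOp_self (fun x => by
        rw [coefP_apply]
        linarith [hQ.le hκ hc x]) _
    simp only [LinearMap.add_apply, LinearMap.smul_apply, LinearMap.comp_apply, inner_add_right,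
      Complex.add_re]
    rw [inner_self_smul_re, Complex.ofReal_re, inner_smul_right, Complex.re_ofReal_mul]
    have m1 : m ≤ 1 := min_le_left _ _
    have m2 : m ≤ 2 * κ := (min_le_right _ _).trans (by linarith)
    have s4 := sq_nonneg ‖jet 4 4 ψ‖
    have a1 := mul_le_mul_of_nonneg_left (mul_le_mul_of_nonneg_right m1 s4) (sub_nonneg.2 ht.2)
    have a2 := mul_le_mul_of_nonneg_left ((mul_le_mul_of_nonneg_right m2 s4).trans h1) ht.1
    linarith
  have hN : ‖g‖ ≤ m * F + C' * F + C * ‖jet 4 3 ψ‖ := by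
    set r := opL hκ hc hQ ψ - mulOp (coefP hκ hc hQ) (jet 4 4 ψ) with hr
    have e : g = f - ((1 - t : ℝ) : ℂ) • (jet 4 0 ψ - (2 : ℂ) • jet 4 2 ψ)
        - (t : ℂ) • (r + (K : ℂ) • jet 4 0 ψ) := by
      simp only [hg, hf, hr, bessel, LinearMap.add_apply, LinearMap.sub_apply,
        LinearMap.smul_apply]
      module
    have t1 : ‖((1 - t : ℝ) : ℂ) • (jet 4 0 ψ - (2 : ℂ) • jet 4 2 ψ)‖ ≤ 3 * F := by
      rw [norm_smul, Complex.norm_real, Real.norm_of_nonneg (sub_nonneg.2 ht.2)]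
      have : ‖jet 4 0 ψ - (2 : ℂ) • jet 4 2 ψ‖ ≤ 3 * F := by
        refine (norm_sub_le _ _).trans ?_
        rw [norm_smul, Complex.norm_ofNat]
        linarith
      calc (1 - t) * ‖jet 4 0 ψ - (2 : ℂ) • jet 4 2 ψ‖ ≤ 1 * (3 * F) :=
            mul_le_mul (by linarith [ht.1]) this (norm_nonneg _) zero_le_one
        _ = _ := one_mul _
    have t2 : ‖(t : ℂ) • (r + (K : ℂ) • jet 4 0 ψ)‖ ≤ (2 * C + |K|) * F + C * ‖jet 4 3 ψ‖ := by
      rw [norm_smul, Complex.norm_real, Real.norm_of_nonneg ht.1]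
      have : ‖r + (K : ℂ) • jet 4 0 ψ‖ ≤ (2 * C + |K|) * F + C * ‖jet 4 3 ψ‖ := by
        refine (norm_add_le _ _).trans ?_
        rw [norm_smul, Complex.norm_real, Real.norm_eq_abs]
        have h1 := hC ψ
        have h2 := mul_le_mul_of_nonneg_left b0 (abs_nonneg K)
        have h3 := mul_le_mul_of_nonneg_left b1 hC0
        have h4 := mul_le_mul_of_nonneg_left b2 hC0
        linarith
      calc t * ‖r + (K : ℂ) • jet 4 0 ψ‖ ≤ 1 * ((2 * C + |K|) * F + C * ‖jet 4 3 ψ‖) :=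
            mul_le_mul ht.2 this (norm_nonneg _) zero_le_one
        _ = _ := one_mul _
    rw [e]
    refine (norm_sub_le _ _).trans ?_
    have := norm_sub_le f (((1 - t : ℝ) : ℂ) • (jet 4 0 ψ - (2 : ℂ) • jet 4 2 ψ))
    rw [hfF] at this
    linarith
  have i3' : ‖jet 4 3 ψ‖ ^ 2 ≤ F * ‖jet 4 4 ψ‖ := i3.trans (mul_le_mul_of_nonneg_right b2 n4)
  -- Young's inequality, weighted so that half of the lower bound $m\|\psi''''\|$ is left after
  -- absorption.
  have a3 : C * ‖jet 4 3 ψ‖ ≤ m / 2 * ‖jet 4 4 ψ‖ + C ^ 2 / (2 * m) * F := by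
    refine abs_le_of_sq_le_sq' ?_ (by positivity) |>.2
    have h1 : (C * ‖jet 4 3 ψ‖) ^ 2 ≤ C ^ 2 * (F * ‖jet 4 4 ψ‖) := by
      rw [mul_pow]
      exact mul_le_mul_of_nonneg_left i3' (sq_nonneg _)
    have h2 : C ^ 2 * (F * ‖jet 4 4 ψ‖)
        = 4 * ((m / 2 * ‖jet 4 4 ψ‖) * (C ^ 2 / (2 * m) * F)) := by
      field_simp
      ring
    rw [h2] at h1
    linarith [four_mul_le_sq_add (m / 2 * ‖jet 4 4 ψ‖) (C ^ 2 / (2 * m) * F)]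
  have b4 : ‖jet 4 4 ψ‖ ≤ G * F := by
    have h : m / 2 * ‖jet 4 4 ψ‖ ≤ m / 2 * (G * F) := by
      have : m / 2 * (G * F) = (m + C' + C ^ 2 / (2 * m)) * F := by
        rw [hG]
        field_simp
      rw [this]
      linarith
    exact le_of_mul_le_mul_left h (by positivity)
  have b3 : ‖jet 4 3 ψ‖ ≤ (G + 1) * F := by
    refine abs_le_of_sq_le_sq' ?_ (by positivity) |>.2
    have h1 := mul_le_mul_of_nonneg_left b4 hF0
    have h2 : ((G + 1) * F) ^ 2 - F * (G * F) = (G ^ 2 + G + 1) * F ^ 2 := by ring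
    have h3 : 0 ≤ (G ^ 2 + G + 1) * F ^ 2 := by positivity
    linarith
  have hGF : 0 ≤ G * F := by positivity
  have e : (G + 1) / m * ‖f‖ = (G + 1) * F := by
    rw [hF]
    ring
  rw [e]
  intro j
  fin_cases j
  · exact b0.trans (by linarith)
  · exact b1.trans (by linarith)
  · exact b2.trans (by linarith)
  · exact b3
  · exact b4.trans (by linarith)

theorem isSymm_opLodd (hκ : 0 < κ) (hc : 2 * κ < c) (hQ : IsSolitaryWave κ c Q)
    (hev : Function.Even Q) : IsSymm (inclL2odd 4) (opLodd hκ hc hQ hev) := fun u v =>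
  isSymm_opL hκ hc hQ (oddIncl 4 u) (oddIncl 4 v)

theorem qform_opLodd (hκ : 0 < κ) (hc : 2 * κ < c) (hQ : IsSolitaryWave κ c Q)
    (hev : Function.Even Q) (u : SobolevOdd 4) : qform (inclL2odd 4) (opLodd hκ hc hQ hev) u
      = qform (jet 4 0) (opL hκ hc hQ) (oddIncl 4 u) := rfl

/-- Continuation from $(1-\partial_x^2)^2$ to $L+K$. Their difference has order four, so it is small
on short steps only relative to the graph norm, which is what the elliptic bound supplies. -/
theorem coerciveOnto_opLodd (hκ : 0 < κ) (hc : 2 * κ < c) (hQ : IsSolitaryWave κ c Q)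
    (hev : Function.Even Q) : CoerciveOnto (inclL2odd 4) (opLodd hκ hc hQ hev) := by
  obtain ⟨K, hK0, hK⟩ := qform_coercive hκ hc hQ
  obtain ⟨M, hM0, hM⟩ := elliptic_bound hκ hc hQ hK
  obtain ⟨C, hC0, hC⟩ := norm_opL_sub_le hκ hc hQ
  refine ⟨K, 1, one_pos, fun d => ?_, ?_⟩
  · have := hK (oddIncl 4 d)
    rw [qform_opLodd, one_mul]
    have h2 : 0 ≤ κ * ‖jet 4 2 (oddIncl 4 d)‖ ^ 2 := by positivity
    have e : ‖inclL2odd 4 d‖ = ‖jet 4 0 (oddIncl 4 d)‖ := rfl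
    rw [e]
    linarith
  · set p := ‖coefP hκ hc hQ‖
    have h := surjective_of_homotopy (B := besselOdd)
      (C := opLodd hκ hc hQ hev + (K : ℂ) • inclL2odd 4 - besselOdd)
      (M := (p + 3 * C + K + 4) * M) (fun t ht d => ?_) besselOdd_surjective
    · rwa [add_sub_cancel] at h
    · set ψ := oddIncl 4 d
      set f := ((1 - t : ℝ) : ℂ) • bessel ψ + (t : ℂ) • (opL hκ hc hQ ψ + (K : ℂ) • jet 4 0 ψ)
        with hf
      have e1 : ‖besselOdd d + (t : ℂ) • (opLodd hκ hc hQ hev + (K : ℂ) • inclL2odd 4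
          - besselOdd) d‖ = ‖f‖ := by
        change ‖bessel ψ + (t : ℂ) • (opL hκ hc hQ ψ + (K : ℂ) • jet 4 0 ψ - bessel ψ)‖ = _
        congr 1
        rw [hf]
        push_cast
        module
      have e2 : ‖(opLodd hκ hc hQ hev + (K : ℂ) • inclL2odd 4 - besselOdd) d‖
          = ‖opL hκ hc hQ ψ + (K : ℂ) • jet 4 0 ψ - bessel ψ‖ := rfl
      rw [e1, e2]
      have b := hM t ht ψ
      have b0 := b 0
      have b1 := b 1
      have b2 := b 2
      have b3 := b 3
      have b4 := b 4
      have hMf : 0 ≤ M * ‖f‖ := by positivity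
      have t1 : ‖opL hκ hc hQ ψ‖ ≤ (p + 3 * C) * (M * ‖f‖) := by
        have h1 := norm_add_le (opL hκ hc hQ ψ - mulOp (coefP hκ hc hQ) (jet 4 4 ψ))
          (mulOp (coefP hκ hc hQ) (jet 4 4 ψ))
        rw [sub_add_cancel] at h1
        have h2 := hC ψ
        have h3 := norm_mulOp_le (coefP hκ hc hQ) (jet 4 4 ψ)
        have h4 := mul_le_mul_of_nonneg_left b4 (norm_nonneg (coefP hκ hc hQ))
        have h5 := mul_le_mul_of_nonneg_left (add_le_add (add_le_add b1 b2) b3) hC0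
        linarith
      have t2 : ‖bessel ψ‖ ≤ 4 * (M * ‖f‖) := by
        have h1 := norm_add_le (jet 4 0 ψ - (2 : ℂ) • jet 4 2 ψ) (jet 4 4 ψ)
        have h2 := norm_sub_le (jet 4 0 ψ) ((2 : ℂ) • jet 4 2 ψ)
        rw [norm_smul, Complex.norm_ofNat] at h2
        change ‖jet 4 0 ψ - (2 : ℂ) • jet 4 2 ψ + jet 4 4 ψ‖ ≤ _
        linarith
      have t3 : ‖(K : ℂ) • jet 4 0 ψ‖ ≤ K * (M * ‖f‖) := by
        rw [norm_smul, Complex.norm_real, Real.norm_of_nonneg hK0]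
        exact mul_le_mul_of_nonneg_left b0 hK0
      have := norm_sub_le (opL hκ hc hQ ψ + (K : ℂ) • jet 4 0 ψ) (bessel ψ)
      have := norm_add_le (opL hκ hc hQ ψ) ((K : ℂ) • jet 4 0 ψ)
      linarith

end Onto

/-! ### Classical representatives -/

/-- `F 0, …, F 3` are the continuous representatives of `ψ, ψ', ψ'', ψ'''`. -/
structure IsRep (ψ : Sobolev 4) (F : Fin 4 → ℝ → ℂ) : Prop where
  ae_eq : ∀ j : Fin 4, jet 4 j.castSucc ψ =ᵐ[volume] F j
  prim : ∀ j : Fin 4, IsPrimitive (F j) (jet 4 j.succ ψ)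

theorem exists_isRep (ψ : Sobolev 4) : ∃ F, IsRep ψ F := by
  have h := fun j : Fin 4 => (jet_weakDeriv 4 ψ j).exists_isPrimitive
  choose F h1 h2 using h
  exact ⟨F, h2, h1⟩

theorem IsRep.continuous {ψ : Sobolev 4} {F : Fin 4 → ℝ → ℂ} (h : IsRep ψ F) (j : Fin 4) :
    Continuous (F j) := (h.prim j).continuous

theorem IsRep.hasDerivAt {ψ : Sobolev 4} {F : Fin 4 → ℝ → ℂ} (h : IsRep ψ F) (j : Fin 3)
    (x : ℝ) : HasDerivAt (F j.castSucc) (F j.succ x) x :=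
  ((h.prim j.castSucc).congr (h.ae_eq j.succ).symm).hasDerivAt (h.continuous _) x

theorem IsRep.memLp {ψ : Sobolev 4} {F : Fin 4 → ℝ → ℂ} (h : IsRep ψ F) (j : Fin 4) :
    MemLp (F j) 2 := (Lp.memLp _).ae_eq (h.ae_eq j)

theorem IsRep.tendsto {ψ : Sobolev 4} {F : Fin 4 → ℝ → ℂ} (h : IsRep ψ F) (j : Fin 4) :
    Tendsto (F j) atTop (𝓝 0) ∧ Tendsto (F j) atBot (𝓝 0) :=
  (h.prim j).tendsto_zero (h.memLp j) (Lp.memLp _)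

/-! ### Jacobi's argument: one negative direction -/

section Form

variable {κ c : ℝ} {Q : ℝ → ℝ}

theorem integrable_form (hκ : 0 < κ) (hc : 2 * κ < c) (hQ : IsSolitaryWave κ c Q)
    {φ φ' : ℝ → ℂ} (hm : MemLp φ 2) (hm' : MemLp φ' 2) :
    Integrable fun x => coefP hκ hc hQ x * ‖φ' x‖ ^ 2 + coefV hκ hc hQ x * ‖φ x‖ ^ 2 := by
  have h := (memLp_two_iff_integrable_sq_norm hm.1).1 hm
  have h' := (memLp_two_iff_integrable_sq_norm hm'.1).1 hm'
  exact (h'.bdd_mul (coefP hκ hc hQ).continuous.aestronglyMeasurable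
    (Eventually.of_forall (coefP hκ hc hQ).norm_coe_le_norm)).add
    (h.bdd_mul (coefV hκ hc hQ).continuous.aestronglyMeasurable
    (Eventually.of_forall (coefV hκ hc hQ).norm_coe_le_norm))

/-- $Q'$ solves $MQ'=0$ and has no zero on the open half-line, so completing the square with
$Q''/Q'$ writes the form as an integral of a square plus an exact derivative with vanishing boundary
values. -/
theorem form_Ioi_nonneg (hκ : 0 < κ) (hc : 2 * κ < c) (hQ : IsSolitaryWave κ c Q)
    (hev : Function.Even Q) {φ φ' : ℝ → ℂ} (hd : ∀ x, HasDerivAt φ (φ' x) x)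
    (hc' : Continuous φ') (hm : MemLp φ 2) (hm' : MemLp φ' 2) (h0 : φ 0 = 0) :
    0 ≤ ∫ x in Set.Ioi (0 : ℝ),
      (coefP hκ hc hQ x * ‖φ' x‖ ^ 2 + coefV hκ hc hQ x * ‖φ x‖ ^ 2) := by
  set p := coefP hκ hc hQ with hp
  set V := coefV hκ hc hQ with hV
  set D := fun n => iteratedDeriv n Q with hD
  have hDd : ∀ n x, HasDerivAt (D n) (D (n + 1) x) x := hQ.hasDerivAt_iter hκ hc
  have hD1 : ∀ x, 0 < x → D 1 x ≠ 0 := fun x hx => by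
    simp only [hD, iteratedDeriv_one]
    exact (hQ.deriv_neg hκ hc hev hx).ne
  have hφc : Continuous φ := continuous_iff_continuousAt.2 fun x => (hd x).continuousAt
  have hlim : Tendsto φ atTop (𝓝 0) :=
    ((IsPrimitive.of_hasDerivAt hd hc').tendsto_zero hm hm').1
  set w : ℝ → ℝ := fun x => p x * ‖φ' x‖ ^ 2 + V x * ‖φ x‖ ^ 2 with hw
  have hwc : Continuous w := (p.continuous.mul (hc'.norm.pow 2)).add
    (V.continuous.mul (hφc.norm.pow 2))
  -- The boundary term: the integrand equals $p|\varphi'-(Q''/Q')\varphi|^2+B'$, so $G$ below is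
  -- nondecreasing.
  set B : ℝ → ℝ := fun x => p x * (D 2 x / D 1 x) * ‖φ x‖ ^ 2 with hB
  set G : ℝ → ℝ := fun x => (∫ t in (0 : ℝ)..x, w t) - B x with hG
  have hpd : ∀ x, HasDerivAt p (-D 1 x) x := fun x => by
    have h : HasDerivAt (fun x => c - Q x) (-D 1 x) x := by
      have := hDd 0 x
      simp only [hD, iteratedDeriv_zero] at this
      exact this.const_sub c
    exact h.congr_of_eventuallyEq (Eventually.of_forall fun y => coefP_apply hκ hc hQ y)
  have hGd : ∀ x, 0 < x → HasDerivAt G (p x * ‖φ' x - ((D 2 x / D 1 x : ℝ) : ℂ) * φ x‖ ^ 2) x := by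
    intro x hx
    have h1 := (hpd x).mul ((hDd 2 x).div (hDd 1 x) (hD1 x hx))
    have h2 := h1.mul (hd x).norm_sq
    have h3 := (hwc.integral_hasStrictDerivAt 0 x).hasDerivAt.sub h2
    refine h3.congr_deriv ?_
    have hx1 := hD1 x hx
    have e3 : p x * D 3 x = (V x + D 2 x) * D 1 x := by
      rw [hp, coefP_apply, hV, coefV_apply]
      linear_combination hQ.eq3 hκ hc x
    have e4 : ‖φ' x - ((D 2 x / D 1 x : ℝ) : ℂ) * φ x‖ ^ 2 = ‖φ' x‖ ^ 2
        - 2 * (D 2 x / D 1 x) * inner ℝ (φ x) (φ' x) + (D 2 x / D 1 x) ^ 2 * ‖φ x‖ ^ 2 := by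
      rw [← Complex.real_smul, norm_sub_sq_real, inner_smul_right, norm_smul,
        real_inner_comm, mul_pow, Real.norm_eq_abs, sq_abs]
      ring
    rw [e4]
    simp only [hw, Pi.mul_apply, Pi.div_apply]
    have e5 : p x * ((D (2 + 1) x * D 1 x - D 2 x * D (1 + 1) x) / D 1 x ^ 2)
        = V x + D 2 x - p x * (D 2 x / D 1 x) ^ 2 := by
      field_simp
      linear_combination D 1 x * e3
    have e6 : -D 1 x * (D 2 x / D 1 x) = -D 2 x := by
      field_simp
    linear_combination (-‖φ x‖ ^ 2) * e5 - ‖φ x‖ ^ 2 * e6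
  have hmono : MonotoneOn G (Set.Ioi 0) := by
    refine monotoneOn_of_deriv_nonneg (convex_Ioi 0)
      (fun x hx => (hGd x hx).continuousAt.continuousWithinAt)
      (fun x hx => (hGd x (by simpa using hx)).differentiableAt.differentiableWithinAt)
      (fun x hx => ?_)
    rw [(hGd x (by simpa using hx)).deriv]
    have : 0 < p x := by
      rw [hp, coefP_apply]
      exact hQ.pos_sub hκ hc x
    positivity
  -- $Q'$ has a simple zero at the origin because $Q''(0)<0$, whereas $|\varphi|^2$ vanishes to
  -- second order.
  have hB0 : Tendsto B (𝓝[>] 0) (𝓝 0) := by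
    have s1 : Tendsto (fun t => t⁻¹ * D 1 t) (𝓝[>] 0) (𝓝 (D 2 0)) := by
      have := (hasDerivAt_iff_tendsto_slope_zero.1 (hDd 1 0)).mono_left
        (nhdsWithin_mono 0 (s := Set.Ioi 0) fun x hx => ne_of_gt hx)
      have h10 : D 1 0 = 0 := by
        simp only [hD, iteratedDeriv_one]
        exact deriv_zero_of_even hev
      simpa [h10] using this
    have s2 : Tendsto (fun t : ℝ => t⁻¹ • φ t) (𝓝[>] 0) (𝓝 (φ' 0)) := by
      have := (hasDerivAt_iff_tendsto_slope_zero.1 (hd 0)).mono_left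
        (nhdsWithin_mono 0 (s := Set.Ioi 0) fun x hx => ne_of_gt hx)
      simpa [h0] using this
    have h20 : D 2 0 ≠ 0 := by
      have := hQ.deriv2_neg hκ hc (deriv_zero_of_even hev)
      simp only [hD]
      rw [iteratedDeriv_succ, iteratedDeriv_one]
      exact this.ne
    have s3 : Tendsto (fun t => p t * D 2 t) (𝓝[>] 0) (𝓝 (p 0 * D 2 0)) :=
      ((p.continuous.mul ((hQ.smooth_iter hκ hc 2).continuous)).tendsto 0).mono_left
        nhdsWithin_le_nhds
    have s4 : Tendsto (fun t => ‖φ t‖) (𝓝[>] 0) (𝓝 0) := by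
      have := (hφc.norm.tendsto 0).mono_left (nhdsWithin_le_nhds (s := Set.Ioi 0))
      simpa [h0] using this
    have s := (s3.mul ((s2.norm).mul s4)).div s1 h20
    simp only [mul_zero, zero_div] at s
    refine s.congr' ?_
    filter_upwards [self_mem_nhdsWithin] with t ht
    have ht0 : (0 : ℝ) < t := ht
    have hx1 := hD1 t ht0
    simp only [hB, Pi.div_apply, norm_smul, norm_inv, Real.norm_of_nonneg ht0.le]
    field_simp
  have hG0 : Tendsto G (𝓝[>] 0) (𝓝 0) := by
    have h1 : Tendsto (fun x => ∫ t in (0 : ℝ)..x, w t) (𝓝[>] 0) (𝓝 0) := by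
      have := (hwc.integral_hasStrictDerivAt 0 0).hasDerivAt.continuousAt.tendsto.mono_left
        (nhdsWithin_le_nhds (s := Set.Ioi 0))
      simpa using this
    simpa using h1.sub hB0
  have hGnn : ∀ x, 0 < x → 0 ≤ G x := fun x hx => by
    refine le_of_tendsto hG0 ?_
    filter_upwards [Ioo_mem_nhdsGT hx] with y hy
    exact hmono hy.1 hx hy.2.le
  have hBinf : Tendsto B atTop (𝓝 0) := by
    have h1 := hQ.tendsto_deriv2_div_deriv hκ hc hev
    have h2 : Tendsto p atTop (𝓝 (c - 0)) :=
      (hQ.tendsto_atTop.const_sub c).congr fun x => (coefP_apply hκ hc hQ x).symm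
    have := (h2.mul h1).mul (hlim.norm.pow 2)
    rw [norm_zero, zero_pow two_ne_zero, mul_zero] at this
    exact this
  have hGinf : Tendsto G atTop (𝓝 ((∫ x in Set.Ioi (0 : ℝ), w x) - 0)) :=
    (intervalIntegral_tendsto_integral_Ioi 0 (integrable_form hκ hc hQ hm hm').integrableOn
      tendsto_id).sub hBinf
  rw [sub_zero] at hGinf
  exact ge_of_tendsto hGinf ((eventually_gt_atTop 0).mono hGnn)

theorem qform_nonneg (hκ : 0 < κ) (hc : 2 * κ < c) (hQ : IsSolitaryWave κ c Q)
    (hev : Function.Even Q) {ψ : Sobolev 4} {φ φ' : ℝ → ℂ} (e1 : jet 4 1 ψ =ᵐ[volume] φ)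
    (e2 : jet 4 2 ψ =ᵐ[volume] φ') (hd : ∀ x, HasDerivAt φ (φ' x) x)
    (hc' : Continuous φ') (h0 : φ 0 = 0) : 0 ≤ qform (jet 4 0) (opL hκ hc hQ) ψ := by
  have hm : MemLp φ 2 := (Lp.memLp _).ae_eq e1
  have hm' : MemLp φ' 2 := (Lp.memLp _).ae_eq e2
  have hi := integrable_form hκ hc hQ hm hm'
  have e : qform (jet 4 0) (opL hκ hc hQ) ψ
      = ∫ x, (coefP hκ hc hQ x * ‖φ' x‖ ^ 2 + coefV hκ hc hQ x * ‖φ x‖ ^ 2) := by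
    rw [qform_opL, ← integral_add (integrable_mul_norm_sq _ _) (integrable_mul_norm_sq _ _)]
    refine integral_congr_ae ?_
    filter_upwards [e1, e2] with x h1 h2
    rw [h1, h2]
  have hpar : ∀ x, coefP hκ hc hQ (-x) = coefP hκ hc hQ x := fun x => by
    rw [coefP_apply, coefP_apply, hev]
  have hparV : ∀ x, coefV hκ hc hQ (-x) = coefV hκ hc hQ x := fun x => by
    have := waveDeriv_parity hκ hc hQ hev 2 x
    change iteratedDeriv 2 Q (-x) = (-1) ^ 2 * iteratedDeriv 2 Q x at this
    rw [coefV_apply, coefV_apply, hev, this]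
    ring
  rw [e, ← intervalIntegral.integral_Iic_add_Ioi (b := 0) hi.integrableOn hi.integrableOn]
  refine add_nonneg ?_ (form_Ioi_nonneg hκ hc hQ hev hd hc' hm hm' h0)
  have hneg := Measure.measurePreserving_neg (volume : Measure ℝ)
  have h := form_Ioi_nonneg hκ hc hQ hev (φ := fun x => φ (-x)) (φ' := fun x => -φ' (-x))
    (fun x => by
      have := (hd (-x)).scomp x (hasDerivAt_neg x)
      simpa [Function.comp_def] using this)
    (hc'.comp continuous_neg).neg (hm.comp_measurePreserving hneg)
    (hm'.comp_measurePreserving hneg).neg (by simpa using h0)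
  have h' := integral_comp_neg_Ioi (0 : ℝ) (fun x => coefP hκ hc hQ x * ‖φ' x‖ ^ 2
    + coefV hκ hc hQ x * ‖φ x‖ ^ 2)
  simp only [hpar, hparV, neg_zero] at h'
  rw [← h']
  simpa using h

/-- The form is nonnegative on the kernel of $\psi\mapsto\psi'(0)$, and the span of two vectors
contains a nontrivial combination annihilated by this functional. -/
theorem negIndexLeOne_opL (hκ : 0 < κ) (hc : 2 * κ < c) (hQ : IsSolitaryWave κ c Q)
    (hev : Function.Even Q) : NegIndexLeOne (jet 4 0) (opL hκ hc hQ) := by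
  intro u v
  obtain ⟨F, hF⟩ := exists_isRep u
  obtain ⟨G, hG⟩ := exists_isRep v
  have key : ∀ a b : ℂ, a * F 1 0 + b * G 1 0 = 0 →
      0 ≤ qform (jet 4 0) (opL hκ hc hQ) (a • u + b • v) := by
    intro a b hab
    have ae : ∀ j : Fin 4, jet 4 j.castSucc (a • u + b • v)
        =ᵐ[volume] fun x => a * F j x + b * G j x := by
      intro j
      rw [map_add, map_smul, map_smul]
      filter_upwards [Lp.coeFn_add (a • jet 4 j.castSucc u) (b • jet 4 j.castSucc v),
        Lp.coeFn_smul a (jet 4 j.castSucc u), Lp.coeFn_smul b (jet 4 j.castSucc v),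
        hF.ae_eq j, hG.ae_eq j] with x h1 h2 h3 h4 h5
      rw [h1, Pi.add_apply, h2, h3, Pi.smul_apply, Pi.smul_apply, h4, h5]
      rfl
    refine qform_nonneg hκ hc hQ hev (ae 1) (ae 2) (fun x => ?_) ?_ hab
    · exact ((hF.hasDerivAt 1 x).const_mul a).add ((hG.hasDerivAt 1 x).const_mul b)
    · exact ((hF.continuous 2).const_mul a).add ((hG.continuous 2).const_mul b)
  by_cases h : G 1 0 = 0
  · exact ⟨0, 1, Or.inr one_ne_zero, key 0 1 (by rw [h]; ring)⟩
  · exact ⟨G 1 0, -F 1 0, Or.inl h, key _ _ (by ring)⟩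

theorem negIndexLeOne_opLodd (hκ : 0 < κ) (hc : 2 * κ < c) (hQ : IsSolitaryWave κ c Q)
    (hev : Function.Even Q) : NegIndexLeOne (inclL2odd 4) (opLodd hκ hc hQ hev) := fun u v =>
  negIndexLeOne_opL hκ hc hQ hev (oddIncl 4 u) (oddIncl 4 v)

end Form

/-! ### Decaying solutions of perturbed linear systems -/

/-- A nonnegative function with `|N'| ≤ K N` that vanishes somewhere vanishes identically. -/
theorem eq_zero_of_abs_deriv_le {N N' : ℝ → ℝ} {K : ℝ} (hd : ∀ x, HasDerivAt N (N' x) x)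
    (h0 : ∀ x, 0 ≤ N x) (hb : ∀ x, |N' x| ≤ K * N x) {x₀ : ℝ} (hx : N x₀ = 0) (x : ℝ) :
    N x = 0 := by
  have hE : ∀ s t : ℝ, HasDerivAt (fun t => N t * Real.exp (s * t))
      ((N' t + s * N t) * Real.exp (s * t)) t := fun s t => by
    have h1 : HasDerivAt (fun t => Real.exp (s * t)) (Real.exp (s * t) * s) t := by
      simpa using ((hasDerivAt_id t).const_mul s).exp
    exact ((hd t).mul h1).congr_deriv (by ring)
  have hmono : Monotone fun t => N t * Real.exp (K * t) :=
    monotone_of_hasDerivAt_nonneg (hE K) fun t =>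
      mul_nonneg (by linarith [neg_le_of_abs_le (hb t)]) (Real.exp_pos _).le
  have hanti : Antitone fun t => N t * Real.exp (-K * t) :=
    antitone_of_hasDerivAt_nonpos (hE (-K)) fun t =>
      mul_nonpos_of_nonpos_of_nonneg (by linarith [le_of_abs_le (hb t)]) (Real.exp_pos _).le
  refine le_antisymm ?_ (h0 x)
  by_contra! hp
  rcases le_total x x₀ with h | h
  · have := hmono h
    simp only [hx] at this
    nlinarith [mul_pos hp (Real.exp_pos (K * x))]
  · have := hanti h
    simp only [hx] at this
    nlinarith [mul_pos hp (Real.exp_pos (-K * x))]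

/-- In a decaying solution of a small perturbation of `s' = -ηs`, `u' = ηu`, `χ'' = -kχ`, the
stable component `s` dominates. -/
theorem stable_dominates {η k X₀ : ℝ} (hη : 0 < η) (hk : 0 < k) {s u χ χ₁ g b w : ℝ → ℝ}
    (hs : ∀ x, HasDerivAt s (-η * s x + g x) x) (hu : ∀ x, HasDerivAt u (η * u x + g x) x)
    (hχ : ∀ x, HasDerivAt χ (χ₁ x) x) (hχ₁ : ∀ x, HasDerivAt χ₁ (-k * χ x + g x) x)
    (hw : ∀ x, HasDerivAt w (b x) x) (hg : ∀ x, X₀ ≤ x →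
      |g x| ≤ b x * (|s x| + |u x| + |χ x| + |χ₁ x|))
    (ts : Tendsto s atTop (𝓝 0)) (tu : Tendsto u atTop (𝓝 0)) (tχ : Tendsto χ atTop (𝓝 0))
    (tχ₁ : Tendsto χ₁ atTop (𝓝 0)) (tb : Tendsto b atTop (𝓝 0)) (tw : Tendsto w atTop (𝓝 0))
    (hb0 : ∀ x, X₀ ≤ x → 0 ≤ b x) {ε : ℝ} (hε : 0 < ε) (hε1 : ε ≤ 1) :
    ∃ X, ∀ x, X ≤ x → u x ^ 2 + χ₁ x ^ 2 + k * χ x ^ 2 ≤ ε * s x ^ 2 := by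
  -- The factor comes from $A^2\le4(s^2+u^2+\chi^2+\chi_1^2)\le4(1+1/k)(s^2+Z)$, doubled by the
  -- cross term $2g(\cdot)$ in the derivative of `D`.
  set Λ := 8 * (1 + 1 / k) with hΛ
  have hΛ0 : 0 < Λ := by positivity
  obtain ⟨X₁, hX₁⟩ := eventually_atTop.1
    (tb.eventually (gt_mem_nhds (show (0 : ℝ) < ε * η / Λ by positivity)))
  set X := max X₀ X₁ with hX
  refine ⟨X, ?_⟩
  -- The limiting system makes `D` nondecreasing, but without a gain in the oscillating modes. The
  -- factor $e^{\Lambda w}$, $w'=b$, pays for the perturbation in those modes; the product is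
  -- nondecreasing near infinity and tends to zero, so it is nonpositive.
  set D : ℝ → ℝ := fun x => u x ^ 2 + χ₁ x ^ 2 + k * χ x ^ 2 - ε * s x ^ 2 with hD
  have hDd : ∀ x, HasDerivAt D (2 * η * u x ^ 2 + 2 * ε * η * s x ^ 2
      + 2 * (g x * (u x + χ₁ x - ε * s x))) x := fun x => by
    refine (((((hu x).pow 2).add ((hχ₁ x).pow 2)).add (((hχ x).pow 2).const_mul k)).sub
      (((hs x).pow 2).const_mul ε)).congr_deriv ?_
    push_cast
    ring
  have hDe : ∀ x, HasDerivAt (fun x => D x * Real.exp (Λ * w x)) ((2 * η * u x ^ 2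
      + 2 * ε * η * s x ^ 2 + 2 * (g x * (u x + χ₁ x - ε * s x)) + Λ * b x * D x)
      * Real.exp (Λ * w x)) x := fun x =>
    ((hDd x).mul ((hw x).const_mul Λ).exp).congr_deriv (by ring)
  have hmono : MonotoneOn (fun x => D x * Real.exp (Λ * w x)) (Set.Ici X) := by
    refine monotoneOn_of_deriv_nonneg (convex_Ici X)
      (fun x _ => (hDe x).continuousAt.continuousWithinAt)
      (fun x _ => (hDe x).differentiableAt.differentiableWithinAt) (fun x hx => ?_)
    rw [interior_Ici] at hx
    rw [(hDe x).deriv]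
    refine mul_nonneg ?_ (Real.exp_pos _).le
    have hx0 : X₀ ≤ x := (le_max_left _ _).trans (le_of_lt hx)
    have hx1 : X₁ ≤ x := (le_max_right _ _).trans (le_of_lt hx)
    have hb := (hX₁ x hx1).le
    have hb' := hb0 x hx0
    rw [le_div_iff₀ hΛ0] at hb
    set A := |s x| + |u x| + |χ x| + |χ₁ x| with hA
    have hA0 : 0 ≤ A := by positivity
    have h1 : |u x + χ₁ x - ε * s x| ≤ A := by
      have e1 := abs_sub (u x + χ₁ x) (ε * s x)
      have e2 := abs_add_le (u x) (χ₁ x)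
      have e3 : |ε * s x| ≤ |s x| := by
        rw [abs_mul, abs_of_pos hε]
        exact mul_le_of_le_one_left (abs_nonneg _) hε1
      have := abs_nonneg (χ x)
      linarith
    have h2 : |g x * (u x + χ₁ x - ε * s x)| ≤ b x * A ^ 2 := by
      rw [abs_mul, sq, ← mul_assoc]
      exact mul_le_mul (hg x hx0) h1 (abs_nonneg _) (mul_nonneg hb' hA0)
    have h3 : A ^ 2 ≤ 4 * (s x ^ 2 + u x ^ 2 + χ x ^ 2 + χ₁ x ^ 2) := by
      rw [← sq_abs (s x), ← sq_abs (u x), ← sq_abs (χ x), ← sq_abs (χ₁ x), hA]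
      nlinarith [sq_nonneg (|s x| - |u x|), sq_nonneg (|s x| - |χ x|), sq_nonneg (|s x| - |χ₁ x|),
        sq_nonneg (|u x| - |χ x|), sq_nonneg (|u x| - |χ₁ x|), sq_nonneg (|χ x| - |χ₁ x|)]
    set Z := u x ^ 2 + χ₁ x ^ 2 + k * χ x ^ 2 with hZ
    have hZ0 : 0 ≤ Z := by positivity
    have h4 : s x ^ 2 + u x ^ 2 + χ x ^ 2 + χ₁ x ^ 2 ≤ (1 + 1 / k) * (s x ^ 2 + Z) := by
      have e1 : χ x ^ 2 = 1 / k * (k * χ x ^ 2) := by field_simp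
      have e2 : 0 ≤ 1 / k * (s x ^ 2 + u x ^ 2 + χ₁ x ^ 2) := by positivity
      have e3 : 0 ≤ k * χ x ^ 2 := by positivity
      rw [hZ]
      linarith
    have h5 : 2 * (b x * A ^ 2) ≤ Λ * b x * (s x ^ 2 + Z) := by
      have := mul_le_mul_of_nonneg_left (h3.trans (mul_le_mul_of_nonneg_left h4
        (by norm_num : (0 : ℝ) ≤ 4))) hb'
      rw [hΛ]
      linarith
    have h6 := neg_le_of_abs_le h2
    have hDx : D x = Z - ε * s x ^ 2 := rfl
    rw [hDx]
    have h7 : b x * Λ * s x ^ 2 ≤ ε * η * s x ^ 2 := mul_le_mul_of_nonneg_right hb (sq_nonneg _)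
    have h8 : ε * (b x * Λ * s x ^ 2) ≤ b x * Λ * s x ^ 2 :=
      mul_le_of_le_one_left (by positivity) hε1
    have h9 : 0 ≤ 2 * η * u x ^ 2 := by positivity
    linarith
  have hlim : Tendsto (fun x => D x * Real.exp (Λ * w x)) atTop (𝓝 0) := by
    have h1 : Tendsto D atTop (𝓝 (0 ^ 2 + 0 ^ 2 + k * 0 ^ 2 - ε * 0 ^ 2)) :=
      (((tu.pow 2).add (tχ₁.pow 2)).add ((tχ.pow 2).const_mul k)).sub ((ts.pow 2).const_mul ε)
    have h2 : Tendsto (fun x => Real.exp (Λ * w x)) atTop (𝓝 (Real.exp (Λ * 0))) :=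
      (Real.continuous_exp.tendsto _).comp (tw.const_mul Λ)
    simpa using h1.mul h2
  intro x hx
  have h : D x * Real.exp (Λ * w x) ≤ 0 :=
    ge_of_tendsto hlim ((eventually_ge_atTop x).mono fun y hy => hmono hx (hx.trans hy) hy)
  have h2 : D x ≤ 0 := by
    by_contra! hp
    nlinarith [mul_pos hp (Real.exp_pos (Λ * w x))]
  simp only [hD] at h2
  linarith

/-! ### The limiting equation at infinity -/

section Eigen

variable {κ c E : ℝ} {Q : ℝ → ℝ}

/-- `f` is a real solution of `L f = E f` that decays at infinity, with its derivatives. -/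
structure IsDecaying (κ c E : ℝ) (Q : ℝ → ℝ) (f : Fin 4 → ℝ → ℝ) : Prop where
  deriv : ∀ (j : Fin 3) (x : ℝ), HasDerivAt (f j.castSucc) (f j.succ x) x
  deriv3 : ∀ x, HasDerivAt (f 3) ((c - Q x)⁻¹ * (2 * iteratedDeriv 1 Q x * f 3 x
    + (2 * iteratedDeriv 2 Q x - 3 * Q x + (c - 2 * κ)) * f 2 x
    + (iteratedDeriv 3 Q x - 3 * iteratedDeriv 1 Q x) * f 1 x + E * f 0 x)) x
  tendsto : ∀ j, Tendsto (f j) atTop (𝓝 0)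

theorem IsDecaying.neg {f : Fin 4 → ℝ → ℝ} (h : IsDecaying κ c E Q f) :
    IsDecaying κ c E Q fun j x => -f j x :=
  ⟨fun j x => (h.deriv j x).neg, fun x => (h.deriv3 x).neg.congr_deriv (by ring),
    fun j => by simpa using (h.tendsto j).neg⟩

/-- The coefficients of a solution of `L f = E f` converge. -/
theorem IsDecaying.exists_remainder (hκ : 0 < κ) (hc : 2 * κ < c) (hQ : IsSolitaryWave κ c Q)
    (hev : Function.Even Q) {f : Fin 4 → ℝ → ℝ} (h : IsDecaying κ c E Q f) :
    ∃ (g : ℝ → ℝ) (C : ℝ), 0 ≤ C ∧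
      (∀ x, HasDerivAt (f 3) ((c - 2 * κ) / c * f 2 x + E / c * f 0 x + g x) x) ∧
      ∀ x, |g x| ≤ C * Q x * (|f 0 x| + |f 1 x| + |f 2 x| + |f 3 x|) := by
  have d0 : DomBy Q Q := by simpa using hQ.domBy hκ hc hev 0 (by norm_num)
  have d1 := hQ.domBy hκ hc hev 1 (by norm_num)
  have d2 := hQ.domBy hκ hc hev 2 (by norm_num)
  have d3 := hQ.domBy hκ hc hev 3 (by norm_num)
  have bi := hQ.bdd_inv hκ hc
  obtain ⟨C3, h3⟩ := DomBy.mul bi (d1.const_mul 2)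
  -- The second summand is the error of replacing $(c-2\kappa)/(c-Q)$ by its limit, since
  -- $1/(c-Q)-1/c=Q/(c(c-Q))$; the same holds for `C0` with $E$.
  obtain ⟨C2, h2⟩ := (DomBy.mul bi ((d2.const_mul 2).add (d0.const_mul (-3)))).add
    ((DomBy.mul bi d0).const_mul ((c - 2 * κ) / c))
  obtain ⟨C1, h1⟩ := DomBy.mul bi (d3.add (d1.const_mul (-3)))
  obtain ⟨C0, h0⟩ := (DomBy.mul bi d0).const_mul (E / c)
  set B3 := fun x => (c - Q x)⁻¹ * (2 * iteratedDeriv 1 Q x) with hB3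
  set B2 := fun x => (c - Q x)⁻¹ * (2 * iteratedDeriv 2 Q x + -3 * Q x)
    + (c - 2 * κ) / c * ((c - Q x)⁻¹ * Q x) with hB2
  set B1 := fun x => (c - Q x)⁻¹ * (iteratedDeriv 3 Q x + -3 * iteratedDeriv 1 Q x) with hB1
  set B0 := fun x => E / c * ((c - Q x)⁻¹ * Q x) with hB0
  have hc0 : c ≠ 0 := by
    have : 0 < c := by linarith
    exact this.ne'
  have hCn : ∀ {B : ℝ → ℝ} {C : ℝ}, (∀ x, |B x| ≤ C * Q x) → 0 ≤ C := fun hB => by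
    have := (abs_nonneg _).trans (hB 0)
    by_contra! hn
    nlinarith [hQ.pos hκ hc hev 0]
  refine ⟨fun x => B3 x * f 3 x + B2 x * f 2 x + B1 x * f 1 x + B0 x * f 0 x, C0 + C1 + C2 + C3,
    add_nonneg (add_nonneg (add_nonneg (hCn h0) (hCn h1)) (hCn h2)) (hCn h3), fun x => ?_,
    fun x => ?_⟩
  · refine (h.deriv3 x).congr_deriv ?_
    have hp := (hQ.pos_sub hκ hc x).ne'
    simp only [hB3, hB2, hB1, hB0]
    field_simp
    ring
  · have hq := hQ.pos hκ hc hev x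
    have t : ∀ {B C F : ℝ}, |B| ≤ C * Q x → |B * F| ≤ C * Q x * |F| := fun hB => by
      rw [abs_mul]
      exact mul_le_mul_of_nonneg_right hB (abs_nonneg _)
    have a3 := t (F := f 3 x) (h3 x)
    have a2 := t (F := f 2 x) (h2 x)
    have a1 := t (F := f 1 x) (h1 x)
    have a0 := t (F := f 0 x) (h0 x)
    have s1 := abs_add_le (B3 x * f 3 x + B2 x * f 2 x + B1 x * f 1 x) (B0 x * f 0 x)
    have s2 := abs_add_le (B3 x * f 3 x + B2 x * f 2 x) (B1 x * f 1 x)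
    have s3 := abs_add_le (B3 x * f 3 x) (B2 x * f 2 x)
    set F0 := |f 0 x|
    set F1 := |f 1 x|
    set F2 := |f 2 x|
    set F3 := |f 3 x|
    have n0 : 0 ≤ F0 := abs_nonneg _
    have n1 : 0 ≤ F1 := abs_nonneg _
    have n2 : 0 ≤ F2 := abs_nonneg _
    have n3 : 0 ≤ F3 := abs_nonneg _
    have c0 := mul_nonneg (hCn h0) hq.le
    have c1 := mul_nonneg (hCn h1) hq.le
    have c2 := mul_nonneg (hCn h2) hq.le
    have c3 := mul_nonneg (hCn h3) hq.le
    have e : (C0 + C1 + C2 + C3) * Q x * (F0 + F1 + F2 + F3)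
        = C3 * Q x * F3 + C2 * Q x * F2 + C1 * Q x * F1 + C0 * Q x * F0
          + (C0 * Q x * (F1 + F2 + F3) + C1 * Q x * (F0 + F2 + F3)
          + C2 * Q x * (F0 + F1 + F3) + C3 * Q x * (F0 + F1 + F2)) := by ring
    have e' : 0 ≤ C0 * Q x * (F1 + F2 + F3) + C1 * Q x * (F0 + F2 + F3)
          + C2 * Q x * (F0 + F1 + F3) + C3 * Q x * (F0 + F1 + F2) := by positivity
    rw [e]
    linarith

/-- A decaying solution of `L f = E f` whose data vanish at one point vanishes identically. -/
theorem IsDecaying.eq_zero (hκ : 0 < κ) (hc : 2 * κ < c) (hQ : IsSolitaryWave κ c Q)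
    (hev : Function.Even Q) {f : Fin 4 → ℝ → ℝ} (h : IsDecaying κ c E Q f) {x₀ : ℝ}
    (h0 : ∀ j, f j x₀ = 0) (x : ℝ) : f 0 x = 0 := by
  obtain ⟨g, C, hC0, hd3, hg⟩ := h.exists_remainder hκ hc hQ hev
  obtain ⟨q, hq⟩ := hQ.bdd0
  have d0 : ∀ x, HasDerivAt (f 0) (f 1 x) x := h.deriv 0
  have d1 : ∀ x, HasDerivAt (f 1) (f 2 x) x := h.deriv 1
  have d2 : ∀ x, HasDerivAt (f 2) (f 3 x) x := h.deriv 2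
  set a := (c - 2 * κ) / c
  set e := E / c
  have hN : ∀ x, HasDerivAt (fun x => f 0 x ^ 2 + f 1 x ^ 2 + f 2 x ^ 2 + f 3 x ^ 2)
      (2 * (f 0 x * f 1 x + f 1 x * f 2 x + f 2 x * f 3 x
        + f 3 x * (a * f 2 x + e * f 0 x + g x))) x := fun x =>
    (((((d0 x).pow 2).add ((d1 x).pow 2)).add ((d2 x).pow 2)).add ((hd3 x).pow 2)).congr_deriv
      (by push_cast; ring)
  have hz := eq_zero_of_abs_deriv_le (K := 2 * (3 + |a| + |e| + 4 * (C * q))) hN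
    (fun x => by positivity) (fun x => ?_) (x₀ := x₀) (by simp [h0]) x
  · have n1 := sq_nonneg (f 1 x)
    have n2 := sq_nonneg (f 2 x)
    have n3 := sq_nonneg (f 3 x)
    exact pow_eq_zero_iff two_ne_zero |>.1 (le_antisymm (by linarith) (sq_nonneg (f 0 x)))
  · set F0 := f 0 x
    set F1 := f 1 x
    set F2 := f 2 x
    set F3 := f 3 x
    set N := F0 ^ 2 + F1 ^ 2 + F2 ^ 2 + F3 ^ 2 with hNd
    have hCQ : C * Q x ≤ C * q :=
      mul_le_mul_of_nonneg_left ((le_abs_self _).trans (hq x)) hC0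
    have hS : |F3| * (|F0| + |F1| + |F2| + |F3|) ≤ 4 * N := by
      rw [hNd, ← sq_abs F0, ← sq_abs F1, ← sq_abs F2, ← sq_abs F3]
      nlinarith [sq_nonneg (|F3| - |F0|), sq_nonneg (|F3| - |F1|), sq_nonneg (|F3| - |F2|),
        sq_nonneg |F0|, sq_nonneg |F1|, sq_nonneg |F2|, sq_nonneg |F3|]
    have hp : ∀ A B : ℝ, A ^ 2 + B ^ 2 ≤ N → |A * B| ≤ N := fun A B hAB => by
      rw [abs_mul]
      nlinarith [sq_nonneg (|A| - |B|), sq_abs A, sq_abs B, sq_nonneg A, sq_nonneg B]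
    have m0 := sq_nonneg F0
    have m1 := sq_nonneg F1
    have m2 := sq_nonneg F2
    have m3 := sq_nonneg F3
    have p01 := hp F0 F1 (by linarith)
    have p12 := hp F1 F2 (by linarith)
    have p23 := hp F2 F3 (by linarith)
    have p32 : |a * (F3 * F2)| ≤ |a| * N := by
      rw [abs_mul]
      exact mul_le_mul_of_nonneg_left (hp F3 F2 (by linarith)) (abs_nonneg _)
    have p30 : |e * (F3 * F0)| ≤ |e| * N := by
      rw [abs_mul]
      exact mul_le_mul_of_nonneg_left (hp F3 F0 (by linarith)) (abs_nonneg _)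
    have pg : |F3 * g x| ≤ 4 * (C * q) * N := by
      rw [abs_mul]
      have hCq : 0 ≤ C * q := mul_nonneg hC0 ((abs_nonneg _).trans (hq x))
      calc |F3| * |g x| ≤ |F3| * (C * q * (|F0| + |F1| + |F2| + |F3|)) := by
            refine mul_le_mul_of_nonneg_left ((hg x).trans ?_) (abs_nonneg _)
            exact mul_le_mul_of_nonneg_right hCQ (by positivity)
        _ = C * q * (|F3| * (|F0| + |F1| + |F2| + |F3|)) := by ring
        _ ≤ C * q * (4 * N) := mul_le_mul_of_nonneg_left hS hCq
        _ = _ := by ring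
    rw [abs_mul, abs_two]
    have e1 : F0 * F1 + F1 * F2 + F2 * F3 + F3 * (a * F2 + e * F0 + g x)
        = F0 * F1 + F1 * F2 + F2 * F3 + a * (F3 * F2) + e * (F3 * F0) + F3 * g x := by ring
    rw [e1]
    have t1 := abs_add_le (F0 * F1 + F1 * F2 + F2 * F3 + a * (F3 * F2) + e * (F3 * F0)) (F3 * g x)
    have t2 := abs_add_le (F0 * F1 + F1 * F2 + F2 * F3 + a * (F3 * F2)) (e * (F3 * F0))
    have t3 := abs_add_le (F0 * F1 + F1 * F2 + F2 * F3) (a * (F3 * F2))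
    have t4 := abs_add_le (F0 * F1 + F1 * F2) (F2 * F3)
    have t5 := abs_add_le (F0 * F1) (F1 * F2)
    linarith

end Eigen

/-! ### Absence of positive eigenvalues on odd functions -/

section NoPositiveEigenvalue

variable {κ c E : ℝ} {Q : ℝ → ℝ}

/-- A continuous function without zeros on a half-line has a sign there. -/
theorem exists_sign_of_ne_zero {s : ℝ → ℝ} (hs : Continuous s) {X : ℝ}
    (h : ∀ x, X ≤ x → s x ≠ 0) :
    ∃ σ : ℝ, (σ = 1 ∨ σ = -1) ∧ ∀ x, X ≤ x → 0 < σ * s x := by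
  have key : ∀ x y, X ≤ x → X ≤ y → s x < 0 → 0 < s y → False := fun x y hx hy h1 h2 => by
    obtain ⟨z, hz, hz0⟩ := isPreconnected_Ici.intermediate_value₂ (s := Set.Ici X) hx hy
      hs.continuousOn (continuousOn_const (c := (0 : ℝ))) h1.le h2.le
    exact h z hz hz0
  rcases (h X le_rfl).lt_or_gt with h1 | h1
  · refine ⟨-1, Or.inr rfl, fun x hx => ?_⟩
    rcases (h x hx).lt_or_gt with h2 | h2
    · linarith
    · exact (key X x le_rfl hx h1 h2).elim
  · refine ⟨1, Or.inl rfl, fun x hx => ?_⟩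
    rcases (h x hx).lt_or_gt with h2 | h2
    · exact (key x X hx le_rfl h2 h1).elim
    · linarith

/-- The components of a decaying solution of `L f = E f` along the modes of the limiting
system. -/
theorem IsDecaying.modes_small (hκ : 0 < κ) (hc : 2 * κ < c) (hQ : IsSolitaryWave κ c Q)
    (hev : Function.Even Q) {f : Fin 4 → ℝ → ℝ} (hf : IsDecaying κ c E Q f) {η k : ℝ}
    (hη : 0 < η) (hk : 0 < k) (ha : (c - 2 * κ) / c = η ^ 2 - k) (he : E / c = η ^ 2 * k)
    {δ : ℝ} (hδ : 0 < δ) : ∃ X, ∀ x, X ≤ x →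
      |(f 3 x + k * f 1 x) + η * (f 2 x + k * f 0 x)|
        ≤ δ * |(f 3 x + k * f 1 x) - η * (f 2 x + k * f 0 x)| ∧
      |f 2 x - η ^ 2 * f 0 x| ≤ δ * |(f 3 x + k * f 1 x) - η * (f 2 x + k * f 0 x)| ∧
      |f 3 x - η ^ 2 * f 1 x| ≤ δ * |(f 3 x + k * f 1 x) - η * (f 2 x + k * f 0 x)| := by
  obtain ⟨g, C, hC0, hd3, hg⟩ := hf.exists_remainder hκ hc hQ hev
  have d0 : ∀ x, HasDerivAt (f 0) (f 1 x) x := hf.deriv 0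
  have d1 : ∀ x, HasDerivAt (f 1) (f 2 x) x := hf.deriv 1
  have d2 : ∀ x, HasDerivAt (f 2) (f 3 x) x := hf.deriv 2
  have t0 := hf.tendsto 0
  have t1 := hf.tendsto 1
  have t2 := hf.tendsto 2
  have t3 := hf.tendsto 3
  rw [ha, he] at hd3
  -- The limiting equation factors as $(\partial^2-\eta^2)(\partial^2+k)f=0$. With $y=f''+kf$, the
  -- modes are $s=y'-\eta y$ (decaying), $u=y'+\eta y$ (growing) and $\chi=f''-\eta^2f$
  -- (oscillating).
  set s := fun x => (f 3 x + k * f 1 x) - η * (f 2 x + k * f 0 x) with hs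
  set u := fun x => (f 3 x + k * f 1 x) + η * (f 2 x + k * f 0 x) with hu
  set χ := fun x => f 2 x - η ^ 2 * f 0 x with hχ
  set χ₁ := fun x => f 3 x - η ^ 2 * f 1 x with hχ₁
  have hsd : ∀ x, HasDerivAt s (-η * s x + g x) x := fun x =>
    (((hd3 x).add ((d1 x).const_mul k)).sub
      (((d2 x).add ((d0 x).const_mul k)).const_mul η)).congr_deriv (by simp only [hs]; ring)
  have hud : ∀ x, HasDerivAt u (η * u x + g x) x := fun x =>
    (((hd3 x).add ((d1 x).const_mul k)).add
      (((d2 x).add ((d0 x).const_mul k)).const_mul η)).congr_deriv (by simp only [hu]; ring)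
  have hχd : ∀ x, HasDerivAt χ (χ₁ x) x := fun x =>
    (d2 x).sub ((d0 x).const_mul (η ^ 2))
  have hχ₁d : ∀ x, HasDerivAt χ₁ (-k * χ x + g x) x := fun x =>
    ((hd3 x).sub ((d1 x).const_mul (η ^ 2))).congr_deriv (by simp only [hχ]; ring)
  have ts : Tendsto s atTop (𝓝 0) := by
    simpa using (t3.add (t1.const_mul k)).sub ((t2.add (t0.const_mul k)).const_mul η)
  have tu : Tendsto u atTop (𝓝 0) := by
    simpa using (t3.add (t1.const_mul k)).add ((t2.add (t0.const_mul k)).const_mul η)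
  have tχ : Tendsto χ atTop (𝓝 0) := by simpa using t2.sub (t0.const_mul (η ^ 2))
  have tχ₁ : Tendsto χ₁ atTop (𝓝 0) := by simpa using t3.sub (t1.const_mul (η ^ 2))
  have hpos : 0 < (c - 2 * κ) / c := div_pos (by linarith) (by linarith)
  have hν := Real.sqrt_pos.2 hpos
  set ν := √((c - 2 * κ) / c)
  obtain ⟨X₀, hX₀⟩ := eventually_atTop.1 ((hQ.tendsto_deriv_div hκ hc hev).eventually
    (gt_mem_nhds (show -ν < -(ν / 2) by linarith)))
  set m := η ^ 2 + k with hm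
  have hm0 : 0 < m := by positivity
  -- A bound for the inverse change of variables, from the modes back to $f,f',f'',f'''$.
  set K := ((1 + η ^ 2) * (1 / (2 * η) + 1 / 2) + (1 + k)) / m with hK
  have hK0 : 0 ≤ K := by positivity
  have hD : ∀ x, HasDerivAt Q (iteratedDeriv 1 Q x) x := fun x => by
    simpa using hQ.hasDerivAt_iter hκ hc 0 x
  -- Near infinity $Q\le-(2/\nu)Q'$, so the perturbation is bounded by $b=-BQ'$, whose primitive
  -- $w=-BQ$ tends to zero as required.
  set B := C * K * (2 / ν) with hB
  have hB0 : 0 ≤ B := by positivity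
  have hQD : ∀ x, X₀ ≤ x → Q x ≤ 2 / ν * -iteratedDeriv 1 Q x := fun x hx => by
    have h := hX₀ x hx
    rw [div_lt_iff₀ (hQ.pos hκ hc hev x)] at h
    have e : Q x = 2 / ν * (ν / 2 * Q x) := by field_simp
    rw [e]
    exact mul_le_mul_of_nonneg_left (by linarith) (by positivity)
  have hgb : ∀ x, X₀ ≤ x → |g x| ≤ -B * iteratedDeriv 1 Q x * (|s x| + |u x| + |χ x| + |χ₁ x|) := by
    intro x hx
    set A := |s x| + |u x| + |χ x| + |χ₁ x| with hA
    have hsum : |f 0 x| + |f 1 x| + |f 2 x| + |f 3 x| ≤ K * A := by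
      have i0 : m * f 0 x = 1 / (2 * η) * (u x - s x) - χ x := by
        simp only [hm, hu, hs, hχ]; field_simp; ring
      have i1 : m * f 1 x = 1 / 2 * (u x + s x) - χ₁ x := by
        simp only [hm, hu, hs, hχ₁]; ring
      have i2 : m * f 2 x = η ^ 2 * (1 / (2 * η) * (u x - s x)) + k * χ x := by
        simp only [hm, hu, hs, hχ]; field_simp; ring
      have i3 : m * f 3 x = η ^ 2 * (1 / 2 * (u x + s x)) + k * χ₁ x := by
        simp only [hm, hu, hs, hχ₁]; ring
      have y0 : |1 / (2 * η) * (u x - s x)| ≤ 1 / (2 * η) * (|u x| + |s x|) := by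
        rw [abs_mul, abs_of_pos (by positivity : 0 < 1 / (2 * η))]
        exact mul_le_mul_of_nonneg_left (abs_sub _ _) (by positivity)
      have y1 : |1 / 2 * (u x + s x)| ≤ 1 / 2 * (|u x| + |s x|) := by
        rw [abs_mul, abs_of_pos (by norm_num : (0 : ℝ) < 1 / 2)]
        exact mul_le_mul_of_nonneg_left (abs_add_le _ _) (by norm_num)
      have j0 := abs_sub (1 / (2 * η) * (u x - s x)) (χ x)
      have j1 := abs_sub (1 / 2 * (u x + s x)) (χ₁ x)
      have j2 := abs_add_le (η ^ 2 * (1 / (2 * η) * (u x - s x))) (k * χ x)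
      have j3 := abs_add_le (η ^ 2 * (1 / 2 * (u x + s x))) (k * χ₁ x)
      rw [← i0, abs_mul, abs_of_pos hm0] at j0
      rw [← i1, abs_mul, abs_of_pos hm0] at j1
      rw [← i2, abs_mul, abs_of_pos hm0, abs_mul (η ^ 2), abs_of_pos (by positivity : 0 < η ^ 2),
        abs_mul k, abs_of_pos hk] at j2
      rw [← i3, abs_mul, abs_of_pos hm0, abs_mul (η ^ 2), abs_of_pos (by positivity : 0 < η ^ 2),
        abs_mul k, abs_of_pos hk] at j3
      have y2 := mul_le_mul_of_nonneg_left y0 (by positivity : 0 ≤ η ^ 2)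
      have y3 := mul_le_mul_of_nonneg_left y1 (by positivity : 0 ≤ η ^ 2)
      rw [hK, div_mul_eq_mul_div, le_div_iff₀ hm0]
      have r : ((1 + η ^ 2) * (1 / (2 * η) + 1 / 2) + (1 + k)) * A
          = (1 + η ^ 2) * (1 / (2 * η) * (|u x| + |s x|)) + (1 + η ^ 2) * (1 / 2 * (|u x| + |s x|))
            + (1 + k) * (|χ x| + |χ₁ x|)
            + ((1 + η ^ 2) * (1 / (2 * η) + 1 / 2) * (|χ x| + |χ₁ x|)
              + (1 + k) * (|u x| + |s x|)) := by rw [hA]; ring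
      have r' : 0 ≤ (1 + η ^ 2) * (1 / (2 * η) + 1 / 2) * (|χ x| + |χ₁ x|)
              + (1 + k) * (|u x| + |s x|) := by positivity
      rw [r]
      linarith
    calc |g x| ≤ C * Q x * (|f 0 x| + |f 1 x| + |f 2 x| + |f 3 x|) := hg x
      _ ≤ C * Q x * (K * A) :=
        mul_le_mul_of_nonneg_left hsum (mul_nonneg hC0 (hQ.pos hκ hc hev x).le)
      _ = C * K * A * Q x := by ring
      _ ≤ C * K * A * (2 / ν * -iteratedDeriv 1 Q x) :=
        mul_le_mul_of_nonneg_left (hQD x hx) (by positivity)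
      _ = _ := by rw [hB]; ring
  have hb0 : ∀ x, X₀ ≤ x → 0 ≤ -B * iteratedDeriv 1 Q x := by
    intro x hx
    have h1 := hQD x hx
    have h2 : 0 ≤ 2 / ν * -iteratedDeriv 1 Q x := (hQ.pos hκ hc hev x).le.trans h1
    have h3 : 0 ≤ C * K * (2 / ν * -iteratedDeriv 1 Q x) := by positivity
    calc 0 ≤ C * K * (2 / ν * -iteratedDeriv 1 Q x) := h3
      _ = _ := by rw [hB]; ring
  -- The entry $\delta^2$ in the minimum serves $u$ and $\chi_1$; the entry $k\delta^2$ serves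
  -- $\chi$, whose square carries the weight $k$.
  obtain ⟨X, hX⟩ := stable_dominates (X₀ := X₀) hη hk hsd hud hχd hχ₁d
    (b := fun x => -B * iteratedDeriv 1 Q x) (w := fun x => -B * Q x)
    (fun x => (hD x).const_mul (-B)) hgb ts tu tχ tχ₁
    (by
      have := (hQ.domBy hκ hc hev 1 (by norm_num)).tendsto hQ.tendsto_atTop
      simpa using this.const_mul (-B))
    (by simpa using hQ.tendsto_atTop.const_mul (-B)) hb0
    (ε := min 1 (min (δ ^ 2) (k * δ ^ 2))) (by positivity) (min_le_left _ _)
  refine ⟨X, fun x hx => ?_⟩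
  have h := hX x hx
  have e2 : min 1 (min (δ ^ 2) (k * δ ^ 2)) * s x ^ 2 ≤ δ ^ 2 * s x ^ 2 :=
    mul_le_mul_of_nonneg_right ((min_le_right _ _).trans (min_le_left _ _)) (sq_nonneg _)
  have e3 : min 1 (min (δ ^ 2) (k * δ ^ 2)) * s x ^ 2 ≤ k * δ ^ 2 * s x ^ 2 :=
    mul_le_mul_of_nonneg_right ((min_le_right _ _).trans (min_le_right _ _)) (sq_nonneg _)
  have n1 := sq_nonneg (u x)
  have n2 := sq_nonneg (χ₁ x)
  have n3 : 0 ≤ k * χ x ^ 2 := by positivity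
  have fin : ∀ z : ℝ, z ^ 2 ≤ δ ^ 2 * s x ^ 2 → |z| ≤ δ * |s x| := fun z hz => by
    refine abs_le_of_sq_le_sq ?_ (by positivity)
    rw [mul_pow, sq_abs]
    exact hz
  refine ⟨fin _ (by linarith), fin _ ?_, fin _ (by linarith)⟩
  have : k * χ x ^ 2 ≤ k * (δ ^ 2 * s x ^ 2) := by linarith
  exact le_of_mul_le_mul_left this hk

/-- A nontrivial decaying solution of `L f = E f`, `E > 0`, is monotone near infinity, and decays
faster than `Q'`. -/
theorem IsDecaying.exists_sign (hκ : 0 < κ) (hc : 2 * κ < c) (hQ : IsSolitaryWave κ c Q)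
    (hev : Function.Even Q) (hE : 0 < E) {f : Fin 4 → ℝ → ℝ} (hf : IsDecaying κ c E Q f)
    (hne : ∃ x, f 0 x ≠ 0) : ∃ σ : ℝ, (σ = 1 ∨ σ = -1) ∧ ∃ X, 0 < X ∧
      (∀ x, X ≤ x → 0 < σ * f 0 x) ∧ σ * f 1 X < 0 ∧
      0 < σ * (f 2 X - iteratedDeriv 2 Q X / iteratedDeriv 1 Q X * f 1 X) := by
  have hc0 : 0 < c := by linarith
  have hpos : 0 < (c - 2 * κ) / c := div_pos (by linarith) hc0
  have hν := Real.sqrt_pos.2 hpos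
  have hν2 := Real.sq_sqrt hpos.le
  have htend := hQ.tendsto_deriv2_div_deriv hκ hc hev
  set ν := √((c - 2 * κ) / c)
  have he0 : 0 < E / c := div_pos hE hc0
  -- The root of the discriminant: $\eta^2$ and $-k$ are the two roots of $z^2-a_0z-E/c$, and $k>0$
  -- because $E>0$.
  set R := √(((c - 2 * κ) / c) ^ 2 + 4 * (E / c)) with hR
  have hR2 : R ^ 2 = ((c - 2 * κ) / c) ^ 2 + 4 * (E / c) := Real.sq_sqrt (by positivity)
  have hRa : (c - 2 * κ) / c < R := by
    refine lt_of_pow_lt_pow_left₀ 2 (Real.sqrt_nonneg _) ?_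
    rw [hR2]
    linarith
  set a₀ := (c - 2 * κ) / c with ha₀
  obtain ⟨η, hη, hη2⟩ : ∃ η : ℝ, 0 < η ∧ η ^ 2 = (a₀ + R) / 2 :=
    ⟨√((a₀ + R) / 2), Real.sqrt_pos.2 (by linarith), Real.sq_sqrt (by linarith)⟩
  set k := (R - a₀) / 2 with hk'
  have hk : 0 < k := by rw [hk']; linarith
  have ha : a₀ = η ^ 2 - k := by rw [hη2, hk']; ring
  have he : E / c = η ^ 2 * k := by
    rw [hη2, hk']
    linear_combination (1 / 4) * hR2.symm
  -- This is where $E>0$ gives decay faster than $Q'$: $\eta^2=\nu^2+k$.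
  have hνη : ν < η := by
    refine lt_of_pow_lt_pow_left₀ 2 hη.le ?_
    rw [hν2]
    linarith
  set τ := (ν + η) / 2 with hτ
  -- The first entry makes the signs of $f$ and $f'$ those of the decaying mode; the second leaves
  -- room to compare $f''/f'\approx-\eta$ with $Q''/Q'>-\tau$, where $\tau$ is midway between $\nu$
  -- and $\eta$.
  set δ := min (1 / (8 * (1 + η))) ((η - τ) / (8 * (η + k + τ))) with hδ'
  have hτη : 0 < η - τ := by rw [hτ]; linarith
  have hτ0 : 0 < τ := by rw [hτ]; linarith
  have hδ : 0 < δ := by positivity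
  have hδ1 : δ * (8 * (1 + η)) ≤ 1 := by
    rw [← le_div_iff₀ (by positivity)]
    exact min_le_left _ _
  have hδ2 : δ * (8 * (η + k + τ)) ≤ η - τ := by
    rw [← le_div_iff₀ (by positivity)]
    exact min_le_right _ _
  obtain ⟨X₁, hX₁⟩ := hf.modes_small hκ hc hQ hev hη hk ha he hδ
  obtain ⟨X₂, hX₂⟩ := eventually_atTop.1 ((htend.eventually
    (lt_mem_nhds (show -τ < -ν by rw [hτ]; linarith))).and
    (htend.eventually (gt_mem_nhds (show -ν < 0 by linarith))))
  set X := max 1 (max X₁ X₂) with hX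
  have hXa : X₁ ≤ X := (le_max_left _ _).trans (le_max_right _ _)
  have hXb : X₂ ≤ X := (le_max_right _ _).trans (le_max_right _ _)
  set s := fun x => (f 3 x + k * f 1 x) - η * (f 2 x + k * f 0 x) with hs
  have d0 : ∀ x, HasDerivAt (f 0) (f 1 x) x := hf.deriv 0
  have d1 : ∀ x, HasDerivAt (f 1) (f 2 x) x := hf.deriv 1
  have d2 : ∀ x, HasDerivAt (f 2) (f 3 x) x := hf.deriv 2
  have cf : ∀ {F G : ℝ → ℝ}, (∀ x, HasDerivAt F (G x) x) → Continuous F := fun h =>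
    continuous_iff_continuousAt.2 fun x => (h x).continuousAt
  have hsc : Continuous s := ((cf hf.deriv3).add ((cf d1).const_mul k)).sub
    (((cf d2).add ((cf d0).const_mul k)).const_mul η)
  -- If $s$ vanished at a point, so would all the modes it dominates, hence all Cauchy data there,
  -- and $f$ would be trivial.
  have hsne : ∀ x, X ≤ x → s x ≠ 0 := by
    intro x hx h0
    obtain ⟨h1, h2, h3⟩ := hX₁ x (hXa.trans hx)
    change |_| ≤ δ * |s x| at h1 h2 h3
    rw [h0, abs_zero, mul_zero] at h1 h2 h3
    have e1 := abs_eq_zero.1 (le_antisymm h1 (abs_nonneg _))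
    have e2 := abs_eq_zero.1 (le_antisymm h2 (abs_nonneg _))
    have e3 := abs_eq_zero.1 (le_antisymm h3 (abs_nonneg _))
    simp only [hs] at h0
    have hm : 0 < η ^ 2 + k := by positivity
    have y0 : f 2 x + k * f 0 x = 0 := by
      have : 2 * η * (f 2 x + k * f 0 x) = 0 := by linarith
      exact (mul_eq_zero.1 this).resolve_left (by positivity)
    have y1 : f 3 x + k * f 1 x = 0 := by linarith
    have f0 : f 0 x = 0 := by
      have : (η ^ 2 + k) * f 0 x = 0 := by linarith
      exact (mul_eq_zero.1 this).resolve_left hm.ne'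
    have f1 : f 1 x = 0 := by
      have : (η ^ 2 + k) * f 1 x = 0 := by linarith
      exact (mul_eq_zero.1 this).resolve_left hm.ne'
    have f2 : f 2 x = 0 := by rw [f0] at e2; linarith
    have f3 : f 3 x = 0 := by rw [f1] at e3; linarith
    obtain ⟨z, hz⟩ := hne
    refine hz (hf.eq_zero hκ hc hQ hev (x₀ := x) (fun j => ?_) z)
    fin_cases j
    exacts [f0, f1, f2, f3]
  obtain ⟨σ, hσ, hσs⟩ := exists_sign_of_ne_zero hsc hsne
  have hσ1 : |σ| = 1 := by rcases hσ with rfl | rfl <;> simp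
  have hm : 0 < η ^ 2 + k := by positivity
  have key : ∀ x, X ≤ x → 0 < -σ * f 0 x ∧ -σ * f 1 x < 0 ∧
      0 < -σ * (f 2 x - iteratedDeriv 2 Q x / iteratedDeriv 1 Q x * f 1 x) := by
    intro x hx
    obtain ⟨h1, h2, h3⟩ := hX₁ x (hXa.trans hx)
    obtain ⟨q1, q2⟩ := hX₂ x (hXb.trans hx)
    have hs0 := hσs x hx
    have hS : |s x| = σ * s x := by
      rw [← abs_of_pos hs0, abs_mul, hσ1, one_mul]
    change |_| ≤ δ * |s x| at h1 h2 h3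
    set S := σ * s x with hS'
    set t := iteratedDeriv 2 Q x / iteratedDeriv 1 Q x
    have lift : ∀ z, |z| ≤ δ * |s x| → |σ * z| ≤ δ * S := fun z hz => by
      rw [abs_mul, hσ1, one_mul, ← hS]
      exact hz
    obtain ⟨u1, u2⟩ := abs_le.1 (lift _ h1)
    obtain ⟨c1, c2⟩ := abs_le.1 (lift _ h2)
    obtain ⟨b1, b2⟩ := abs_le.1 (lift _ h3)
    set U := σ * ((f 3 x + k * f 1 x) + η * (f 2 x + k * f 0 x)) with hU
    set Z := σ * (f 2 x - η ^ 2 * f 0 x) with hZ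
    set Z' := σ * (f 3 x - η ^ 2 * f 1 x) with hZ'
    have i0 : (η ^ 2 + k) * (2 * η * (-σ * f 0 x)) = S - U + 2 * η * Z := by
      simp only [hS', hU, hZ, hs]; ring
    have i1 : (η ^ 2 + k) * (-σ * f 1 x) = -(1 / 2 * (U + S)) + Z' := by
      simp only [hS', hU, hZ', hs]; ring
    have i2 : (η ^ 2 + k) * (-σ * f 2 x) = η * (1 / 2 * (S - U)) - k * Z := by
      simp only [hS', hU, hZ, hs]; ring
    have hδS : 0 < δ * S := mul_pos hδ hs0
    have w1 : δ * S * 8 + δ * S * 8 * η ≤ S := by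
      have := mul_le_mul_of_nonneg_right hδ1 hs0.le
      linarith
    have w2 : 8 * (η * (δ * S)) + 8 * (k * (δ * S)) + 8 * (τ * (δ * S)) ≤ (η - τ) * S := by
      have := mul_le_mul_of_nonneg_right hδ2 hs0.le
      linarith
    have p1 : η * -(δ * S) ≤ η * Z := mul_le_mul_of_nonneg_left c1 hη.le
    have p2 : η * U ≤ η * (δ * S) := mul_le_mul_of_nonneg_left u2 hη.le
    have p3 : k * Z ≤ k * (δ * S) := mul_le_mul_of_nonneg_left c2 hk.le
    have hηd : 0 < η * (δ * S) := by positivity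
    have hkd : 0 < k * (δ * S) := by positivity
    have hτd : 0 < τ * (δ * S) := by positivity
    refine ⟨?_, ?_, ?_⟩
    · have : 0 < (η ^ 2 + k) * (2 * η * (-σ * f 0 x)) := by rw [i0]; linarith
      exact pos_of_mul_pos_right (pos_of_mul_pos_right this hm.le) (by positivity)
    · have : (η ^ 2 + k) * (-σ * f 1 x) < 0 := by rw [i1]; linarith
      by_contra! hn
      linarith [mul_nonneg hm.le hn]
    · have e : (η ^ 2 + k) * (-σ * (f 2 x - t * f 1 x))
          = (η ^ 2 + k) * (-σ * f 2 x) - t * ((η ^ 2 + k) * (-σ * f 1 x)) := by ring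
      have : 0 < (η ^ 2 + k) * (-σ * (f 2 x - t * f 1 x)) := by
        rw [e, i2, i1]
        have g1 : 1 / 2 * (U + S) - Z' ≤ 1 / 2 * S + 2 * (δ * S) := by linarith
        have g0 : 0 ≤ 1 / 2 * (U + S) - Z' := by linarith
        have g2 : -t * (1 / 2 * (U + S) - Z') ≤ τ * (1 / 2 * S + 2 * (δ * S)) :=
          mul_le_mul (by linarith) g1 g0 hτ0.le
        linarith
      exact pos_of_mul_pos_right this hm.le
  refine ⟨-σ, ?_, X, lt_of_lt_of_le one_pos (le_max_left _ _), fun x hx => (key x hx).1,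
    (key X le_rfl).2.1, (key X le_rfl).2.2⟩
  rcases hσ with rfl | rfl <;> simp

/-- A decaying solution of `L f = E f`, `E > 0`, that vanishes at the origin is trivial. -/
theorem IsDecaying.eq_zero_of_pos (hκ : 0 < κ) (hc : 2 * κ < c) (hQ : IsSolitaryWave κ c Q)
    (hev : Function.Even Q) (hE : 0 < E) {f : Fin 4 → ℝ → ℝ} (hf : IsDecaying κ c E Q f)
    (h0 : f 0 0 = 0) (x : ℝ) : f 0 x = 0 := by
  by_contra hx
  obtain ⟨σ, hσ, X, hX, f0, f1, f2⟩ := hf.exists_sign hκ hc hQ hev hE ⟨x, hx⟩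
  wlog h1 : σ = 1 generalizing f σ
  · have h2 : σ = -1 := hσ.resolve_left h1
    subst h2
    refine this hf.neg (by simpa using h0) (by simpa using hx) 1 (Or.inl rfl) ?_ ?_ ?_ rfl
    · simpa using f0
    · simpa using f1
    · linarith
  subst h1
  simp only [one_mul] at f0 f1 f2
  have d0 : ∀ x, HasDerivAt (f 0) (f 1 x) x := hf.deriv 0
  have d1 : ∀ x, HasDerivAt (f 1) (f 2 x) x := hf.deriv 1
  have d2 : ∀ x, HasDerivAt (f 2) (f 3 x) x := hf.deriv 2
  have d3 := hf.deriv3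
  have c0 : Continuous (f 0) := continuous_iff_continuousAt.2 fun x => (d0 x).continuousAt
  set D := fun n => iteratedDeriv n Q with hD
  have hDd : ∀ n x, HasDerivAt (D n) (D (n + 1) x) x := hQ.hasDerivAt_iter hκ hc
  have hQd : ∀ x, HasDerivAt Q (D 1 x) x := fun x => by simpa [hD] using hDd 0 x
  have hD1 : ∀ x, 0 < x → D 1 x < 0 := fun x hx => by
    simp only [hD, iteratedDeriv_one]
    exact hQ.deriv_neg hκ hc hev hx
  have hp := hQ.pos_sub hκ hc
  -- Here $n=Mf'$, so the equation $-\partial_xMf'=Ef$ reads $n'=-Ef$. Since $n\to0$ at infinity,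
  -- $n$ is nonnegative wherever $f$ stays positive up to infinity.
  set n : ℝ → ℝ := fun x => (D 2 x - 3 * Q x + (c - 2 * κ)) * f 1 x + D 1 x * f 2 x
    - (c - Q x) * f 3 x with hn
  have hnd : ∀ x, HasDerivAt n (-E * f 0 x) x := fun x => by
    refine (((((hDd 2 x).sub ((hQd x).const_mul 3)).add_const (c - 2 * κ)).mul (d1 x)).add
      ((hDd 1 x).mul (d2 x))).sub (((hQd x).const_sub c).mul (d3 x)) |>.congr_deriv ?_
    have := mul_inv_cancel₀ (hp x).ne'
    simp only [Pi.sub_apply]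
    linear_combination (-(2 * iteratedDeriv 1 Q x * f 3 x
      + (2 * iteratedDeriv 2 Q x - 3 * Q x + (c - 2 * κ)) * f 2 x
      + (iteratedDeriv 3 Q x - 3 * iteratedDeriv 1 Q x) * f 1 x + E * f 0 x)) * this
  have hDt : ∀ j, j ≤ 5 → Tendsto (D j) atTop (𝓝 0) := fun j hj =>
    (hQ.domBy hκ hc hev j hj).tendsto hQ.tendsto_atTop
  have hnt : Tendsto n atTop (𝓝 0) := by
    simpa using (((((hDt 2 (by norm_num)).sub (hQ.tendsto_atTop.const_mul 3)).add_const
      (c - 2 * κ)).mul (hf.tendsto 1)).add ((hDt 1 (by norm_num)).mul (hf.tendsto 2))).sub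
      ((hQ.tendsto_atTop.const_sub c).mul (hf.tendsto 3))
  have anti : ∀ {G G' : ℝ → ℝ} {S : Set ℝ}, Convex ℝ S → (∀ x ∈ S, HasDerivAt G (G' x) x) →
      (∀ x ∈ S, G' x ≤ 0) → AntitoneOn G S := fun hS hG hG' =>
    antitoneOn_of_deriv_nonpos hS (fun x hx => (hG x hx).continuousAt.continuousWithinAt)
      (fun x hx => (hG x (interior_subset hx)).differentiableAt.differentiableWithinAt)
      fun x hx => by
        rw [(hG x (interior_subset hx)).deriv]
        exact hG' x (interior_subset hx)
  have hnX : 0 ≤ n X := by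
    have ha : AntitoneOn n (Set.Ici X) := anti (convex_Ici X) (fun x _ => hnd x) fun x hx => by
      have := mul_pos hE (f0 x hx)
      linarith
    exact le_of_tendsto hnt ((eventually_ge_atTop X).mono fun y hy => ha Set.self_mem_Ici hy hy)
  -- the last zero before `X`
  obtain ⟨x₀, hx₀, hmax⟩ := (isCompact_Icc.inter_right (isClosed_singleton.preimage c0 :
    IsClosed (f 0 ⁻¹' {0}))).exists_isGreatest ⟨0, Set.left_mem_Icc.2 hX.le, h0⟩
  have hz : f 0 x₀ = 0 := hx₀.2
  have hx₀X : x₀ < X := lt_of_le_of_ne hx₀.1.2 fun h => by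
    have := f0 X le_rfl
    rw [← h, hz] at this
    exact lt_irrefl _ this
  have hpos : ∀ x ∈ Set.Ioc x₀ X, 0 < f 0 x := by
    intro x hx
    by_contra! hle
    obtain ⟨z, hz1, hz2⟩ := intermediate_value_Icc hx.2 c0.continuousOn ⟨hle, (f0 X le_rfl).le⟩
    have := hmax ⟨⟨hx₀.1.1.trans (hx.1.le.trans hz1.1), hz1.2⟩, hz2⟩
    linarith [hx.1, hz1.1]
  have hgt : ∀ x ∈ Set.Ioc x₀ X, 0 < x := fun x hx => lt_of_le_of_lt hx₀.1.1 hx.1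
  have hXm : X ∈ Set.Ioc x₀ X := ⟨hx₀X, le_rfl⟩
  have hn0 : ∀ x ∈ Set.Ioc x₀ X, 0 ≤ n x := fun x hx =>
    hnX.trans (anti (convex_Ioc x₀ X) (fun x _ => hnd x) (fun x hx => by
      have := mul_pos hE (hpos x hx)
      linarith) hx hXm hx.2)
  -- The weighted Wronskian of $f'$ and $Q'$; since $MQ'=0$ and $Mf'=n$, its derivative is
  -- $Q'n\le0$, so it stays positive to the left of `X`.
  set a : ℝ → ℝ := fun x => (c - Q x) * (f 1 x * D 2 x - f 2 x * D 1 x) with ha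
  have had : ∀ x, HasDerivAt a (D 1 x * n x) x := fun x => by
    refine (((hQd x).const_sub c).mul (((d1 x).mul (hDd 2 x)).sub
      ((d2 x).mul (hDd 1 x)))).congr_deriv ?_
    simp only [hn, Pi.sub_apply, Pi.mul_apply]
    linear_combination f 1 x * hQ.eq3 hκ hc x
  have haX : 0 < a X := by
    refine mul_pos (hp X) ?_
    have h := mul_pos_of_neg_of_neg (hD1 X hX) (neg_neg_of_pos f2)
    have hne := (hD1 X hX).ne
    have e : D 1 X * -(f 2 X - D 2 X / D 1 X * f 1 X) = f 1 X * D 2 X - f 2 X * D 1 X := by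
      field_simp
      ring
    rw [← e]
    exact h
  have ha0 : ∀ x ∈ Set.Ioc x₀ X, 0 < a x := fun x hx =>
    haX.trans_le (anti (convex_Ioc x₀ X) (fun x _ => had x) (fun x hx =>
      mul_nonpos_of_nonpos_of_nonneg (hD1 x (hgt x hx)).le (hn0 x hx)) hx hXm hx.2)
  -- The derivative of $f'/Q'$ is $-a/(pQ'^2)<0$, so the quotient, positive at `X`, is positive on
  -- the whole interval. Hence $f'<0$ after the zero $x_0$, which is incompatible with $f(X)>0$.
  have hr : ∀ x ∈ Set.Ioc x₀ X, 0 < f 1 x / D 1 x := fun x hx =>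
    (div_pos_of_neg_of_neg f1 (hD1 X hX)).trans_le (anti (convex_Ioc x₀ X)
      (fun x hx => (d1 x).div (hDd 1 x) (hD1 x (hgt x hx)).ne) (fun x hx => by
        refine div_nonpos_of_nonpos_of_nonneg ?_ (sq_nonneg _)
        have h1 := pos_of_mul_pos_right (ha0 x hx) (hp x).le
        change f 2 x * D 1 x - f 1 x * D 2 x ≤ 0
        linarith) hx hXm hx.2)
  have hf1 : ∀ x ∈ Set.Ioc x₀ X, f 1 x < 0 := fun x hx => by
    have h := mul_neg_of_pos_of_neg (hr x hx) (hD1 x (hgt x hx))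
    rwa [div_mul_cancel₀ _ (hD1 x (hgt x hx)).ne] at h
  have hanti : AntitoneOn (f 0) (Set.Icc x₀ X) :=
    antitoneOn_of_deriv_nonpos (convex_Icc x₀ X) c0.continuousOn
      (fun x _ => (d0 x).differentiableAt.differentiableWithinAt) fun x hx => by
        rw [interior_Icc] at hx
        rw [(d0 x).deriv]
        exact (hf1 x ⟨hx.1, hx.2.le⟩).le
  have := hanti (Set.left_mem_Icc.2 hx₀X.le) (Set.right_mem_Icc.2 hx₀X.le) hx₀X.le
  linarith [f0 X le_rfl]

end NoPositiveEigenvalue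

/-! ### The kernel on odd functions and the null direction of the form -/

section Kernel

variable {κ c E : ℝ} {Q : ℝ → ℝ}

/-- Eigenfunctions of `L` are classical solutions. -/
theorem IsRep.hasDerivAt_three (hκ : 0 < κ) (hc : 2 * κ < c) (hQ : IsSolitaryWave κ c Q)
    {ψ : Sobolev 4} {F : Fin 4 → ℝ → ℂ} (hF : IsRep ψ F)
    (hψ : opL hκ hc hQ ψ = (E : ℂ) • jet 4 0 ψ) (x : ℝ) :
    HasDerivAt (F 3) (((c - Q x)⁻¹ : ℝ) * ((2 * iteratedDeriv 1 Q x : ℝ) * F 3 x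
      + (2 * iteratedDeriv 2 Q x - 3 * Q x + (c - 2 * κ) : ℝ) * F 2 x
      + (iteratedDeriv 3 Q x - 3 * iteratedDeriv 1 Q x : ℝ) * F 1 x + E * F 0 x)) x := by
  have hD : ∀ n, Continuous (iteratedDeriv n Q) := fun n => (hQ.smooth_iter hκ hc n).continuous
  have hQc := hQ.contDiff.continuous
  have hcF := hF.continuous
  refine ((hF.prim 3).congr ?_).hasDerivAt (g := fun x => ((c - Q x)⁻¹ : ℝ) *
    ((2 * iteratedDeriv 1 Q x : ℝ) * F 3 x
      + (2 * iteratedDeriv 2 Q x - 3 * Q x + (c - 2 * κ) : ℝ) * F 2 x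
      + (iteratedDeriv 3 Q x - 3 * iteratedDeriv 1 Q x : ℝ) * F 1 x + E * F 0 x)) ?_ x
  · set q := waveDeriv hκ hc hQ with hq
    let C := BoundedContinuousFunction.const (β := ℝ) ℝ
    have hψ' : mulOp (C c - q 0) (jet 4 4 ψ) - mulOp (C 2 * q 1) (jet 4 3 ψ)
      - mulOp (C 2 * q 2 - C 3 * q 0 + C (c - 2 * κ)) (jet 4 2 ψ)
      - mulOp (q 3 - C 3 * q 1) (jet 4 1 ψ) = (E : ℂ) • jet 4 0 ψ := hψ
    filter_upwards [Lp.coeFn_smul (E : ℂ) (jet 4 0 ψ), coeFn_mulOp (C c - q 0) (jet 4 4 ψ),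
      coeFn_mulOp (C 2 * q 1) (jet 4 3 ψ),
      coeFn_mulOp (C 2 * q 2 - C 3 * q 0 + C (c - 2 * κ)) (jet 4 2 ψ),
      coeFn_mulOp (q 3 - C 3 * q 1) (jet 4 1 ψ),
      Lp.coeFn_sub (mulOp (C c - q 0) (jet 4 4 ψ)) (mulOp (C 2 * q 1) (jet 4 3 ψ)),
      Lp.coeFn_sub (mulOp (C c - q 0) (jet 4 4 ψ) - mulOp (C 2 * q 1) (jet 4 3 ψ))
        (mulOp (C 2 * q 2 - C 3 * q 0 + C (c - 2 * κ)) (jet 4 2 ψ)),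
      Lp.coeFn_sub (mulOp (C c - q 0) (jet 4 4 ψ) - mulOp (C 2 * q 1) (jet 4 3 ψ)
        - mulOp (C 2 * q 2 - C 3 * q 0 + C (c - 2 * κ)) (jet 4 2 ψ))
        (mulOp (q 3 - C 3 * q 1) (jet 4 1 ψ)),
      hF.ae_eq 0, hF.ae_eq 1, hF.ae_eq 2, hF.ae_eq 3]
      with x e0 e4 e3 e2 e1 s1 s2 s3 f0 f1 f2 f3
    have h := s3
    rw [hψ', e0, Pi.sub_apply, s2, Pi.sub_apply, s1, Pi.sub_apply, e1, e2, e3, e4,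
      Pi.smul_apply, smul_eq_mul] at h
    have w : ∀ j, q j x = iteratedDeriv j Q x := fun _ => rfl
    have w0 : q 0 x = Q x := by rw [w]; simp
    have w1 : q 1 x = iteratedDeriv 1 Q x := w 1
    have w2 : q 2 x = iteratedDeriv 2 Q x := w 2
    have w3 : q 3 x = iteratedDeriv 3 Q x := w 3
    simp only [C, BoundedContinuousFunction.sub_apply, BoundedContinuousFunction.add_apply,
      BoundedContinuousFunction.mul_apply, BoundedContinuousFunction.const_apply, w0, w1, w2,
      w3] at h
    change jet 4 0 ψ x = F 0 x at f0
    change jet 4 1 ψ x = F 1 x at f1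
    change jet 4 2 ψ x = F 2 x at f2
    change jet 4 3 ψ x = F 3 x at f3
    rw [f0, f1, f2, f3] at h
    have hp : ((c - Q x : ℝ) : ℂ) ≠ 0 := Complex.ofReal_ne_zero.2 (hQ.pos_sub hκ hc x).ne'
    change _ = jet 4 4 ψ x
    symm
    rw [Complex.ofReal_inv, eq_inv_mul_iff_mul_eq₀ hp]
    linear_combination -h
  · have hi : Continuous fun x => ((c - Q x)⁻¹ : ℝ) :=
      (continuous_const.sub hQc).inv₀ fun x => (hQ.pos_sub hκ hc x).ne'
    have r : ∀ {a : ℝ → ℝ}, Continuous a → Continuous fun x => (a x : ℂ) := fun h =>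
      Complex.continuous_ofReal.comp h
    exact (r hi).mul (((((r ((hD 1).const_mul 2)).mul (hcF 3)).add
      ((r ((((hD 2).const_mul 2).sub (hQc.const_mul 3)).add continuous_const)).mul (hcF 2))).add
      ((r ((hD 3).sub ((hD 1).const_mul 3))).mul (hcF 1))).add ((hcF 0).const_mul _))

/-- The coefficients and $E$ are real, so real and imaginary parts solve the equation separately,
and the sign arguments for real functions apply to each. -/
theorem IsRep.isDecaying (hκ : 0 < κ) (hc : 2 * κ < c) (hQ : IsSolitaryWave κ c Q)
    {ψ : Sobolev 4} {F : Fin 4 → ℝ → ℂ} (hF : IsRep ψ F)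
    (hψ : opL hκ hc hQ ψ = (E : ℂ) • jet 4 0 ψ) :
    IsDecaying κ c E Q (fun j x => (F j x).re) ∧ IsDecaying κ c E Q (fun j x => (F j x).im) := by
  have hd : ∀ (ℓ : ℂ →L[ℝ] ℝ) {G : ℝ → ℂ} {G' : ℂ} {x : ℝ}, HasDerivAt G G' x →
      HasDerivAt (fun x => ℓ (G x)) (ℓ G') x := fun ℓ _ _ _ h =>
    ℓ.hasFDerivAt.comp_hasDerivAt _ h
  have ht : ∀ (ℓ : ℂ →L[ℝ] ℝ) j, Tendsto (fun x => ℓ (F j x)) atTop (𝓝 0) := fun ℓ j => by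
    have := (ℓ.continuous.tendsto 0).comp (hF.tendsto j).1
    rwa [map_zero] at this
  have h3 := hF.hasDerivAt_three hκ hc hQ hψ
  constructor
  · refine ⟨fun j x => hd Complex.reCLM (hF.hasDerivAt j x), fun x => ?_, ht Complex.reCLM⟩
    have := hd Complex.reCLM (h3 x)
    simpa only [Complex.reCLM_apply, Complex.re_ofReal_mul, Complex.add_re] using this
  · refine ⟨fun j x => hd Complex.imCLM (hF.hasDerivAt j x), fun x => ?_, ht Complex.imCLM⟩
    have := hd Complex.imCLM (h3 x)
    simpa only [Complex.imCLM_apply, Complex.im_ofReal_mul, Complex.add_im] using this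

/-- A decaying solution of `L f = 0` that vanishes at the origin with its second derivative is
trivial. -/
theorem IsDecaying.eq_zero_of_kernel (hκ : 0 < κ) (hc : 2 * κ < c) (hQ : IsSolitaryWave κ c Q)
    (hev : Function.Even Q) {f : Fin 4 → ℝ → ℝ} (hf : IsDecaying κ c 0 Q f)
    (h2 : f 2 0 = 0) (x : ℝ) : f 0 x = 0 := by
  have d0 : ∀ x, HasDerivAt (f 0) (f 1 x) x := hf.deriv 0
  have d1 : ∀ x, HasDerivAt (f 1) (f 2 x) x := hf.deriv 1
  have d2 : ∀ x, HasDerivAt (f 2) (f 3 x) x := hf.deriv 2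
  have d3 := hf.deriv3
  set D := fun n => iteratedDeriv n Q with hD
  have hDd : ∀ n x, HasDerivAt (D n) (D (n + 1) x) x := hQ.hasDerivAt_iter hκ hc
  have hQd : ∀ x, HasDerivAt Q (D 1 x) x := fun x => by simpa [hD] using hDd 0 x
  have hD1 : ∀ x, 0 < x → D 1 x < 0 := fun x hx => by
    simp only [hD, iteratedDeriv_one]
    exact hQ.deriv_neg hκ hc hev hx
  have hp := hQ.pos_sub hκ hc
  have hconst : ∀ {G : ℝ → ℝ}, (∀ x, HasDerivAt G 0 x) → Tendsto G atTop (𝓝 0) → ∀ x, G x = 0 := by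
    intro G hG hGt x
    have e : ∀ y, G y = G x := fun y =>
      is_const_of_deriv_eq_zero (fun z => (hG z).differentiableAt) (fun z => (hG z).deriv) y x
    exact tendsto_nhds_unique (tendsto_const_nhds.congr fun y => (e y).symm) hGt
  -- For $E=0$ the quantity $n=Mf'$ is constant and tends to zero, hence vanishes; the Wronskian
  -- below is then constant and vanishes in turn.
  set n : ℝ → ℝ := fun x => (D 2 x - 3 * Q x + (c - 2 * κ)) * f 1 x + D 1 x * f 2 x
    - (c - Q x) * f 3 x with hn
  have hnd : ∀ x, HasDerivAt n 0 x := fun x => by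
    refine (((((hDd 2 x).sub ((hQd x).const_mul 3)).add_const (c - 2 * κ)).mul (d1 x)).add
      ((hDd 1 x).mul (d2 x))).sub (((hQd x).const_sub c).mul (d3 x)) |>.congr_deriv ?_
    have := mul_inv_cancel₀ (hp x).ne'
    simp only [Pi.sub_apply]
    linear_combination (-(2 * iteratedDeriv 1 Q x * f 3 x
      + (2 * iteratedDeriv 2 Q x - 3 * Q x + (c - 2 * κ)) * f 2 x
      + (iteratedDeriv 3 Q x - 3 * iteratedDeriv 1 Q x) * f 1 x)) * this
  have hDt : ∀ j, j ≤ 5 → Tendsto (D j) atTop (𝓝 0) := fun j hj =>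
    (hQ.domBy hκ hc hev j hj).tendsto hQ.tendsto_atTop
  have hn0 := hconst hnd (by
    simpa using (((((hDt 2 (by norm_num)).sub (hQ.tendsto_atTop.const_mul 3)).add_const
      (c - 2 * κ)).mul (hf.tendsto 1)).add ((hDt 1 (by norm_num)).mul (hf.tendsto 2))).sub
      ((hQ.tendsto_atTop.const_sub c).mul (hf.tendsto 3)))
  set a : ℝ → ℝ := fun x => (c - Q x) * (f 1 x * D 2 x - f 2 x * D 1 x) with ha
  have had : ∀ x, HasDerivAt a 0 x := fun x => by
    refine (((hQd x).const_sub c).mul (((d1 x).mul (hDd 2 x)).sub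
      ((d2 x).mul (hDd 1 x)))).congr_deriv ?_
    have := hn0 x
    simp only [hn] at this
    simp only [Pi.sub_apply, Pi.mul_apply]
    linear_combination f 1 x * hQ.eq3 hκ hc x + D 1 x * this
  have ha0 := hconst had (by
    simpa using (hQ.tendsto_atTop.const_sub c).mul (((hf.tendsto 1).mul (hDt 2 (by norm_num))).sub
      ((hf.tendsto 2).mul (hDt 1 (by norm_num)))))
  have hW : ∀ x, f 1 x * D 2 x = f 2 x * D 1 x := fun x =>
    sub_eq_zero.1 ((mul_eq_zero.1 (ha0 x)).resolve_left (hp x).ne')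
  have hrd : ∀ x ∈ Set.Ioi (0 : ℝ), HasDerivAt (fun x => f 1 x / D 1 x) 0 x := fun x hx => by
    refine ((d1 x).div (hDd 1 x) (hD1 x hx).ne).congr_deriv ?_
    rw [div_eq_zero_iff]
    left
    linarith [hW x]
  have hr : ∀ x ∈ Set.Ioi (0 : ℝ), f 1 x = f 1 1 / D 1 1 * D 1 x := fun x hx => by
    have h := (convex_Ioi (0 : ℝ)).is_const_of_fderivWithin_eq_zero (𝕜 := ℝ)
      (f := fun x => f 1 x / D 1 x)
      (fun y hy => (hrd y hy).differentiableAt.differentiableWithinAt)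
      (fun y hy => by
        rw [fderivWithin_of_isOpen isOpen_Ioi hy]
        ext
        simp [(hrd y hy).deriv]) hx (Set.mem_Ioi.2 one_pos)
    change f 1 x / D 1 x = f 1 1 / D 1 1 at h
    rw [← h, div_mul_cancel₀ _ (hD1 x hx).ne]
  set r := f 1 1 / D 1 1
  have hf2 : ∀ x ∈ Set.Ioi (0 : ℝ), f 2 x = r * D 2 x := fun x hx => by
    have hx1 := (hD1 x hx).ne
    have h := hW x
    rw [hr x hx] at h
    exact mul_right_cancel₀ hx1 (by rw [← h]; ring)
  -- $f''=rQ''$ extends to the origin by continuity, where $f''$ vanishes but $Q''$ does not.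
  have hr0 : r = 0 := by
    have t1 : Tendsto (f 2) (𝓝[>] 0) (𝓝 (f 2 0)) :=
      (d2 0).continuousAt.tendsto.mono_left nhdsWithin_le_nhds
    have t2 : Tendsto (fun x => r * D 2 x) (𝓝[>] 0) (𝓝 (r * D 2 0)) :=
      (((hDd 2 0).continuousAt.tendsto).const_mul r).mono_left nhdsWithin_le_nhds
    have t3 := t1.congr' (Filter.eventually_of_mem self_mem_nhdsWithin hf2)
    have e := tendsto_nhds_unique t3 t2
    rw [h2] at e
    have h20 : D 2 0 ≠ 0 := by
      have := hQ.deriv2_neg hκ hc (deriv_zero_of_even hev)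
      simp only [hD]
      rw [iteratedDeriv_succ, iteratedDeriv_one]
      exact this.ne
    exact (mul_eq_zero.1 e.symm).resolve_right h20
  have z1 : ∀ x ∈ Set.Ioi (0 : ℝ), f 1 x = 0 := fun x hx => by rw [hr x hx, hr0, zero_mul]
  have z2 : ∀ x ∈ Set.Ioi (0 : ℝ), f 2 x = 0 := fun x hx => by rw [hf2 x hx, hr0, zero_mul]
  have z3 : f 3 1 = 0 := by
    have h : f 2 =ᶠ[𝓝 1] fun _ => 0 := by
      filter_upwards [Ioi_mem_nhds (one_pos : (0 : ℝ) < 1)] with x hx using z2 x hx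
    exact (d2 1).unique ((hasDerivAt_const 1 (0 : ℝ)).congr_of_eventuallyEq h)
  have z0 : f 0 1 = 0 := by
    have h : ∀ x ∈ Set.Ioi (0 : ℝ), f 0 x = f 0 1 := fun x hx =>
      (convex_Ioi (0 : ℝ)).is_const_of_fderivWithin_eq_zero (𝕜 := ℝ) (f := f 0)
        (fun y _ => (d0 y).differentiableAt.differentiableWithinAt)
        (fun y hy => by
          rw [fderivWithin_of_isOpen isOpen_Ioi hy]
          ext
          simp [(d0 y).deriv, z1 y hy]) hx (Set.mem_Ioi.2 one_pos)
    refine tendsto_nhds_unique (tendsto_const_nhds.congr' ?_) (hf.tendsto 0)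
    filter_upwards [eventually_gt_atTop 0] with x hx using (h x hx).symm
  refine hf.eq_zero hκ hc hQ hev (x₀ := 1) (fun j => ?_) x
  fin_cases j
  exacts [z0, z1 1 (Set.mem_Ioi.2 one_pos), z2 1 (Set.mem_Ioi.2 one_pos), z3]

theorem IsRep.apply_zero_of_odd {ψ : Sobolev 4} {F : Fin 4 → ℝ → ℂ} (hF : IsRep ψ F) {j : Fin 4}
    (h : jet 4 j.castSucc ψ ∈ L2odd) : F j 0 = 0 := by
  have hae : (fun x => F j (-x)) =ᵐ[volume] fun x => -F j x := by
    filter_upwards [hF.ae_eq j, neg_ae (hF.ae_eq j), h] with x h1 h2 h3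
    rw [← h1, ← h2, h3, neg_one_mul]
  have e := congrFun (((hF.continuous j).comp continuous_neg).ae_eq_iff_eq volume
    (hF.continuous j).neg |>.1 hae) 0
  change F j (-0) = -F j 0 at e
  rw [neg_zero] at e
  exact self_eq_neg.1 e

/-- `L` has no nonnegative eigenvalues on odd functions. -/
theorem opLodd_eq_zero (hκ : 0 < κ) (hc : 2 * κ < c) (hQ : IsSolitaryWave κ c Q)
    (hev : Function.Even Q) (hE : 0 ≤ E) {ψ : SobolevOdd 4}
    (hψ : opLodd hκ hc hQ hev ψ = (E : ℂ) • inclL2odd 4 ψ) : ψ = 0 := by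
  obtain ⟨F, hF⟩ := exists_isRep (oddIncl 4 ψ)
  obtain ⟨hre, him⟩ := hF.isDecaying hκ hc hQ (E := E) (congrArg Subtype.val hψ)
  obtain ⟨o0, o2, -⟩ := jet_odd ψ
  have z0 : F 0 0 = 0 := hF.apply_zero_of_odd (j := 0) o0
  have z2 : F 2 0 = 0 := hF.apply_zero_of_odd (j := 2) o2
  have hz : ∀ x, F 0 x = 0 := fun x => by
    rcases hE.eq_or_lt with rfl | hE'
    · exact Complex.ext (hre.eq_zero_of_kernel hκ hc hQ hev (by simp [z2]) x)
        (him.eq_zero_of_kernel hκ hc hQ hev (by simp [z2]) x)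
    · exact Complex.ext (hre.eq_zero_of_pos hκ hc hQ hev hE' (by simp [z0]) x)
        (him.eq_zero_of_pos hκ hc hQ hev hE' (by simp [z0]) x)
  have hj : jet 4 0 (oddIncl 4 ψ) = 0 := by
    rw [Lp.eq_zero_iff_ae_eq_zero]
    filter_upwards [hF.ae_eq 0] with x hx
    exact hx.trans (hz x)
  exact oddIncl_injective 4 (jet_zero_injective 4 (by rw [hj, map_zero, map_zero]))

/-- `Q'` as an odd `H⁴` function. -/
theorem exists_derivWave (hκ : 0 < κ) (hc : 2 * κ < c) (hQ : IsSolitaryWave κ c Q)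
    (hev : Function.Even Q) : ∃ u : SobolevOdd 4, ∀ j : Fin 5,
      jet 4 j (oddIncl 4 u) =ᵐ[volume] fun x => ((iteratedDeriv (j + 1) Q x : ℝ) : ℂ) := by
  have hm : ∀ j : Fin 5, MemLp (fun x => ((iteratedDeriv (j + 1) Q x : ℝ) : ℂ)) 2 := fun j =>
    (hQ.domBy hκ hc hev (j + 1) (by omega)).memLp hκ hc hQ hev
      (hQ.smooth_iter hκ hc (j + 1)).continuous
  refine ⟨⟨WithLp.toLp 2 fun j => (hm j).toLp _, fun j => ?_, ?_⟩, fun j => (hm j).coeFn_toLp⟩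
  · refine HasWeakDeriv.congr (IsPrimitive.of_hasDerivAt
      (F := fun x => ((iteratedDeriv ((j.castSucc : Fin 5) + 1) Q x : ℝ) : ℂ))
      (g := fun x => ((iteratedDeriv ((j.succ : Fin 5) + 1) Q x : ℝ) : ℂ)) (fun x => ?_)
      ?_).hasWeakDeriv (hm j.castSucc).coeFn_toLp (hm j.succ).coeFn_toLp
    · exact (hQ.hasDerivAt_iter hκ hc (j + 1) x).ofReal_comp
    · exact Complex.continuous_ofReal.comp (hQ.smooth_iter hκ hc _).continuous
  · have h := (hm 0).coeFn_toLp
    have h1 : ∀ x, iteratedDeriv 1 Q (-x) = -iteratedDeriv 1 Q x := fun x => by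
      have := waveDeriv_parity hκ hc hQ hev 1 x
      change iteratedDeriv 1 Q (-x) = (-1) ^ 1 * iteratedDeriv 1 Q x at this
      simpa using this
    filter_upwards [h, neg_ae h] with x e1 e2
    refine e2.trans (Eq.trans ?_ (congrArg (fun z => -1 * z) e1.symm))
    change ((iteratedDeriv 1 Q (-x) : ℝ) : ℂ) = -1 * ((iteratedDeriv 1 Q x : ℝ) : ℂ)
    rw [h1]
    simp

/-- The quadratic form of `L` vanishes at some nonzero odd function, namely at `Q'`. -/
theorem exists_qform_eq_zero (hκ : 0 < κ) (hc : 2 * κ < c) (hQ : IsSolitaryWave κ c Q)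
    (hev : Function.Even Q) : ∃ u : SobolevOdd 4, u ≠ 0 ∧
      qform (inclL2odd 4) (opLodd hκ hc hQ hev) u = 0 := by
  obtain ⟨u, hu⟩ := exists_derivWave hκ hc hQ hev
  refine ⟨u, ?_, ?_⟩
  · rintro rfl
    have h := hu 0
    rw [map_zero, map_zero] at h
    have h0 : (fun x => ((iteratedDeriv 1 Q x : ℝ) : ℂ)) =ᵐ[volume] fun _ => 0 :=
      h.symm.trans (Lp.coeFn_zero ℂ 2 volume)
    have e := congrFun ((Continuous.ae_eq_iff_eq volume (Complex.continuous_ofReal.comp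
      (hQ.smooth_iter hκ hc 1).continuous) continuous_const).1 h0) 1
    have e1 : iteratedDeriv 1 Q 1 = 0 := Complex.ofReal_eq_zero.1 e
    rw [iteratedDeriv_one] at e1
    exact (hQ.deriv_neg hκ hc hev one_pos).ne e1
  · set D := fun n => iteratedDeriv n Q with hD
    have hDd : ∀ n x, HasDerivAt (D n) (D (n + 1) x) x := hQ.hasDerivAt_iter hκ hc
    have hQd : ∀ x, HasDerivAt Q (D 1 x) x := fun x => by simpa [hD] using hDd 0 x
    have i2 := integrable_mul_norm_sq (coefP hκ hc hQ) (jet 4 2 (oddIncl 4 u))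
    have i1 := integrable_mul_norm_sq (coefV hκ hc hQ) (jet 4 1 (oddIncl 4 u))
    rw [qform_opLodd, qform_opL, ← integral_add i2 i1]
    have hae : (fun x => coefP hκ hc hQ x * ‖jet 4 2 (oddIncl 4 u) x‖ ^ 2
        + coefV hκ hc hQ x * ‖jet 4 1 (oddIncl 4 u) x‖ ^ 2) =ᵐ[volume] fun x =>
        (c - Q x) * D 3 x ^ 2 + (D 2 x - 3 * Q x + (c - 2 * κ)) * D 2 x ^ 2 := by
      filter_upwards [hu 2, hu 1] with x h2 h1
      rw [h2, h1, coefP_apply, coefV_apply, Complex.norm_real, Complex.norm_real,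
        Real.norm_eq_abs, Real.norm_eq_abs, sq_abs, sq_abs]
      rfl
    have hi := (i2.add i1).congr hae
    rw [integral_congr_ae hae]
    -- Differentiating $MQ'=0$ gives $MQ''=3Q'^2-Q''^2-2Q'Q'''$, so $Q''MQ''=(Q'^3-Q'Q''^2)'$. The
    -- integrand $pQ'''^2+VQ''^2$ equals $(pQ''Q''')'+Q''MQ''$, an exact derivative.
    have hW : ∀ x, HasDerivAt (fun x => (c - Q x) * (D 2 x * D 3 x) - D 1 x * D 2 x ^ 2 + D 1 x ^ 3)
        ((c - Q x) * D 3 x ^ 2 + (D 2 x - 3 * Q x + (c - 2 * κ)) * D 2 x ^ 2) x := fun x => by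
      refine (((((hQd x).const_sub c).mul ((hDd 2 x).mul (hDd 3 x))).sub
        ((hDd 1 x).mul ((hDd 2 x).pow 2))).add ((hDd 1 x).pow 3)).congr_deriv ?_
      simp only [Pi.mul_apply, Pi.pow_apply]
      push_cast
      linear_combination D 2 x * hQ.eq4 hκ hc x
    have ht : ∀ l : Filter ℝ, Tendsto Q l (𝓝 0) → Tendsto (fun x =>
        (c - Q x) * (D 2 x * D 3 x) - D 1 x * D 2 x ^ 2 + D 1 x ^ 3) l (𝓝 0) := fun l hl => by
      have t : ∀ j, j ≤ 5 → Tendsto (D j) l (𝓝 0) := fun j hj =>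
        (hQ.domBy hκ hc hev j hj).tendsto hl
      have t1 := t 1 (by norm_num)
      have t2 := t 2 (by norm_num)
      have t3 := t 3 (by norm_num)
      simpa using (((hl.const_sub c).mul (t2.mul t3)).sub (t1.mul (t2.pow 2))).add (t1.pow 3)
    have hbot : Tendsto Q atBot (𝓝 0) := by
      have := hQ.tendsto_atTop.comp tendsto_neg_atBot_atTop
      exact this.congr fun x => hev x
    rw [integral_of_hasDerivAt_of_tendsto hW hi (ht _ hbot) (ht _ hQ.tendsto_atTop), sub_zero]

end Kernel

/-- A symmetric operator has no generalized eigenvectors of rank two. -/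
theorem IsSymm.eq_zero_of_sub_eq {H D : Type*} [NormedAddCommGroup H] [InnerProductSpace ℂ H]
    [AddCommGroup D] [Module ℂ D] {i A : D →ₗ[ℂ] H} (hs : IsSymm i A) {φ g : D} {lam : ℝ} {a : ℂ}
    (h : A φ = (lam : ℂ) • i φ) (hg : A g - (lam : ℂ) • i g = a • i φ) (hφ : i φ ≠ 0) : a = 0 := by
  have e := congrArg (fun z => inner ℂ (i φ) z) hg
  simp only [inner_sub_right, inner_smul_right] at e
  rw [hs, h, inner_smul_left, Complex.conj_ofReal, sub_self] at e
  exact (mul_eq_zero.1 e.symm).resolve_right (inner_self_ne_zero.2 hφ)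

/-! ### The matrix operator -/

theorem X.mk_inj {f f' : L2odd} {g g' : SobolevOdd 2} :
    X.mk f g = X.mk f' g' ↔ f = f' ∧ g = g' :=
  ⟨fun h => ⟨congrArg WithLp.fst h, congrArg WithLp.snd h⟩, fun h => by rw [h.1, h.2]⟩

theorem inclL2odd_inclOdd (g : SobolevOdd 4) :
    inclL2odd 2 (inclOdd (by norm_num : 2 ≤ 4) g) = inclL2odd 4 g := rfl

/-- The inclusion `H^k_odd(ℝ) ⊆ L²_odd(ℝ)` is continuous. -/
def inclL2oddL (k : ℕ) : SobolevOdd k →L[ℂ] L2odd :=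
  ⟨inclL2odd k, ((PiLp.continuous_apply 2 _ 0).comp continuous_subtype_val).subtype_mk _⟩

/-- The first component of an element of `X`. -/
def X.fstL : X →L[ℂ] L2odd :=
  LinearMap.mkContinuous ⟨⟨fun W => WithLp.fst W, fun _ _ => rfl⟩, fun _ _ => rfl⟩ 1 fun W => by
    have := X.norm_mk (WithLp.fst W) (WithLp.snd W)
    change ‖W‖ = _ at this
    rw [this, one_mul]
    exact le_add_of_nonneg_right (norm_nonneg _)

/-- The second component of an element of `X`. -/
def X.sndL : X →L[ℂ] SobolevOdd 2 :=
  LinearMap.mkContinuous ⟨⟨fun W => WithLp.snd W, fun _ _ => rfl⟩, fun _ _ => rfl⟩ 1 fun W => by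
    have := X.norm_mk (WithLp.fst W) (WithLp.snd W)
    change ‖W‖ = _ at this
    rw [this, one_mul]
    exact le_add_of_nonneg_left (norm_nonneg _)

/-- The map `f ↦ (f, 0)`. -/
def X.inlL : L2odd →L[ℂ] X :=
  LinearMap.mkContinuous ⟨⟨fun f => X.mk f 0, fun f g => X.mk_inj.2 ⟨rfl, (add_zero 0).symm⟩⟩,
    fun a f => X.mk_inj.2 ⟨rfl, (smul_zero a).symm⟩⟩ 1 fun f => by
      refine (X.norm_mk f 0).le.trans ?_
      rw [norm_zero, add_zero, one_mul]

/-- The map `g ↦ (0, g)`. -/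
def X.inrL : SobolevOdd 2 →L[ℂ] X :=
  LinearMap.mkContinuous ⟨⟨fun g => X.mk 0 g, fun f g => X.mk_inj.2 ⟨(add_zero 0).symm, rfl⟩⟩,
    fun a f => X.mk_inj.2 ⟨(smul_zero a).symm, rfl⟩⟩ 1 fun g => by
      refine (X.norm_mk 0 g).le.trans ?_
      rw [norm_zero, zero_add, one_mul]

theorem X.inlL_add_inrL (f : L2odd) (g : SobolevOdd 2) : X.inlL f + X.inrL g = X.mk f g :=
  X.mk_inj.2 ⟨add_zero f, zero_add g⟩

section Matrix

variable {κ c : ℝ} {Q : ℝ → ℝ}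

theorem opCurlyL_sub (hκ : 0 < κ) (hc : 2 * κ < c) (hQ : IsSolitaryWave κ c Q)
    (hev : Function.Even Q) (μ : ℂ) (f : SobolevOdd 2) (g : SobolevOdd 4) :
    opCurlyL hκ hc hQ hev (Y.mk f g) - μ • inclYX (Y.mk f g)
      = X.mk (opLodd hκ hc hQ hev g - μ • inclL2odd 2 f)
        (f - μ • inclOdd (by norm_num : 2 ≤ 4) g) := rfl

/-- `μ` is an eigenvalue of `𝓛` iff `μ²` is an eigenvalue of `L` on odd functions. -/
theorem isEigenvalue_curlyL_iff (hκ : 0 < κ) (hc : 2 * κ < c) (hQ : IsSolitaryWave κ c Q)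
    (hev : Function.Even Q) (μ : ℂ) : IsEigenvalue (curlyL hκ hc hQ hev) μ ↔
      ∃ g : SobolevOdd 4, g ≠ 0 ∧ opLodd hκ hc hQ hev g = μ ^ 2 • inclL2odd 4 g := by
  rw [curlyL, isEigenvalue_unbounded_iff]
  constructor
  · rintro ⟨W, hW, h⟩
    obtain ⟨f, g, rfl⟩ : ∃ f g, W = Y.mk f g := ⟨WithLp.fst W, WithLp.snd W, rfl⟩
    have e := sub_eq_zero.2 h
    rw [opCurlyL_sub] at e
    obtain ⟨e1, e2⟩ := X.mk_inj.1 (e.trans (rfl : (0 : X) = X.mk 0 0))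
    rw [sub_eq_zero] at e1 e2
    refine ⟨g, ?_, ?_⟩
    · rintro rfl
      rw [map_zero, smul_zero] at e2
      exact hW (by rw [e2]; rfl)
    · rw [e1, e2, map_smul, smul_smul, ← sq, inclL2odd_inclOdd]
  · rintro ⟨g, hg, h⟩
    refine ⟨Y.mk (μ • inclOdd (by norm_num : 2 ≤ 4) g) g, fun h0 => hg (congrArg WithLp.snd h0), ?_⟩
    rw [← sub_eq_zero, opCurlyL_sub]
    refine X.mk_inj.2 ⟨?_, sub_self _⟩
    rw [h, map_smul, smul_smul, ← sq, inclL2odd_inclOdd, sub_self]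

/-- The square roots of a simple negative eigenvalue of `L` are simple eigenvalues of `𝓛`. -/
theorem isSimpleEigenvalue_curlyL (hκ : 0 < κ) (hc : 2 * κ < c) (hQ : IsSolitaryWave κ c Q)
    (hev : Function.Even Q) {lam : ℝ} (hlam : lam < 0) {φ : SobolevOdd 4} (hφ : φ ≠ 0)
    (h : opLodd hκ hc hQ hev φ = (lam : ℂ) • inclL2odd 4 φ) {μ : ℂ} (hμ : μ ^ 2 = lam) :
    IsSimpleEigenvalue (curlyL hκ hc hQ hev) μ := by
  have hi := inclL2odd_injective 4
  have hs := isSymm_opLodd hκ hc hQ hev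
  have hn := negIndexLeOne_opLodd hκ hc hQ hev
  have hμ0 : μ ≠ 0 := by
    rintro rfl
    rw [zero_pow two_ne_zero] at hμ
    exact hlam.ne (Complex.ofReal_eq_zero.1 hμ.symm)
  let j : SobolevOdd 4 →ₗ[ℂ] SobolevOdd 2 := inclOdd (by norm_num)
  have hij : ∀ g, inclL2odd 2 (j g) = inclL2odd 4 g := fun _ => rfl
  have hmk : ∀ b : ℂ, inclYX (Y.mk (μ • j (b • φ)) (b • φ))
      = b • inclYX (Y.mk (μ • j φ) φ) := fun b => by
    have e : Y.mk (μ • j (b • φ)) (b • φ) = b • Y.mk (μ • j φ) φ := by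
      rw [map_smul, smul_comm]
      rfl
    rw [e, map_smul]
  refine ⟨inclYX (Y.mk (μ • j φ) φ), fun h0 => hφ ?_, fun x => ⟨?_, ?_⟩⟩
  · have := inclYX_injective (h0.trans (map_zero inclYX).symm)
    exact congrArg WithLp.snd this
  · rintro ⟨n, hx⟩
    induction n generalizing x with
    | zero => exact ⟨0, by rw [zero_smul]; exact hx⟩
    | succ n ih =>
      rw [curlyL, inKerPow_succ_unbounded_iff] at hx
      obtain ⟨W, rfl, hW⟩ := hx
      obtain ⟨f, g, rfl⟩ : ∃ f g, W = Y.mk f g := ⟨WithLp.fst W, WithLp.snd W, rfl⟩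
      obtain ⟨a, ha⟩ := ih _ hW
      rw [opCurlyL_sub] at ha
      obtain ⟨e1, e2⟩ := X.mk_inj.1 (ha.trans
        (rfl : _ = X.mk (a • inclL2odd 2 (μ • j φ)) (a • j φ)))
      -- By induction $(\mathcal L-\mu)W$ is $a$ times the eigenvector $(\mu\varphi,\varphi)$.
      -- Eliminating $f$ gives $(L-\mu^2)g=2a\mu\varphi$; pairing with $\varphi$ yields $a=0$, as
      -- $\mu\ne0$.
      have ef : f = μ • j g + a • j φ := sub_eq_iff_eq_add'.1 e2
      have e3 : opLodd hκ hc hQ hev g - (lam : ℂ) • inclL2odd 4 g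
          = (2 * a * μ) • inclL2odd 4 φ := by
        rw [ef] at e1
        simp only [map_add, map_smul, hij] at e1
        rw [← hμ]
        rw [sub_eq_iff_eq_add] at e1 ⊢
        rw [e1]
        module
      have ha0 : a = 0 := by
        have := hs.eq_zero_of_sub_eq h e3 fun h0 => hφ (hi (h0.trans (map_zero _).symm))
        simpa [hμ0] using this
      rw [ha0, mul_zero, zero_mul, zero_smul, sub_eq_zero] at e3
      rw [ha0, zero_smul, add_zero] at ef
      obtain ⟨b, hb⟩ : ∃ b : ℂ, g = b • φ := by
        by_cases hg : g = 0
        · exact ⟨0, by rw [hg, zero_smul]⟩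
        · exact (eigen_unique hi hs hn hlam hlam hφ hg h e3).2
      exact ⟨b, by rw [ef, hb, hmk]⟩
  · rintro ⟨a, rfl⟩
    refine ⟨1, ?_⟩
    rw [curlyL, inKerPow_succ_unbounded_iff]
    refine ⟨_, hmk a, ?_⟩
    rw [opCurlyL_sub]
    refine X.mk_inj.2 ⟨?_, sub_self _⟩
    rw [map_smul (inclL2odd 2), hij, map_smul, map_smul, h, ← hμ]
    module

/-- `𝓛 - μ` is boundedly invertible iff `L - μ²` is, on odd functions. -/
theorem mem_resolventSet_curlyL_iff (hκ : 0 < κ) (hc : 2 * κ < c) (hQ : IsSolitaryWave κ c Q)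
    (hev : Function.Even Q) (μ : ℂ) : μ ∈ resolventSet (curlyL hκ hc hQ hev) ↔
      μ ^ 2 ∈ resolventSet (Lodd hκ hc hQ hev) := by
  rw [curlyL, Lodd, mem_resolventSet_unbounded_iff, mem_resolventSet_unbounded_iff]
  let j : SobolevOdd 4 →ₗ[ℂ] SobolevOdd 2 := inclOdd (by norm_num)
  have hij : ∀ g, inclL2odd 2 (j g) = inclL2odd 4 g := fun _ => rfl
  constructor
  · rintro ⟨R, h1, h2⟩
    -- For the right-hand side $(y,0)$ the second equation gives $f=\mu g$, so the second component
    -- $g$ of the solution satisfies $(L-\mu^2)g=y$.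
    refine ⟨inclL2oddL 2 ∘L X.sndL ∘L R ∘L X.inlL, fun y => ?_, fun d => ?_⟩
    · obtain ⟨W, e1, e2⟩ := h1 (X.inlL y)
      obtain ⟨f, g, rfl⟩ : ∃ f g, W = Y.mk f g := ⟨WithLp.fst W, WithLp.snd W, rfl⟩
      rw [opCurlyL_sub] at e2
      obtain ⟨e3, e4⟩ := X.mk_inj.1 (e2.trans (rfl : X.inlL y = X.mk y 0))
      refine ⟨g, ?_, ?_⟩
      · change inclL2odd 4 g = inclL2oddL 2 (X.sndL (R (X.inlL y)))
        rw [← e1]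
        rfl
      · rw [sub_eq_zero.1 e4] at e3
        rw [← e3, map_smul, smul_smul, ← sq, inclL2odd_inclOdd]
    · have e := h2 (Y.mk (μ • j d) d)
      rw [opCurlyL_sub] at e
      have e1 : X.mk (opLodd hκ hc hQ hev d - μ • inclL2odd 2 (μ • j d)) (μ • j d - μ • j d)
          = X.inlL (opLodd hκ hc hQ hev d - μ ^ 2 • inclL2odd 4 d) := by
        refine X.mk_inj.2 ⟨?_, sub_self _⟩
        rw [map_smul, smul_smul, ← sq, hij]
      change inclL2oddL 2 (X.sndL (R (X.inlL _))) = _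
      rw [← e1]
      exact congrArg (fun W => inclL2oddL 2 (X.sndL W)) e
  · rintro ⟨R, h1, h2⟩
    choose S hS1 hS2 using h1
    have hi := inclL2odd_injective 4
    let T : L2odd →ₗ[ℂ] SobolevOdd 2 :=
      { toFun := fun y => j (S y)
        map_add' := fun y z => by
          rw [← map_add]
          exact congrArg j (hi (by rw [map_add, hS1, hS1, hS1, map_add]))
        map_smul' := fun a y => by
          rw [RingHom.id_apply, ← map_smul]
          exact congrArg j (hi (by rw [map_smul, hS1, hS1, map_smul])) }
    have hT : ∀ y, inclL2oddL 2 (T y) = R y := fun y => (hij (S y)).trans (hS1 y)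
    -- $(L-\mu^2)^{-1}$ is bounded into $L^2$ with values in $H^4\subset H^2$. The closed graph
    -- theorem makes it bounded into $H^2$, which the second component of `X` requires.
    have hTc : Continuous T := LinearMap.continuous_of_seq_closed_graph T fun u x y hu hTu => by
      refine inclL2odd_injective 2 ?_
      have t1 := ((inclL2oddL 2).continuous.tendsto y).comp hTu
      have t2 := (R.continuous.tendsto x).comp hu
      have e : (inclL2oddL 2 : SobolevOdd 2 → L2odd) ∘ (T ∘ u) = R ∘ u := funext fun k => hT (u k)
      rw [e] at t1
      exact (tendsto_nhds_unique t1 t2).trans (hT x).symm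
    let T' : L2odd →L[ℂ] SobolevOdd 2 := ⟨T, hTc⟩
    let P : X →L[ℂ] L2odd := X.fstL + μ • (inclL2oddL 2 ∘L X.sndL)
    refine ⟨X.inlL ∘L (inclL2oddL 2 ∘L X.sndL + μ • (R ∘L P)) + X.inrL ∘L T' ∘L P,
      fun y => ?_, fun W => ?_⟩
    · obtain ⟨f, g, rfl⟩ : ∃ f g, y = X.mk f g := ⟨WithLp.fst y, WithLp.snd y, rfl⟩
      -- Solving $Lg'-\mu f'=f$, $f'-\mu g'=g$: substituting $f'=g+\mu g'$ leaves $(L-\mu^2)g'=f+\mu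
      -- g$.
      set z : L2odd := f + μ • inclL2odd 2 g with hz
      refine ⟨Y.mk (g + μ • j (S z)) (S z), ?_, ?_⟩
      · refine Eq.trans ?_ (X.inlL_add_inrL (inclL2odd 2 g + μ • R z) (T z)).symm
        refine X.mk_inj.2 ⟨?_, rfl⟩
        change inclL2odd 2 (g + μ • j (S z)) = _
        rw [map_add, map_smul, hij, hS1]
      · rw [opCurlyL_sub]
        refine X.mk_inj.2 ⟨?_, add_sub_cancel_right _ _⟩
        have e := hS2 z
        rw [map_add, map_smul, hij]
        rw [sub_eq_iff_eq_add] at e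
        rw [e, hz]
        module
    · obtain ⟨f, g, rfl⟩ : ∃ f g, W = Y.mk f g := ⟨WithLp.fst W, WithLp.snd W, rfl⟩
      rw [opCurlyL_sub]
      set y₁ := opLodd hκ hc hQ hev g - μ • inclL2odd 2 f with hy₁
      set y₂ := f - μ • j g with hy₂
      have hz : y₁ + μ • inclL2odd 2 y₂ = opLodd hκ hc hQ hev g - μ ^ 2 • inclL2odd 4 g := by
        rw [hy₁, hy₂, map_sub, map_smul, hij]
        module
      have hR : R (y₁ + μ • inclL2odd 2 y₂) = inclL2odd 4 g := by rw [hz, h2]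
      have hSg : S (y₁ + μ • inclL2odd 2 y₂) = g := hi (by rw [hS1, hR])
      refine Eq.trans (X.inlL_add_inrL (inclL2odd 2 y₂ + μ • R (y₁ + μ • inclL2odd 2 y₂))
        (T (y₁ + μ • inclL2odd 2 y₂))) ?_
      refine X.mk_inj.2 ⟨?_, congrArg j hSg⟩
      rw [hR, hy₂, map_sub, map_smul, hij, sub_add_cancel]
      rfl

end Matrix

end CHKP
end

/-! ### The spectrum of $\mathcal L$ -/

theorem mainTheorem6 (κ c : ℝ) (hκ : 0 < κ) (hc : 2 * κ < c) (Q : ℝ → ℝ)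
    (hQ : CHKP.IsSolitaryWave κ c Q) (hev : Function.Even Q) :
    ∃ lam : ℝ, lam < 0 ∧
      -- `lam` is the single negative eigenvalue of `L`
      (∀ ν : ℝ, ν < 0 → (CHKP.IsEigenvalue (CHKP.L hκ hc hQ) (ν : ℂ) ↔ ν = lam)) ∧
      -- the eigenvalues of `𝓛` are exactly `± i √|lam|`, and they are simple
      (∀ μ : ℂ, CHKP.IsEigenvalue (CHKP.curlyL hκ hc hQ hev) μ ↔
        μ = Complex.I * (√|lam| : ℝ) ∨ μ = -(Complex.I * (√|lam| : ℝ))) ∧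
      CHKP.IsSimpleEigenvalue (CHKP.curlyL hκ hc hQ hev) (Complex.I * (√|lam| : ℝ)) ∧
      CHKP.IsSimpleEigenvalue (CHKP.curlyL hκ hc hQ hev) (-(Complex.I * (√|lam| : ℝ))) ∧
      -- the rest of the spectrum of `𝓛` is real
      (∀ μ ∈ CHKP.spectrum (CHKP.curlyL hκ hc hQ hev), μ ≠ Complex.I * (√|lam| : ℝ) →
        μ ≠ -(Complex.I * (√|lam| : ℝ)) → μ.im = 0) ∧
      -- the resolvent sets of `𝓛` and of `L` on odd functions
      (∀ μ : ℂ, μ ∈ CHKP.resolventSet (CHKP.curlyL hκ hc hQ hev) ↔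
        μ ^ 2 ∈ CHKP.resolventSet (CHKP.Lodd hκ hc hQ hev)) := by
  open CHKP in
  have hi := inclL2odd_injective 4
  have hs := isSymm_opLodd hκ hc hQ hev
  have hn := negIndexLeOne_opLodd hκ hc hQ hev
  have hco := coerciveOnto_opLodd hκ hc hQ hev
  obtain ⟨u, hu, hqu⟩ := exists_qform_eq_zero hκ hc hQ hev
  obtain ⟨lam, hlam, φ, hφ, hAφ⟩ := exists_neg_eigenvalue hi hs hn hco
    (fun d hd => opLodd_eq_zero hκ hc hQ hev le_rfl (by simpa using hd)) hu hqu
  have hsq : ∀ μ : ℂ, μ ^ 2 = lam ↔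
      μ = Complex.I * (√|lam| : ℝ) ∨ μ = -(Complex.I * (√|lam| : ℝ)) := fun μ => by
    have e : (Complex.I * (√|lam| : ℝ)) ^ 2 = (lam : ℂ) := by
      rw [mul_pow, Complex.I_sq, ← Complex.ofReal_pow, Real.sq_sqrt (abs_nonneg _),
        abs_of_neg hlam]
      simp
    rw [← e]
    exact sq_eq_sq_iff_eq_or_eq_neg
  -- Uniqueness on odd functions; for $L$ on the whole space it is obtained below from the form on
  -- all of $H^4$, where the form also has at most one negative direction.
  have huniq : ∀ (r : ℝ) (d : SobolevOdd 4), r < 0 → d ≠ 0 →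
      opLodd hκ hc hQ hev d = (r : ℂ) • inclL2odd 4 d → r = lam := fun r d hr hd h =>
    (eigen_unique hi hs hn hr hlam hd hφ h hAφ).1
  refine ⟨lam, hlam, fun ν hν => ?_, fun μ => ?_, ?_, ?_, fun μ hμ h1 h2 => ?_,
    mem_resolventSet_curlyL_iff hκ hc hQ hev⟩
  · have hφ' : oddIncl 4 φ ≠ 0 := fun h => hφ (oddIncl_injective 4 (h.trans (map_zero _).symm))
    have hAφ' : opL hκ hc hQ (oddIncl 4 φ) = (lam : ℂ) • jet 4 0 (oddIncl 4 φ) :=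
      congrArg Subtype.val hAφ
    rw [CHKP.L, isEigenvalue_unbounded_iff]
    constructor
    · rintro ⟨d, hd, h⟩
      exact (eigen_unique (jet_zero_injective 4) (isSymm_opL hκ hc hQ)
        (negIndexLeOne_opL hκ hc hQ hev) hν hlam hd hφ' h hAφ').1
    · rintro rfl
      exact ⟨_, hφ', hAφ'⟩
  · rw [isEigenvalue_curlyL_iff, ← hsq]
    constructor
    · rintro ⟨g, hg, h⟩
      have him := hs.eigenvalue_im hi hg h
      have hre : μ ^ 2 = ((μ ^ 2).re : ℂ) := Complex.ext rfl (by simpa using him)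
      rw [hre] at h ⊢
      rcases lt_or_ge (μ ^ 2).re 0 with hr | hr
      · rw [huniq _ g hr hg h]
      · exact (hg (opLodd_eq_zero hκ hc hQ hev hr h)).elim
    · intro h
      exact ⟨φ, hφ, by rw [h, hAφ]⟩
  · exact isSimpleEigenvalue_curlyL hκ hc hQ hev hlam hφ hAφ ((hsq _).2 (Or.inl rfl))
  · exact isSimpleEigenvalue_curlyL hκ hc hQ hev hlam hφ hAφ ((hsq _).2 (Or.inr rfl))
  · have hres : μ ^ 2 ∉ resolventSet (Lodd hκ hc hQ hev) := fun h =>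
      hμ ((mem_resolventSet_curlyL_iff hκ hc hQ hev μ).2 h)
    have him : (μ ^ 2).im = 0 := by
      by_contra h
      exact hres (mem_resolventSet_of_im_ne_zero hi hs hco h)
    have hre : μ ^ 2 = ((μ ^ 2).re : ℂ) := Complex.ext rfl (by simpa using him)
    -- A negative $\mu^2$ outside the resolvent set would have to be an eigenvalue, hence $\lambda$,
    -- and $\mu$ would be one of the two excluded points.
    have hr : 0 ≤ (μ ^ 2).re := by
      by_contra! hr
      rw [hre] at hres
      refine hres (mem_resolventSet_of_neg hi hs hn hco hr fun d hd => ?_)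
      by_contra hd0
      rw [huniq _ d hr hd0 hd] at hre
      rcases (hsq μ).1 hre with h | h
      exacts [h1 h, h2 h]
    rw [sq, Complex.mul_im] at him
    rw [sq, Complex.mul_re] at hr
    by_contra h
    have h0 : μ.re = 0 := by
      have : 2 * (μ.re * μ.im) = 0 := by linarith
      exact (mul_eq_zero.1 ((mul_eq_zero.1 this).resolve_left two_ne_zero)).resolve_right h
    rw [h0] at hr
    have := mul_self_pos.2 h
    linarith
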